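/- Let $k$ be a commutative ring. A *double algebra* over $k$ is a $k$-module $A$ with two associative unital $k$-algebra structures $V=\langle A,\circ,e\rangle$ and $H=\langle A,\star,i\rangle$ such that for all $a,b\in A$ $$\begin{aligned} (a\star e)\circ b&=((a\star e)\circ i)\star b, & a\circ(b\star e)&=(i\circ(b\star e))\star a,\\ (a\circ i)\star b&=((a\circ i)\star e)\circ b, & a\star(b\circ i)&=(e\star(b\circ i))\circ a,\\ a\circ(e\star b)&=a\star(i\circ(e\star b)), & (e\star a)\circ b&=b\star((e\star a)\circ i),\\ a\star(i\circ b)&=a\circ(e\star(i\circ b)), & (i\circ a)\star b&=b\circ((i\circ a)\star e). \end{aligned}$$ Put $\Phi_L(a)=a\star e$, $\Phi_R(a)=e\star a$, $\Phi_B(a)=a\circ i$, $\Phi_T(a)=i\circ a$. Their images $L,R$ are subalgebras of $V$ and $B,T$ are subalgebras of $H$. The double algebra is *Frobenius* if each of $\Phi_L,\Phi_R\colon V\to L,R$ and $\Phi_B,\Phi_T\colon H\to B,T$ is a Frobenius homomorphism; here $\Phi\colon X\to S$, with $S$ a subalgebra of $X$, is a Frobenius homomorphism if it is an $S$-$S$-bimodule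 map and there are finitely many $x_j,y_j\in X$ with $\sum_j\Phi(ax_j)y_j=a=\sum_j x_j\Phi(y_ja)$ for all $a\in X$. Let $\sum_k u_k\otimes v_k$ and $\sum_j x_j\otimes y_j$ be the dual bases of $\Phi_B$ and $\Phi_L$. An *antipode* is a $k$-linear map $S\colon A\to A$ such that for all $a,a',a''\in A$ $$\begin{aligned} \Phi_B(a'\star(a''\circ a))&=\Phi_B((a'\circ S(a))\star a''), & \Phi_R(a'\circ(a\star a''))&=\Phi_R((S(a)\star a')\circ a''),\\ \Phi_L((a'\star a)\circ a'')&=\Phi_L(a'\circ(a''\star S(a))), & \Phi_T((a\circ a')\star a'')&=\Phi_T(a'\star(S(a)\circ a'')). \end{aligned}$$ A *left (right) almost bialgebroid* $\langle\mathcal A,\mathcal B,s,t,\Delta,\varepsilon\rangle$ is a structure satisfying all the axioms of a left (right) bialgebroid (including the Takeuchi property and unitality of $\Delta$ and $\varepsilon$) except possibly multiplicativity of $\Delta$. The bimodule structures are $b\cdot a\cdot b'=s(b)t(b')a$ in the left case and $b\cdot a\cdot b'=a\,t(b)s(b')$ in the right case. If a left almost bialgebroid is finitely generated projective as a left and as a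 right $\mathcal B$-module, its left dual and right dual are the right almost bialgebroids over $\mathcal B$ on $$\overleftarrow{\mathcal A}=\{\phi\colon\mathcal A\to\mathcal B \mid \phi(t(b)a)=\phi(a)b\},\qquad \overrightarrow{\mathcal A}=\{\phi\colon\mathcal A\to\mathcal B\mid \phi(s(b)a)=b\,\phi(a)\}$$ (the maps $\phi$ being $k$-linear), with unit $\varepsilon$, counit $\psi\mapsto\psi(1)$, and respectively $$\begin{array}{lll} &\overleftarrow{\mathcal A} & \overrightarrow{\mathcal A}\\ \text{product} & (\phi\psi)(a)=\psi(s(\phi(a_{(1)}))a_{(2)}) & (\phi\psi)(a)=\psi(t(\phi(a_{(2)}))a_{(1)})\\ \text{source} & \overleftarrow s(b)(a)=\varepsilon(a\,t(b)) & \overrightarrow s(b)(a)=\varepsilon(a)b\\ \text{target} & \overleftarrow t(b)(a)=b\,\varepsilon(a) & \overrightarrow t(b)(a)=\varepsilon(a\,s(b))\\ \text{coproduct} & \psi(aa')=\psi^{(1)}(a\,t(\psi^{(2)}(a'))) & \psi(aa')=\psi^{(2)}(a\,s(\psi^{(1)}(a'))) \end{array}$$ An isomorphism of right almost bialgebroids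 is a pair $(F,f)$ of $k$-algebra isomorphisms of the total and of the base algebras that commutes with the source maps, target maps, coproducts (via $F\otimes F$) and counits. For a Frobenius double algebra $A$, $$V_B=\langle V,B,\Phi_L|_B,\Phi_R|_B,\Delta_B,\Phi_B\rangle,\quad \Delta_B(a)=\sum_k a\star u_k\otimes_B v_k,$$ is a left almost bialgebroid, finitely generated projective on both sides over $B$, and $$H_L^{\mathrm{op}}=\langle H^{\mathrm{op}},L,\Phi_T|_L,\Phi_B|_L,\Delta_L,\Phi_L\rangle,\quad \Delta_L(a)=\sum_j a\circ x_j\otimes_L y_j,$$ is a right almost bialgebroid. Define $$\overleftarrow\kappa\colon H\to\overleftarrow{V_B},\ h\mapsto\Phi_B(h\star\_),\qquad \overrightarrow\kappa\colon H\to\overrightarrow{V_B},\ h\mapsto\Phi_B\Phi_L(\_\circ h).$$ **Proposition.** For any Frobenius double algebra $A$, the two pairs of maps $$(\overleftarrow\kappa,\Phi_B|_L)\colon H_L^{\mathrm{op}}\to\overleftarrow{V_B}\qquad\text{and}\qquad(\overrightarrow\kappa,\Phi_B|_L)\colon H_L^{\mathrm{op}}\to\overrightarrow{V_B}$$ are both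 isomorphisms of right almost bialgebroids if and only if $A$ has an antipode. -/

import Mathlib

open scoped TensorProduct
open MulOpposite

section Balanced

/-- The relations `m·b ⊗ n - m ⊗ b·n`, for a right action `r` of `B` on `M` and a left action `l`
of `B` on `N`. -/
def BalRel (k : Type*) {M N B : Type*} [CommRing k] [AddCommGroup M] [Module k M]
    [AddCommGroup N] [Module k N] (r : B → M →ₗ[k] M) (l : B → N →ₗ[k] N) :
    Submodule k (M ⊗[k] N) :=
  Submodule.span k {z | ∃ b m n, z = r b m ⊗ₜ[k] n - m ⊗ₜ[k] l b n}

/-- The tensor product `M ⊗_B N` over a (noncommutative) `k`-algebra `B`. -/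
abbrev BTensor (k : Type*) {M N B : Type*} [CommRing k] [AddCommGroup M] [Module k M]
    [AddCommGroup N] [Module k N] (r : B → M →ₗ[k] M) (l : B → N →ₗ[k] N) :=
  (M ⊗[k] N) ⧸ BalRel k r l

/-- The canonical map `M ⊗_k N → M ⊗_B N`. -/
abbrev BTensor.mk {k M N B : Type*} [CommRing k] [AddCommGroup M] [Module k M]
    [AddCommGroup N] [Module k N] (r : B → M →ₗ[k] M) (l : B → N →ₗ[k] N) :
    M ⊗[k] N →ₗ[k] BTensor k r l :=
  (BalRel k r l).mkQ

theorem BalRel.le_ker {k M N B P : Type*} [CommRing k] [AddCommGroup M] [Module k M]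
    [AddCommGroup N] [Module k N] [AddCommGroup P] [Module k P]
    {r : B → M →ₗ[k] M} {l : B → N →ₗ[k] N} (f : M ⊗[k] N →ₗ[k] P)
    (hf : ∀ b m n, f (r b m ⊗ₜ n) = f (m ⊗ₜ l b n)) : BalRel k r l ≤ LinearMap.ker f := by
  refine Submodule.span_le.2 ?_
  rintro _ ⟨b, m, n, rfl⟩
  simp [hf]

theorem BTensor.mk_tmul {k M N B : Type*} [CommRing k] [AddCommGroup M] [Module k M]
    [AddCommGroup N] [Module k N] (r : B → M →ₗ[k] M) (l : B → N →ₗ[k] N) (b : B) (m : M) (n : N) :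
    BTensor.mk r l (r b m ⊗ₜ n) = BTensor.mk r l (m ⊗ₜ l b n) := by
  rw [← sub_eq_zero, ← map_sub, Submodule.mkQ_apply, Submodule.Quotient.mk_eq_zero]
  exact Submodule.subset_span ⟨b, m, n, rfl⟩

theorem BTensor.congr {k M N B P : Type*} [CommRing k] [AddCommGroup M] [Module k M]
    [AddCommGroup N] [Module k N] [AddCommGroup P] [Module k P]
    {r : B → M →ₗ[k] M} {l : B → N →ₗ[k] N} (f : M ⊗[k] N →ₗ[k] P)
    (hf : ∀ b m n, f (r b m ⊗ₜ n) = f (m ⊗ₜ l b n)) {z z' : M ⊗[k] N}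
    (h : BTensor.mk r l z = BTensor.mk r l z') : f z = f z' := by
  have h1 : z - z' ∈ BalRel k r l := (Submodule.Quotient.eq _).1 h
  have h2 := BalRel.le_ker f hf h1
  rwa [LinearMap.mem_ker, map_sub, sub_eq_zero] at h2

theorem BTensor.exists_rep {k M N B : Type*} [CommRing k] [AddCommGroup M] [Module k M]
    [AddCommGroup N] [Module k N] {r : B → M →ₗ[k] M} {l : B → N →ₗ[k] N} (q : BTensor k r l) :
    ∃ z, BTensor.mk r l z = q :=
  Submodule.mkQ_surjective _ q

/-- The relations of the triple tensor product `M ⊗_B M ⊗_B M`. -/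
def TriRel (k : Type*) {M B : Type*} [CommRing k] [AddCommGroup M] [Module k M]
    (r l : B → M →ₗ[k] M) : Submodule k ((M ⊗[k] M) ⊗[k] M) :=
  Submodule.span k ({z | ∃ b m n p, z = (r b m ⊗ₜ[k] n) ⊗ₜ[k] p - (m ⊗ₜ[k] l b n) ⊗ₜ[k] p} ∪
    {z | ∃ b m n p, z = (m ⊗ₜ[k] r b n) ⊗ₜ[k] p - (m ⊗ₜ[k] n) ⊗ₜ[k] l b p})

/-- The triple tensor product `M ⊗_B M ⊗_B M`. -/
abbrev TriTensor (k : Type*) {M B : Type*} [CommRing k] [AddCommGroup M] [Module k M]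
    (r l : B → M →ₗ[k] M) :=
  ((M ⊗[k] M) ⊗[k] M) ⧸ TriRel k r l

/-- The canonical map `M ⊗_k M ⊗_k M → M ⊗_B M ⊗_B M`. -/
abbrev TriTensor.mk {k M B : Type*} [CommRing k] [AddCommGroup M] [Module k M]
    (r l : B → M →ₗ[k] M) : (M ⊗[k] M) ⊗[k] M →ₗ[k] TriTensor k r l :=
  (TriRel k r l).mkQ

theorem TriTensor.mk_left {k M B : Type*} [CommRing k] [AddCommGroup M] [Module k M]
    (r l : B → M →ₗ[k] M) (b : B) (m n p : M) :
    TriTensor.mk r l ((r b m ⊗ₜ n) ⊗ₜ p) = TriTensor.mk r l ((m ⊗ₜ l b n) ⊗ₜ p) := by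
  rw [← sub_eq_zero, ← map_sub, Submodule.mkQ_apply, Submodule.Quotient.mk_eq_zero]
  exact Submodule.subset_span (Or.inl ⟨b, m, n, p, rfl⟩)

theorem TriTensor.mk_right {k M B : Type*} [CommRing k] [AddCommGroup M] [Module k M]
    (r l : B → M →ₗ[k] M) (b : B) (m n p : M) :
    TriTensor.mk r l ((m ⊗ₜ r b n) ⊗ₜ p) = TriTensor.mk r l ((m ⊗ₜ n) ⊗ₜ l b p) := by
  rw [← sub_eq_zero, ← map_sub, Submodule.mkQ_apply, Submodule.Quotient.mk_eq_zero]
  exact Submodule.subset_span (Or.inr ⟨b, m, n, p, rfl⟩)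

theorem TriTensor.congr {k M B P : Type*} [CommRing k] [AddCommGroup M] [Module k M]
    [AddCommGroup P] [Module k P] {r l : B → M →ₗ[k] M} (f : (M ⊗[k] M) ⊗[k] M →ₗ[k] P)
    (hl : ∀ b m n p, f ((r b m ⊗ₜ n) ⊗ₜ p) = f ((m ⊗ₜ l b n) ⊗ₜ p))
    (hr : ∀ b m n p, f ((m ⊗ₜ r b n) ⊗ₜ p) = f ((m ⊗ₜ n) ⊗ₜ l b p))
    {z z' : (M ⊗[k] M) ⊗[k] M} (h : TriTensor.mk r l z = TriTensor.mk r l z') : f z = f z' := by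
  have h1 : z - z' ∈ TriRel k r l := (Submodule.Quotient.eq _).1 h
  have h2 : TriRel k r l ≤ LinearMap.ker f := by
    refine Submodule.span_le.2 ?_
    rintro _ (⟨b, m, n, p, rfl⟩ | ⟨b, m, n, p, rfl⟩)
    · simp [hl]
    · simp [hr]
  have h3 := h2 h1
  rwa [LinearMap.mem_ker, map_sub, sub_eq_zero] at h3

/-- The map `(M ⊗_B M) ⊗_k M → M ⊗_B M ⊗_B M`, `[m ⊗ n] ⊗ p ↦ [m ⊗ n ⊗ p]`. -/
def TriTensor.inl {k M B : Type*} [CommRing k] [AddCommGroup M] [Module k M]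
    (r l : B → M →ₗ[k] M) : BTensor k r l ⊗[k] M →ₗ[k] TriTensor k r l :=
  TensorProduct.lift ((BalRel k r l).liftQ (TensorProduct.curry (TriTensor.mk r l))
    (BalRel.le_ker _ fun b m n => LinearMap.ext fun p => TriTensor.mk_left r l b m n p))

/-- The map `M ⊗_k (M ⊗_B M) → M ⊗_B M ⊗_B M`, `m ⊗ [n ⊗ p] ↦ [m ⊗ n ⊗ p]`. -/
def TriTensor.inr {k M B : Type*} [CommRing k] [AddCommGroup M] [Module k M]
    (r l : B → M →ₗ[k] M) : M ⊗[k] BTensor k r l →ₗ[k] TriTensor k r l :=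
  TensorProduct.lift (LinearMap.flip ((BalRel k r l).liftQ
    (LinearMap.flip (TensorProduct.curry
      (TriTensor.mk r l ∘ₗ (TensorProduct.assoc k M M M).symm.toLinearMap)))
    (BalRel.le_ker _ fun b m n => LinearMap.ext fun p => TriTensor.mk_right r l b p m n)))

@[simp] theorem TriTensor.inl_mk {k M B : Type*} [CommRing k] [AddCommGroup M] [Module k M]
    (r l : B → M →ₗ[k] M) (z : M ⊗[k] M) (p : M) :
    TriTensor.inl r l (BTensor.mk r l z ⊗ₜ p) = TriTensor.mk r l (z ⊗ₜ p) := rfl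

@[simp] theorem TriTensor.inr_mk {k M B : Type*} [CommRing k] [AddCommGroup M] [Module k M]
    (r l : B → M →ₗ[k] M) (z : M ⊗[k] M) (p : M) :
    TriTensor.inr r l (p ⊗ₜ BTensor.mk r l z) =
      TriTensor.mk r l ((TensorProduct.assoc k M M M).symm (p ⊗ₜ z)) := rfl

/-- The map `D ⊗ id : M ⊗_k M → M ⊗_B M ⊗_B M` induced by `D : M → M ⊗_B M`. -/
def comulId {k M B : Type*} [CommRing k] [AddCommGroup M] [Module k M]
    {r l : B → M →ₗ[k] M} (D : M →ₗ[k] BTensor k r l) : M ⊗[k] M →ₗ[k] TriTensor k r l :=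
  TriTensor.inl r l ∘ₗ D.rTensor M

/-- The map `id ⊗ D : M ⊗_k M → M ⊗_B M ⊗_B M` induced by `D : M → M ⊗_B M`. -/
def idComul {k M B : Type*} [CommRing k] [AddCommGroup M] [Module k M]
    {r l : B → M →ₗ[k] M} (D : M →ₗ[k] BTensor k r l) : M ⊗[k] M →ₗ[k] TriTensor k r l :=
  TriTensor.inr r l ∘ₗ D.lTensor M

end Balanced

/-- A left almost bialgebroid `⟨A, B, s, t, Δ, ε⟩` over `k`: a left bialgebroid whose
comultiplication need not be multiplicative. The bimodule structure is
`b · a · b' = s(b) t(b') a`. Identities in `A ⊗_B A` and maps out of it are expressed through an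
arbitrary representative `z ∈ A ⊗_k A` of `Δ(a)`. -/
structure LeftAlmostBialgebroid (k A B : Type*) [CommRing k] [Ring A] [Algebra k A]
    [Ring B] [Algebra k B] where
  /-- the source map -/
  s : B →ₐ[k] A
  /-- the target map -/
  t : Bᵐᵒᵖ →ₐ[k] A
  s_mul_t : ∀ b b', s b * t (op b') = t (op b') * s b
  /-- the comultiplication `A → A ⊗_B A` -/
  comul : A →ₗ[k] BTensor k (fun b : B => LinearMap.mulLeft k (t (op b)))
    (fun b : B => LinearMap.mulLeft k (s b))
  /-- the counit -/
  counit : A →ₗ[k] B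
  /-- `Δ` and `ε` are bimodule maps -/
  comul_s_mul : ∀ b a z, BTensor.mk _ _ z = comul a →
    comul (s b * a) = BTensor.mk _ _ ((LinearMap.mulLeft k (s b)).rTensor A z)
  comul_t_mul : ∀ b a z, BTensor.mk _ _ z = comul a →
    comul (t (op b) * a) = BTensor.mk _ _ ((LinearMap.mulLeft k (t (op b))).lTensor A z)
  counit_s_mul : ∀ b a, counit (s b * a) = b * counit a
  counit_t_mul : ∀ b a, counit (t (op b) * a) = counit a * b
  /-- `(Δ ⊗ id) Δ = (id ⊗ Δ) Δ` -/
  coassoc : ∀ a z, BTensor.mk _ _ z = comul a → comulId comul z = idComul comul z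
  /-- `ε(a₁) · a₂ = a = a₁ · ε(a₂)` -/
  counit_comul : ∀ a z, BTensor.mk _ _ z = comul a →
    TensorProduct.lift (LinearMap.mul k A ∘ₗ s.toLinearMap ∘ₗ counit) z = a
  comul_counit : ∀ a z, BTensor.mk _ _ z = comul a →
    TensorProduct.lift (LinearMap.flip (LinearMap.mul k A ∘ₗ t.toLinearMap ∘ₗ
      (opLinearEquiv k).toLinearMap ∘ₗ counit)) z = a
  /-- the Takeuchi property `a₁ t(b) ⊗ a₂ = a₁ ⊗ a₂ s(b)` -/
  takeuchi : ∀ a b z, BTensor.mk _ _ z = comul a →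
    BTensor.mk (fun b : B => LinearMap.mulLeft k (t (op b)))
        (fun b : B => LinearMap.mulLeft k (s b)) ((LinearMap.mulRight k (t (op b))).rTensor A z) =
      BTensor.mk _ _ ((LinearMap.mulRight k (s b)).lTensor A z)
  comul_one : comul 1 = BTensor.mk _ _ (1 ⊗ₜ 1)
  counit_one : counit 1 = 1
  counit_mul_s : ∀ a a', counit (a * s (counit a')) = counit (a * a')
  counit_mul_t : ∀ a a', counit (a * t (op (counit a'))) = counit (a * a')

/-- A right almost bialgebroid `⟨A, B, s, t, Δ, ε⟩` over `k`: a right bialgebroid whose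
comultiplication need not be multiplicative. The bimodule structure is
`b · a · b' = a t(b) s(b')`. -/
structure RightAlmostBialgebroid (k A B : Type*) [CommRing k] [Ring A] [Algebra k A]
    [Ring B] [Algebra k B] where
  /-- the source map -/
  s : B →ₐ[k] A
  /-- the target map -/
  t : Bᵐᵒᵖ →ₐ[k] A
  s_mul_t : ∀ b b', s b * t (op b') = t (op b') * s b
  /-- the comultiplication `A → A ⊗_B A` -/
  comul : A →ₗ[k] BTensor k (fun b : B => LinearMap.mulRight k (s b))
    (fun b : B => LinearMap.mulRight k (t (op b)))
  /-- the counit -/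
  counit : A →ₗ[k] B
  /-- `Δ` and `ε` are bimodule maps -/
  comul_mul_t : ∀ b a z, BTensor.mk _ _ z = comul a →
    comul (a * t (op b)) = BTensor.mk _ _ ((LinearMap.mulRight k (t (op b))).rTensor A z)
  comul_mul_s : ∀ b a z, BTensor.mk _ _ z = comul a →
    comul (a * s b) = BTensor.mk _ _ ((LinearMap.mulRight k (s b)).lTensor A z)
  counit_mul_t : ∀ b a, counit (a * t (op b)) = b * counit a
  counit_mul_s : ∀ b a, counit (a * s b) = counit a * b
  /-- `(Δ ⊗ id) Δ = (id ⊗ Δ) Δ` -/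
  coassoc : ∀ a z, BTensor.mk _ _ z = comul a → comulId comul z = idComul comul z
  /-- `ε(a₁) · a₂ = a = a₁ · ε(a₂)` -/
  counit_comul : ∀ a z, BTensor.mk _ _ z = comul a →
    TensorProduct.lift ((LinearMap.mul k A).flip ∘ₗ t.toLinearMap ∘ₗ
      (opLinearEquiv k).toLinearMap ∘ₗ counit) z = a
  comul_counit : ∀ a z, BTensor.mk _ _ z = comul a →
    TensorProduct.lift (LinearMap.flip ((LinearMap.mul k A).flip ∘ₗ s.toLinearMap ∘ₗ counit)) z = a
  /-- the Takeuchi property `s(b) a₁ ⊗ a₂ = a₁ ⊗ t(b) a₂` -/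
  takeuchi : ∀ a b z, BTensor.mk _ _ z = comul a →
    BTensor.mk (fun b : B => LinearMap.mulRight k (s b))
        (fun b : B => LinearMap.mulRight k (t (op b))) ((LinearMap.mulLeft k (s b)).rTensor A z) =
      BTensor.mk _ _ ((LinearMap.mulLeft k (t (op b))).lTensor A z)
  comul_one : comul 1 = BTensor.mk _ _ (1 ⊗ₜ 1)
  counit_one : counit 1 = 1
  counit_s_mul : ∀ a a', counit (s (counit a) * a') = counit (a * a')
  counit_t_mul : ∀ a a', counit (t (op (counit a)) * a') = counit (a * a')

/-- The pair of maps `(F, f)` is an isomorphism of right almost bialgebroids: algebra isomorphisms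
of the total algebras and of the base algebras which commute with the source maps, the target maps,
the comultiplications, `(F ⊗ F) Δ = Δ' F`, and the counits. -/
structure RightAlmostBialgebroid.IsIso {k A B A' B' : Type*} [CommRing k]
    [Ring A] [Algebra k A] [Ring B] [Algebra k B] [Ring A'] [Algebra k A'] [Ring B'] [Algebra k B']
    (P : RightAlmostBialgebroid k A B) (Q : RightAlmostBialgebroid k A' B')
    (F : A →ₗ[k] A') (f : B →ₗ[k] B') : Prop where
  bijective_total : Function.Bijective F
  bijective_base : Function.Bijective f
  map_one : F 1 = 1
  map_mul : ∀ x y, F (x * y) = F x * F y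
  map_base_one : f 1 = 1
  map_base_mul : ∀ b b', f (b * b') = f b * f b'
  map_s : ∀ b, F (P.s b) = Q.s (f b)
  map_t : ∀ b, F (P.t (op b)) = Q.t (op (f b))
  map_comul : ∀ x z, BTensor.mk _ _ z = P.comul x →
    Q.comul (F x) = BTensor.mk _ _ (TensorProduct.map F F z)
  map_counit : ∀ x, Q.counit (F x) = f (P.counit x)

namespace LeftAlmostBialgebroid

section Op

variable {k A B : Type*} [CommRing k] [Ring A] [Algebra k A] [Ring B] [Algebra k B]
  (P : LeftAlmostBialgebroid k A B)

/-- The right action of `B` on `A^op`, `op a · b = op a * op t(b)`. -/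
abbrev opR : B → Aᵐᵒᵖ →ₗ[k] Aᵐᵒᵖ := fun b => LinearMap.mulRight k (AlgHom.opComm.symm P.t b)

/-- The left action of `B` on `A^op`, `b · op a = op a * op s(b)`. -/
abbrev opL : B → Aᵐᵒᵖ →ₗ[k] Aᵐᵒᵖ := fun b => LinearMap.mulRight k (AlgHom.op P.s (op b))

/-- The right action of `B` on `A`, `a · b = t(b) a`. -/
abbrev rAct : B → A →ₗ[k] A := fun b => LinearMap.mulLeft k (P.t (op b))

/-- The left action of `B` on `A`, `b · a = s(b) a`. -/
abbrev lAct : B → A →ₗ[k] A := fun b => LinearMap.mulLeft k (P.s b)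

/-- The map `op ⊗ op` on `A ⊗_k A`. -/
abbrev op2 (k A : Type*) [CommRing k] [Ring A] [Algebra k A] : A ⊗[k] A →ₗ[k] Aᵐᵒᵖ ⊗[k] Aᵐᵒᵖ :=
  TensorProduct.map (opLinearEquiv k).toLinearMap (opLinearEquiv k).toLinearMap

/-- The map on tensor squares used for the opposite of a left almost bialgebroid:
`[x ⊗ y] ↦ [op x ⊗ op y]`. -/
def opTensor :
    BTensor k P.rAct
      P.lAct →ₗ[k]
    BTensor k P.opR
      P.opL :=
  (BalRel k _ _).liftQ
    (BTensor.mk _ _ ∘ₗ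
      op2 k A)
    (BalRel.le_ker _ (fun b m n => by
      simpa using BTensor.mk_tmul P.opR
        P.opL b (op m) (op n)))

theorem opTensor_mk (z : A ⊗[k] A) :
    P.opTensor (BTensor.mk _ _ z) = BTensor.mk _ _
      (op2 k A z) := rfl

theorem exists_op_rep (a : A) (z : Aᵐᵒᵖ ⊗[k] Aᵐᵒᵖ)
    (hz : BTensor.mk _ _ z = P.opTensor (P.comul a)) :
    ∃ w : A ⊗[k] A, BTensor.mk _ _ w = P.comul a ∧
      z = op2 k A w := by
  refine ⟨TensorProduct.map (opLinearEquiv k).symm.toLinearMap (opLinearEquiv k).symm.toLinearMap z,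
    ?_, ?_⟩
  · obtain ⟨w, hw⟩ := BTensor.exists_rep (P.comul a)
    rw [← hw, opTensor_mk] at hz
    rw [← hw]
    have := BTensor.congr (BTensor.mk P.rAct
      P.lAct ∘ₗ
        TensorProduct.map (opLinearEquiv k).symm.toLinearMap (opLinearEquiv k).symm.toLinearMap)
      (fun b m n => by
        simpa using BTensor.mk_tmul P.rAct
          P.lAct b (unop m) (unop n)) hz
    rw [LinearMap.comp_apply, LinearMap.comp_apply] at this
    rw [this]
    congr 1
    exact LinearMap.congr_fun (f := TensorProduct.map _ _ ∘ₗ TensorProduct.map _ _)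
      (g := LinearMap.id) (TensorProduct.ext' fun _ _ => rfl) w
  · exact LinearMap.congr_fun (g := TensorProduct.map _ _ ∘ₗ TensorProduct.map _ _)
      (f := LinearMap.id) (TensorProduct.ext' fun _ _ => rfl) z

theorem opTri_exists :
    ∃ G : TriTensor k P.rAct
        P.lAct →ₗ[k]
      TriTensor k P.opR
        P.opL,
      ∀ z, G (TriTensor.mk _ _ z) = TriTensor.mk _ _ (TensorProduct.map (op2 k A) (opLinearEquiv k).toLinearMap z) := by
  refine ⟨(TriRel k _ _).liftQ (TriTensor.mk _ _ ∘ₗ TensorProduct.map (op2 k A) (opLinearEquiv k).toLinearMap) ?_, fun z => rfl⟩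
  refine Submodule.span_le.2 ?_
  rintro _ (⟨b, m, n, p, rfl⟩ | ⟨b, m, n, p, rfl⟩)
  · rw [SetLike.mem_coe, LinearMap.mem_ker, map_sub, sub_eq_zero]
    simpa using TriTensor.mk_left P.opR
      P.opL b (op m) (op n) (op p)
  · rw [SetLike.mem_coe, LinearMap.mem_ker, map_sub, sub_eq_zero]
    simpa using TriTensor.mk_right P.opR
      P.opL b (op m) (op n) (op p)

/-- The comultiplication of the opposite. -/
def opComul :
    Aᵐᵒᵖ →ₗ[k] BTensor k P.opR
      P.opL :=
  P.opTensor ∘ₗ P.comul ∘ₗ (opLinearEquiv k).symm.toLinearMap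

theorem opComul_op (a : A) :
    P.opComul (op a) = P.opTensor (P.comul a) := rfl

theorem comulId_op
    (G : TriTensor k P.rAct
        P.lAct →ₗ[k]
      TriTensor k P.opR
        P.opL)
    (hG : ∀ z, G (TriTensor.mk _ _ z) = TriTensor.mk _ _ (TensorProduct.map (op2 k A) (opLinearEquiv k).toLinearMap z))
    (w : A ⊗[k] A) :
    comulId P.opComul (op2 k A w) =
      G (comulId P.comul w) := by
  induction w with
  | zero => simp only [map_zero]
  | add x y hx hy => simp only [map_add, hx, hy]
  | tmul x y =>
    obtain ⟨v, hv⟩ := BTensor.exists_rep (P.comul x)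
    simp only [comulId, LinearMap.comp_apply, LinearMap.rTensor_tmul, TensorProduct.map_tmul,
      LinearEquiv.coe_coe, coe_opLinearEquiv, opComul_op]
    rw [← hv, opTensor_mk, TriTensor.inl_mk, TriTensor.inl_mk, hG, TensorProduct.map_tmul]
    rfl

theorem idComul_op
    (G : TriTensor k P.rAct
        P.lAct →ₗ[k]
      TriTensor k P.opR
        P.opL)
    (hG : ∀ z, G (TriTensor.mk _ _ z) = TriTensor.mk _ _ (TensorProduct.map (op2 k A) (opLinearEquiv k).toLinearMap z))
    (w : A ⊗[k] A) :
    idComul P.opComul (op2 k A w) =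
      G (idComul P.comul w) := by
  induction w with
  | zero => simp only [map_zero]
  | add x y hx hy => simp only [map_add, hx, hy]
  | tmul x y =>
    obtain ⟨v, hv⟩ := BTensor.exists_rep (P.comul y)
    simp only [idComul, LinearMap.comp_apply, LinearMap.lTensor_tmul, TensorProduct.map_tmul,
      LinearEquiv.coe_coe, coe_opLinearEquiv, opComul_op]
    rw [← hv, opTensor_mk, TriTensor.inr_mk, TriTensor.inr_mk, hG]
    congr 1
    clear hv
    induction v with
    | zero => simp only [map_zero, TensorProduct.tmul_zero]
    | add x y hx hy => simp only [map_add, TensorProduct.tmul_add, hx, hy]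
    | tmul x y => simp

theorem lift_op_left (w : A ⊗[k] A) :
    TensorProduct.lift ((LinearMap.mul k Aᵐᵒᵖ).flip ∘ₗ (AlgHom.op P.s).toLinearMap ∘ₗ
      (opLinearEquiv k).toLinearMap ∘ₗ P.counit ∘ₗ (opLinearEquiv k).symm.toLinearMap)
      (op2 k A w) =
    op (TensorProduct.lift (LinearMap.mul k A ∘ₗ P.s.toLinearMap ∘ₗ P.counit) w) := by
  induction w with
  | zero => simp only [map_zero, op_zero]
  | add x y hx hy => simp only [map_add, hx, hy, op_add]
  | tmul x y => simp

theorem lift_op_right (w : A ⊗[k] A) :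
    TensorProduct.lift (LinearMap.flip ((LinearMap.mul k Aᵐᵒᵖ).flip ∘ₗ
      (AlgHom.opComm.symm P.t).toLinearMap ∘ₗ P.counit ∘ₗ (opLinearEquiv k).symm.toLinearMap))
      (op2 k A w) =
    op (TensorProduct.lift (LinearMap.flip (LinearMap.mul k A ∘ₗ P.t.toLinearMap ∘ₗ
      (opLinearEquiv k).toLinearMap ∘ₗ P.counit)) w) := by
  induction w with
  | zero => simp only [map_zero, op_zero]
  | add x y hx hy => simp only [map_add, hx, hy, op_add]
  | tmul x y => simp [AlgHom.opComm]

/-- The opposite of a left almost bialgebroid `⟨A, B, s, t, Δ, ε⟩`: the right almost bialgebroid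
`⟨A^op, B, t, s, Δ, ε⟩`, with source `t : B → A^op` and target `s : B^op → A^op`. -/
def opposite : RightAlmostBialgebroid k Aᵐᵒᵖ B where
  s := AlgHom.opComm.symm P.t
  t := AlgHom.op P.s
  s_mul_t b b' := by
    change op (P.t (op b)) * op (P.s b') = op (P.s b') * op (P.t (op b))
    rw [← op_mul, ← op_mul, P.s_mul_t]
  comul := P.opComul
  counit := P.counit ∘ₗ (opLinearEquiv k).symm.toLinearMap
  comul_mul_t b a z hz := by
    obtain ⟨w, hw, rfl⟩ := P.exists_op_rep _ z hz
    change P.opTensor (P.comul (P.s b * unop a)) = _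
    rw [P.comul_s_mul b (unop a) w hw, opTensor_mk]
    congr 1
    clear hz hw
    induction w with
    | zero => simp only [map_zero]
    | add x y hx hy => simp only [map_add, hx, hy]
    | tmul x y => simp
  comul_mul_s b a z hz := by
    obtain ⟨w, hw, rfl⟩ := P.exists_op_rep _ z hz
    change P.opTensor (P.comul (P.t (op b) * unop a)) = _
    rw [P.comul_t_mul b (unop a) w hw, opTensor_mk]
    congr 1
    clear hz hw
    induction w with
    | zero => simp only [map_zero]
    | add x y hx hy => simp only [map_add, hx, hy]
    | tmul x y => simp
  counit_mul_t b a := P.counit_s_mul b (unop a)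
  counit_mul_s b a := P.counit_t_mul b (unop a)
  coassoc a z hz := by
    obtain ⟨w, hw, rfl⟩ := P.exists_op_rep _ z hz
    obtain ⟨G, hG⟩ := P.opTri_exists
    have h := P.coassoc (unop a) w hw
    rw [P.comulId_op G hG, P.idComul_op G hG, h]
  counit_comul a z hz := by
    obtain ⟨w, hw, rfl⟩ := P.exists_op_rep _ z hz
    rw [P.lift_op_left, P.counit_comul (unop a) w hw, op_unop]
  comul_counit a z hz := by
    obtain ⟨w, hw, rfl⟩ := P.exists_op_rep _ z hz
    rw [P.lift_op_right, P.comul_counit (unop a) w hw, op_unop]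
  takeuchi a b z hz := by
    obtain ⟨w, hw, rfl⟩ := P.exists_op_rep _ z hz
    have h := congrArg P.opTensor (P.takeuchi (unop a) b w hw)
    rw [opTensor_mk, opTensor_mk] at h
    refine Eq.trans ?_ (h.trans ?_)
    · congr 1
      clear hz hw h
      induction w with
      | zero => simp only [map_zero]
      | add x y hx hy => simp only [map_add, hx, hy]
      | tmul x y => simp
    · congr 1
      clear hz hw h
      induction w with
      | zero => simp only [map_zero]
      | add x y hx hy => simp only [map_add, hx, hy]
      | tmul x y => simp
  comul_one := congrArg P.opTensor P.comul_one
  counit_one := P.counit_one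
  counit_s_mul a a' := P.counit_mul_t (unop a') (unop a)
  counit_t_mul a a' := P.counit_mul_s (unop a') (unop a)

end Op

section Counit

variable {k A B : Type*} [CommRing k] [Ring A] [Algebra k A] [Ring B] [Algebra k B]
  (P : LeftAlmostBialgebroid k A B)

theorem counit_s (b : B) : P.counit (P.s b) = b := by
  simpa [P.counit_one] using P.counit_s_mul b 1

theorem counit_t (b : B) : P.counit (P.t (op b)) = b := by
  simpa [P.counit_one] using P.counit_t_mul b 1

theorem counit_ts (a : A) (b : B) :
    P.counit (a * P.t (op b)) = P.counit (a * P.s b) := by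
  rw [← P.counit_mul_s, counit_t]

end Counit

section LeftDual

/-- The left dual `Hom(A_B, B_B) = {φ | φ(t(b) a) = φ(a) b}`. -/
def leftDualSubmodule {k A B : Type*} [CommRing k] [Ring A] [Algebra k A] [Ring B] [Algebra k B]
    (P : LeftAlmostBialgebroid k A B) : Submodule k (A →ₗ[k] B) where
  carrier := {φ | ∀ b a, φ (P.t (op b) * a) = φ a * b}
  add_mem' {φ ψ} hφ hψ b a := by
    rw [LinearMap.add_apply, LinearMap.add_apply, hφ, hψ, add_mul]
  zero_mem' b a := by simp
  smul_mem' c φ hφ b a := by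
    rw [LinearMap.smul_apply, LinearMap.smul_apply, hφ, smul_mul_assoc]

/-- The left dual `Hom(A_B, B_B) = {φ | φ(t(b) a) = φ(a) b}` as a type. -/
def LeftDual {k A B : Type*} [CommRing k] [Ring A] [Algebra k A] [Ring B] [Algebra k B]
    (P : LeftAlmostBialgebroid k A B) : Type _ :=
  ↥P.leftDualSubmodule

namespace LeftDual

variable {k A B : Type*} [CommRing k] [Ring A] [Algebra k A] [Ring B] [Algebra k B]
  {P : LeftAlmostBialgebroid k A B}

instance : AddCommGroup P.LeftDual := inferInstanceAs (AddCommGroup ↥P.leftDualSubmodule)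

instance : Module k P.LeftDual := inferInstanceAs (Module k ↥P.leftDualSubmodule)

/-- The inclusion of the left dual into the `k`-linear maps `A → B`. -/
def toLin : P.LeftDual →ₗ[k] A →ₗ[k] B := P.leftDualSubmodule.subtype

instance : CoeFun P.LeftDual (fun _ => A → B) := ⟨fun φ => toLin φ⟩

@[ext] theorem ext {φ ψ : P.LeftDual} (h : ∀ a, φ a = ψ a) : φ = ψ :=
  Subtype.ext (LinearMap.ext h)

theorem apply_t_mul (φ : P.LeftDual) (b : B) (a : A) : φ (P.t (op b) * a) = φ a * b := φ.2 b a

/-- The map `a ⊗ a' ↦ ψ(s(φ(a)) a')`. -/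
def ev (φ ψ : P.LeftDual) : A ⊗[k] A →ₗ[k] B :=
  toLin ψ ∘ₗ TensorProduct.lift (LinearMap.mul k A ∘ₗ P.s.toLinearMap ∘ₗ toLin φ)

@[simp] theorem ev_tmul (φ ψ : P.LeftDual) (a a' : A) : ev φ ψ (a ⊗ₜ a') = ψ (P.s (φ a) * a') := rfl

theorem ev_bal (φ ψ : P.LeftDual) (b : B) (m n : A) :
    ev φ ψ (LinearMap.mulLeft k (P.t (op b)) m ⊗ₜ n) =
      ev φ ψ (m ⊗ₜ LinearMap.mulLeft k (P.s b) n) := by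
  simp [apply_t_mul, mul_assoc]

/-- The product `(φψ)(a) = ψ(s(φ(a₁)) a₂)`. -/
instance : Mul P.LeftDual := ⟨fun φ ψ =>
  ⟨(Submodule.liftQ _ (ev φ ψ) (BalRel.le_ker _ (ev_bal φ ψ))) ∘ₗ P.comul, fun b a => by
    obtain ⟨z, hz⟩ := BTensor.exists_rep (P.comul a)
    rw [LinearMap.comp_apply, LinearMap.comp_apply, P.comul_t_mul b a z hz, ← hz,
      Submodule.mkQ_apply, Submodule.mkQ_apply, Submodule.liftQ_apply, Submodule.liftQ_apply]
    have : ev φ ψ ∘ₗ (LinearMap.mulLeft k (P.t (op b))).lTensor A =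
        LinearMap.mulRight k b ∘ₗ ev φ ψ := by
      refine TensorProduct.ext' fun x y => ?_
      simp [← mul_assoc, P.s_mul_t]
      simp [mul_assoc, apply_t_mul]
    exact LinearMap.congr_fun this z⟩⟩

/-- The unit of the dual is the counit. -/
instance : One P.LeftDual := ⟨⟨P.counit, P.counit_t_mul⟩⟩

theorem one_apply (a : A) : (1 : P.LeftDual) a = P.counit a := rfl

theorem mul_apply (φ ψ : P.LeftDual) (a : A) (z : A ⊗[k] A) (hz : BTensor.mk _ _ z = P.comul a) :
    (φ * ψ) a = ev φ ψ z := by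
  change (Submodule.liftQ _ (ev φ ψ) (BalRel.le_ker _ (ev_bal φ ψ))) (P.comul a) = _
  rw [← hz]; rfl

theorem add_apply (φ ψ : P.LeftDual) (a : A) : (φ + ψ) a = φ a + ψ a := rfl

theorem smul_apply (c : k) (ψ : P.LeftDual) (a : A) : (c • ψ) a = c • ψ a := rfl

protected theorem mul_assoc (φ ψ χ : P.LeftDual) : φ * ψ * χ = φ * (ψ * χ) := by
  ext a
  obtain ⟨z, hz⟩ := BTensor.exists_rep (P.comul a)
  rw [mul_apply _ _ a z hz, mul_apply _ _ a z hz]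
  let G : (A ⊗[k] A) ⊗[k] A →ₗ[k] B :=
    toLin χ ∘ₗ TensorProduct.lift (LinearMap.mul k A ∘ₗ P.s.toLinearMap ∘ₗ ev φ ψ)
  have hG : ∀ x y w, G ((x ⊗ₜ y) ⊗ₜ w) = χ (P.s (ψ (P.s (φ x) * y)) * w) := fun _ _ _ => rfl
  let G' : TriTensor k P.rAct
      P.lAct →ₗ[k] B :=
    (TriRel k _ _).liftQ G (by
      refine Submodule.span_le.2 ?_
      rintro _ (⟨b, m, n, p, rfl⟩ | ⟨b, m, n, p, rfl⟩)
      · simp [hG, apply_t_mul, mul_assoc]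
      · have : P.s (φ m) * (P.t (op b) * n) = P.t (op b) * (P.s (φ m) * n) := by
          rw [← mul_assoc, P.s_mul_t, mul_assoc]
        simp [hG, apply_t_mul, mul_assoc, this])
  have h1 : G' ∘ₗ comulId P.comul = ev (φ * ψ) χ := by
    refine TensorProduct.ext' fun x y => ?_
    obtain ⟨w, hw⟩ := BTensor.exists_rep (P.comul x)
    simp only [comulId, LinearMap.comp_apply, LinearMap.rTensor_tmul, ev_tmul]
    rw [mul_apply φ ψ x w hw, ← hw, TriTensor.inl_mk]
    rfl
  have h2 : G' ∘ₗ idComul P.comul = ev φ (ψ * χ) := by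
    refine TensorProduct.ext' fun x y => ?_
    obtain ⟨w, hw⟩ := BTensor.exists_rep (P.comul y)
    simp only [idComul, LinearMap.comp_apply, LinearMap.lTensor_tmul, ev_tmul]
    have h3 := P.comul_s_mul (φ x) y w hw
    rw [mul_apply ψ χ _ _ h3.symm, ← hw, TriTensor.inr_mk]
    change G _ = _
    have h4 : G ∘ₗ (TensorProduct.assoc k A A A).symm.toLinearMap ∘ₗ TensorProduct.mk k A _ x =
        ev ψ χ ∘ₗ (LinearMap.mulLeft k (P.s (φ x))).rTensor A :=
      TensorProduct.ext' fun _ _ => rfl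
    exact LinearMap.congr_fun h4 w
  rw [← h1, ← h2, LinearMap.comp_apply, LinearMap.comp_apply, P.coassoc a z hz]

instance : Ring P.LeftDual :=
  { (inferInstance : AddCommGroup P.LeftDual) with
    mul := (· * ·)
    one := 1
    mul_assoc := LeftDual.mul_assoc
    one_mul := fun ψ => by
      ext a
      obtain ⟨z, hz⟩ := BTensor.exists_rep (P.comul a)
      rw [mul_apply _ _ a z hz]
      exact congrArg ψ (P.counit_comul a z hz)
    mul_one := fun φ => by
      ext a
      obtain ⟨z, hz⟩ := BTensor.exists_rep (P.comul a)
      rw [mul_apply _ _ a z hz]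
      conv_rhs => rw [← P.comul_counit a z hz]
      refine LinearMap.congr_fun (f := ev φ 1) (g := toLin φ ∘ₗ _) (TensorProduct.ext' fun x y => ?_) z
      rw [ev_tmul, one_apply, P.counit_s_mul]
      exact (apply_t_mul φ _ _).symm
    left_distrib := fun φ ψ χ => by
      ext a
      obtain ⟨z, hz⟩ := BTensor.exists_rep (P.comul a)
      rw [add_apply, mul_apply _ _ a z hz, mul_apply _ _ a z hz, mul_apply _ _ a z hz]
      exact LinearMap.congr_fun (g := ev φ ψ + ev φ χ) (TensorProduct.ext' fun x y => rfl) z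
    right_distrib := fun φ ψ χ => by
      ext a
      obtain ⟨z, hz⟩ := BTensor.exists_rep (P.comul a)
      rw [add_apply, mul_apply _ _ a z hz, mul_apply _ _ a z hz, mul_apply _ _ a z hz]
      refine LinearMap.congr_fun (g := ev φ χ + ev ψ χ) (TensorProduct.ext' fun x y => ?_) z
      simp [add_mul]
    zero_mul := fun χ => by
      ext a
      obtain ⟨z, hz⟩ := BTensor.exists_rep (P.comul a)
      rw [mul_apply _ _ a z hz]
      refine LinearMap.congr_fun (g := 0) (TensorProduct.ext' fun x y => ?_) z
      simp
    mul_zero := fun χ => by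
      ext a
      obtain ⟨z, hz⟩ := BTensor.exists_rep (P.comul a)
      rw [mul_apply _ _ a z hz]
      exact LinearMap.congr_fun (g := 0) (TensorProduct.ext' fun x y => rfl) z }

instance : Algebra k P.LeftDual :=
  Algebra.ofModule
    (fun c φ ψ => by
      ext a
      obtain ⟨z, hz⟩ := BTensor.exists_rep (P.comul a)
      rw [smul_apply, mul_apply _ _ a z hz, mul_apply _ _ a z hz]
      refine LinearMap.congr_fun (g := c • ev φ ψ) (TensorProduct.ext' fun x y => ?_) z
      simp)
    (fun c φ ψ => by
      ext a
      obtain ⟨z, hz⟩ := BTensor.exists_rep (P.comul a)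
      rw [smul_apply, mul_apply _ _ a z hz, mul_apply _ _ a z hz]
      refine LinearMap.congr_fun (g := c • ev φ ψ) (TensorProduct.ext' fun x y => ?_) z
      simp)

/-- The source map `s(b)(a) = ε(a t(b))` of the left dual. -/
def sMap (b : B) : P.LeftDual :=
  ⟨P.counit ∘ₗ LinearMap.mulRight k (P.t (op b)), fun b' a => by
    simp [mul_assoc, P.counit_t_mul]⟩

/-- The target map `t(b)(a) = b ε(a)` of the left dual. -/
def tMap (b : B) : P.LeftDual :=
  ⟨LinearMap.mulLeft k b ∘ₗ P.counit, fun b' a => by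
    simp [mul_assoc, P.counit_t_mul]⟩

theorem sMap_apply (b : B) (a : A) : (sMap b : P.LeftDual) a = P.counit (a * P.t (op b)) := rfl

theorem tMap_apply (b : B) (a : A) : (tMap b : P.LeftDual) a = b * P.counit a := rfl

theorem mul_tMap (ψ : P.LeftDual) (b : B) (a : A) : (ψ * tMap b : P.LeftDual) a = b * ψ a := by
  obtain ⟨z, hz⟩ := BTensor.exists_rep (P.comul a)
  rw [mul_apply _ _ a z hz]
  conv_rhs => rw [← P.comul_counit a z hz]
  refine LinearMap.congr_fun (f := ev ψ (tMap b))
    (g := LinearMap.mulLeft k b ∘ₗ toLin ψ ∘ₗ _) (TensorProduct.ext' fun x y => ?_) z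
  rw [ev_tmul, tMap_apply, P.counit_s_mul]
  exact congrArg (b * ·) (apply_t_mul ψ _ _).symm

theorem mul_sMap (ψ : P.LeftDual) (b : B) (a : A) : (ψ * sMap b : P.LeftDual) a = ψ (a * P.t (op b)) := by
  obtain ⟨z, hz⟩ := BTensor.exists_rep (P.comul a)
  rw [mul_apply _ _ a z hz]
  set F := TensorProduct.lift (LinearMap.flip (LinearMap.mul k A ∘ₗ P.t.toLinearMap ∘ₗ
      (opLinearEquiv k).toLinearMap ∘ₗ P.counit)) with hF
  have hFt : ∀ x y, F (x ⊗ₜ y) = P.t (op (P.counit y)) * x := fun _ _ => rfl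
  have h1 : ev ψ (sMap b) = toLin ψ ∘ₗ F ∘ₗ (LinearMap.mulRight k (P.s b)).lTensor A := by
    refine TensorProduct.ext' fun x y => ?_
    rw [ev_tmul, sMap_apply, mul_assoc, P.counit_s_mul, P.counit_ts]
    exact (apply_t_mul ψ _ _).symm
  have h2 : F ∘ₗ (LinearMap.mulRight k (P.t (op b))).rTensor A =
      LinearMap.mulRight k (P.t (op b)) ∘ₗ F := by
    refine TensorProduct.ext' fun x y => ?_
    simp [hFt, mul_assoc]
  have h3 := BTensor.congr F (fun b m n => by
    simp [hFt, P.counit_s_mul, mul_assoc]) (P.takeuchi a b z hz)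
  rw [h1, LinearMap.comp_apply, LinearMap.comp_apply, ← h3, ← LinearMap.comp_apply F, h2,
    LinearMap.comp_apply, P.comul_counit a z hz]
  rfl

theorem sMap_mul (ψ : P.LeftDual) (b : B) (a : A) : (sMap b * ψ : P.LeftDual) a = ψ (a * P.s b) := by
  obtain ⟨z, hz⟩ := BTensor.exists_rep (P.comul a)
  rw [mul_apply _ _ a z hz]
  set F := TensorProduct.lift (LinearMap.mul k A ∘ₗ P.s.toLinearMap ∘ₗ P.counit) with hF
  have hFt : ∀ x y, F (x ⊗ₜ y) = P.s (P.counit x) * y := fun _ _ => rfl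
  have h1 : ev (sMap b) ψ = toLin ψ ∘ₗ F ∘ₗ (LinearMap.mulRight k (P.t (op b))).rTensor A :=
    TensorProduct.ext' fun x y => rfl
  have h2 : F ∘ₗ (LinearMap.mulRight k (P.s b)).lTensor A =
      LinearMap.mulRight k (P.s b) ∘ₗ F := by
    refine TensorProduct.ext' fun x y => ?_
    simp [hFt, mul_assoc]
  have h3 := BTensor.congr F (fun b m n => by
    simp [hFt, P.counit_t_mul, mul_assoc]) (P.takeuchi a b z hz)
  rw [h1, LinearMap.comp_apply, LinearMap.comp_apply, h3, ← LinearMap.comp_apply F, h2,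
    LinearMap.comp_apply, P.counit_comul a z hz]
  rfl

theorem tMap_mul (ψ : P.LeftDual) (b : B) (a : A) : (tMap b * ψ : P.LeftDual) a = ψ (P.s b * a) := by
  obtain ⟨z, hz⟩ := BTensor.exists_rep (P.comul a)
  rw [mul_apply _ _ a z hz]
  conv_rhs => rw [← P.counit_comul a z hz]
  refine LinearMap.congr_fun (f := ev (tMap b) ψ)
    (g := toLin ψ ∘ₗ LinearMap.mulLeft k (P.s b) ∘ₗ _) (TensorProduct.ext' fun x y => ?_) z
  rw [ev_tmul, tMap_apply, map_mul P.s, mul_assoc]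
  rfl

/-- The source map of the left dual as an algebra map. -/
def sHom (P : LeftAlmostBialgebroid k A B) : B →ₐ[k] P.LeftDual :=
  AlgHom.ofLinearMap
    { toFun := sMap
      map_add' := fun b b' => by ext a; simp [sMap_apply, mul_add]
      map_smul' := fun c b => by ext a; simp [sMap_apply] }
    (by ext a; simp [sMap_apply, one_apply])
    (fun b b' => by ext a; simp [mul_sMap, sMap_apply, mul_assoc])

/-- The target map of the left dual as an algebra map. -/
def tHom (P : LeftAlmostBialgebroid k A B) : Bᵐᵒᵖ →ₐ[k] P.LeftDual :=
  AlgHom.ofLinearMap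
    { toFun := fun b => tMap b.unop
      map_add' := fun b b' => by ext a; simp [tMap_apply, add_mul]
      map_smul' := fun c b => by ext a; simp [tMap_apply] }
    (by ext a; simp [tMap_apply, one_apply])
    (fun b b' => by ext a; simp [mul_tMap, tMap_apply, mul_assoc])

@[simp] theorem sHom_apply (b : B) : sHom P b = sMap b := rfl
@[simp] theorem tHom_apply (b : Bᵐᵒᵖ) : tHom P b = tMap b.unop := rfl

/-- The right action `φ · b = φ s(b)` of `B` on the dual. -/
abbrev dR (P : LeftAlmostBialgebroid k A B) : B → P.LeftDual →ₗ[k] P.LeftDual :=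
  fun b => LinearMap.mulRight k (sHom P b)

/-- The left action `b · φ = φ t(b)` of `B` on the dual. -/
abbrev dL (P : LeftAlmostBialgebroid k A B) : B → P.LeftDual →ₗ[k] P.LeftDual :=
  fun b => LinearMap.mulRight k (tHom P (op b))

/-- The pairing `φ ⊗ ψ ↦ φ(a t(ψ(a')))`. -/
def pair (a a' : A) : P.LeftDual ⊗[k] P.LeftDual →ₗ[k] B :=
  TensorProduct.lift (LinearMap.mk₂ k (fun φ ψ : P.LeftDual => φ (a * P.t (op (ψ a'))))
    (fun _ _ _ => rfl) (fun _ _ _ => rfl) (fun _ _ _ => by simp [mul_add])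
    (fun _ _ _ => by simp))

theorem pair_tmul (a a' : A) (φ ψ : P.LeftDual) : pair a a' (φ ⊗ₜ ψ) = φ (a * P.t (op (ψ a'))) := rfl

theorem pair_bal (a a' : A) (b : B) (φ ψ : P.LeftDual) :
    pair a a' (LinearMap.mulRight k (sHom P b) φ ⊗ₜ ψ) =
      pair a a' (φ ⊗ₜ LinearMap.mulRight k (tHom P (op b)) ψ) := by
  simp [pair_tmul, mul_sMap, mul_tMap, mul_assoc]

/-- The map `ψ ↦ ψ(_ c)`. -/
def shift (c : A) : P.LeftDual →ₗ[k] P.LeftDual where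
  toFun ψ := ⟨toLin ψ ∘ₗ LinearMap.mulRight k c, fun b a => by
    simp [mul_assoc, apply_t_mul]⟩
  map_add' _ _ := rfl
  map_smul' _ _ := rfl

theorem shift_apply (c : A) (ψ : P.LeftDual) (a : A) : shift c ψ a = ψ (a * c) := rfl

/-- A finite dual basis of `A` as a right `B`-module: `a = ∑ e_i · φ_i(a) = ∑ t(φ_i(a)) e_i`. -/
structure DualBasis (P : LeftAlmostBialgebroid k A B) where
  n : ℕ
  e : Fin n → A
  φ : Fin n → P.LeftDual
  sum_eq : ∀ a, ∑ i, P.t (op (φ i a)) * e i = a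

theorem apply_sum {ι : Type*} (s : Finset ι) (f : ι → P.LeftDual) (a : A) :
    (∑ i ∈ s, f i) a = ∑ i ∈ s, f i a := by
  rw [map_sum, LinearMap.sum_apply]

theorem DualBasis.sum_apply (D : DualBasis P) (ψ : P.LeftDual) (a : A) :
    ∑ i, ψ (D.e i) * D.φ i a = ψ a := by
  conv_rhs => rw [← D.sum_eq a, map_sum]
  exact Finset.sum_congr rfl fun i _ => (apply_t_mul ψ _ _).symm

/-- The functionals `φ(_ t(ψ(c)))`, linear in `φ ⊗ ψ`. -/
def pairR (c : A) : P.LeftDual ⊗[k] P.LeftDual →ₗ[k] P.LeftDual :=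
  TensorProduct.lift (LinearMap.mk₂ k (fun φ ψ : P.LeftDual => φ * sMap (ψ c))
    (fun _ _ _ => add_mul _ _ _) (fun _ _ _ => smul_mul_assoc _ _ _)
    (fun φ ψ ψ' => by
      rw [← mul_add]; congr 1; exact (sHom P).map_add _ _)
    (fun r φ ψ => by
      rw [← mul_smul_comm]; congr 1; exact map_smul (sHom P) _ _))

theorem pairR_apply (c a : A) (z : P.LeftDual ⊗[k] P.LeftDual) : pairR c z a = pair a c z := by
  refine LinearMap.congr_fun (f := LinearMap.applyₗ a ∘ₗ toLin ∘ₗ pairR c)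
    (TensorProduct.ext' fun x y => ?_) z
  exact mul_sMap _ _ _

theorem DualBasis.mk_eq (D : DualBasis P) (z : P.LeftDual ⊗[k] P.LeftDual) :
    BTensor.mk (dR P)
        (dL P) z =
      BTensor.mk _ _ (∑ i, pairR (D.e i) z ⊗ₜ D.φ i) := by
  induction z with
  | zero => simp
  | add x y hx hy => 
    simp only [map_add, hx, hy, TensorProduct.add_tmul, Finset.sum_add_distrib]
  | tmul φ ψ =>
    have h1 : ψ = ∑ i, D.φ i * tMap (ψ (D.e i)) := by
      ext a
      rw [apply_sum]
      simp only [mul_tMap, D.sum_apply]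
    conv_lhs => rw [h1, TensorProduct.tmul_sum]
    rw [map_sum, map_sum]
    refine Finset.sum_congr rfl fun i _ => ?_
    exact (BTensor.mk_tmul (dR P)
        (dL P) (ψ (D.e i)) φ (D.φ i)).symm

/-- Elements of the tensor square of the left dual are determined by the pairing. -/
theorem DualBasis.mk_ext (D : DualBasis P) {z z' : P.LeftDual ⊗[k] P.LeftDual}
    (h : ∀ a a', pair a a' z = pair a a' z') :
    BTensor.mk (dR P)
        (dL P) z = BTensor.mk _ _ z' := by
  rw [D.mk_eq z, D.mk_eq z']
  congr 1
  refine Finset.sum_congr rfl fun i _ => ?_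
  congr 1
  ext a
  rw [pairR_apply, pairR_apply, h]

/-- The pairing `φ ⊗ ψ ⊗ χ ↦ φ(a t(ψ(a' t(χ(a'')))))`. -/
def pair3 (a a' a'' : A) : (P.LeftDual ⊗[k] P.LeftDual) ⊗[k] P.LeftDual →ₗ[k] B :=
  TensorProduct.lift (LinearMap.mk₂ k
    (fun (w : P.LeftDual ⊗[k] P.LeftDual) (χ : P.LeftDual) => pair a (a' * P.t (op (χ a''))) w)
    (fun _ _ _ => map_add _ _ _) (fun _ _ _ => map_smul _ _ _)
    (fun w χ χ' => by
      refine LinearMap.congr_fun (f := pair a (a' * P.t (op ((χ + χ') a''))))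
        (g := pair a (a' * P.t (op (χ a''))) + pair a (a' * P.t (op (χ' a''))))
        (TensorProduct.ext' fun x y => ?_) w
      simp [pair_tmul, mul_add])
    (fun c w χ => by
      refine LinearMap.congr_fun (f := pair a (a' * P.t (op ((c • χ) a''))))
        (g := c • pair a (a' * P.t (op (χ a''))))
        (TensorProduct.ext' fun x y => ?_) w
      simp [pair_tmul]))

theorem pair3_tmul (a a' a'' : A) (w : P.LeftDual ⊗[k] P.LeftDual) (χ : P.LeftDual) :
    pair3 a a' a'' (w ⊗ₜ χ) = pair a (a' * P.t (op (χ a''))) w := rfl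

/-- Elements of the triple tensor product of the left dual are determined by `pair3`. -/
theorem DualBasis.mk_ext3 (D : DualBasis P)
    {z z' : (P.LeftDual ⊗[k] P.LeftDual) ⊗[k] P.LeftDual}
    (h : ∀ a a' a'', pair3 a a' a'' z = pair3 a a' a'' z') :
    TriTensor.mk (dR P)
        (dL P) z = TriTensor.mk _ _ z' := by
  let q (c c' : A) : (P.LeftDual ⊗[k] P.LeftDual) ⊗[k] P.LeftDual →ₗ[k] P.LeftDual :=
    TensorProduct.lift (LinearMap.mk₂ k
      (fun (w : P.LeftDual ⊗[k] P.LeftDual) (χ : P.LeftDual) => pairR (c * P.t (op (χ c'))) w)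
      (fun _ _ _ => map_add _ _ _) (fun _ _ _ => map_smul _ _ _)
      (fun w χ χ' => by
        ext a
        refine (pairR_apply _ _ _).trans (Eq.trans ?_ (add_apply (pairR (c * P.t (op (χ c'))) w)
          (pairR (c * P.t (op (χ' c'))) w) a).symm)
        rw [pairR_apply, pairR_apply]
        exact map_add (pair3 a c c' ∘ₗ TensorProduct.mk k _ _ w) χ χ')
      (fun r w χ => by
        ext a
        refine (pairR_apply _ _ _).trans (Eq.trans ?_
          (smul_apply r (pairR (c * P.t (op (χ c'))) w) a).symm)
        rw [pairR_apply]
        exact map_smul (pair3 a c c' ∘ₗ TensorProduct.mk k _ _ w) r χ))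
  have hq : ∀ c c' z a, q c c' z a = pair3 a c c' z := by
    intro c c' z a
    refine LinearMap.congr_fun (f := LinearMap.applyₗ a ∘ₗ toLin ∘ₗ q c c')
      (TensorProduct.ext' fun x y => ?_) z
    exact pairR_apply _ _ _
  have key : ∀ z, TriTensor.mk (dR P)
        (dL P) z =
      TriTensor.mk _ _ (∑ j, ∑ i, (q (D.e i) (D.e j) z ⊗ₜ D.φ i) ⊗ₜ D.φ j) := by
    intro z
    induction z with
    | zero => simp
    | add x y hx hy =>
      simp only [map_add, hx, hy, TensorProduct.add_tmul, Finset.sum_add_distrib]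
    | tmul w χ =>
      have h1 : χ = ∑ i, D.φ i * tMap (χ (D.e i)) := by
        ext a
        rw [apply_sum]
        simp only [mul_tMap, D.sum_apply]
      conv_lhs => rw [h1, TensorProduct.tmul_sum]
      rw [map_sum, map_sum]
      refine Finset.sum_congr rfl fun j _ => ?_
      have h2 : TriTensor.mk (dR P)
          (dL P)
            (w ⊗ₜ (D.φ j * tMap (χ (D.e j)))) =
          TriTensor.mk _ _ ((LinearMap.lTensor _ (LinearMap.mulRight k (sMap (χ (D.e j)))) w) ⊗ₜ
            D.φ j) := by
        induction w with
        | zero => simp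
        | add x y hx hy => simp only [map_add, TensorProduct.add_tmul, hx, hy]
        | tmul x y =>
          exact (TriTensor.mk_right (dR P)
            (dL P) _ _ _ _).symm
      rw [h2, ← TriTensor.inl_mk, D.mk_eq, TriTensor.inl_mk, TensorProduct.sum_tmul]
      congr 1
      refine Finset.sum_congr rfl fun i _ => ?_
      congr 2
      ext a
      rw [hq, pair3_tmul, pairR_apply]
      refine LinearMap.congr_fun (f := pair a (D.e i) ∘ₗ LinearMap.lTensor _ _)
        (TensorProduct.ext' fun x y => ?_) w
      simp [pair_tmul, mul_sMap]
  rw [key z, key z']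
  congr 1
  refine Finset.sum_congr rfl fun j _ => Finset.sum_congr rfl fun i _ => ?_
  congr 2
  ext a
  rw [hq, hq, h]

/-- The comultiplication of the left dual, written in a dual basis. -/
def DualBasis.comul (D : DualBasis P) : P.LeftDual →ₗ[k]
    BTensor k (dR P)
      (dL P) :=
  BTensor.mk _ _ ∘ₗ ∑ i, (TensorProduct.mk k P.LeftDual P.LeftDual).flip (D.φ i) ∘ₗ shift (D.e i)

/-- The comultiplication of the left dual is characterized by `ψ(a a') = ψ⁽¹⁾(a t(ψ⁽²⁾(a')))`. -/
theorem DualBasis.mk_eq_comul_iff (D : DualBasis P) (ψ : P.LeftDual)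
    (z : P.LeftDual ⊗[k] P.LeftDual) :
    BTensor.mk _ _ z = D.comul ψ ↔ ∀ a a', pair a a' z = ψ (a * a') := by
  have h0 : ∀ a a', pair a a' (∑ i, shift (D.e i) ψ ⊗ₜ[k] D.φ i) = ψ (a * a') := by
    intro a a'
    rw [map_sum]
    simp only [pair_tmul, shift_apply]
    rw [← map_sum]
    congr 1
    conv_rhs => rw [← D.sum_eq a']
    rw [Finset.mul_sum]
    simp [mul_assoc]
  have h1 : D.comul ψ = BTensor.mk _ _ (∑ i, shift (D.e i) ψ ⊗ₜ[k] D.φ i) := by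
    rw [DualBasis.comul, LinearMap.comp_apply, LinearMap.sum_apply]
    rfl
  constructor
  · intro h a a'
    rw [← h0 a a']
    exact BTensor.congr (pair a a') (pair_bal a a') (h.trans h1)
  · intro h
    rw [h1]
    exact D.mk_ext fun a a' => by rw [h, h0]

end LeftDual

/-- The left dual of a left almost bialgebroid `A` that is finitely generated projective as a right
`B`-module (witnessed by a dual basis; the comultiplication does not depend on it). -/
def leftDual {k A B : Type*} [CommRing k] [Ring A] [Algebra k A] [Ring B] [Algebra k B]
    (P : LeftAlmostBialgebroid k A B) (D : LeftDual.DualBasis P) :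
    RightAlmostBialgebroid k P.LeftDual B where
  s := LeftDual.sHom P
  t := LeftDual.tHom P
  s_mul_t b b' := by
    ext a
    simp [LeftDual.mul_tMap, LeftDual.tMap_mul, LeftDual.sMap_apply, mul_assoc, P.counit_s_mul]
  comul := D.comul
  counit := LinearMap.applyₗ 1 ∘ₗ LeftDual.toLin
  comul_mul_t b ψ z hz := by
    symm
    rw [D.mk_eq_comul_iff] at hz ⊢
    intro a a'
    rw [LeftDual.tHom_apply, LeftDual.mul_tMap, ← hz]
    refine LinearMap.congr_fun (f := LeftDual.pair a a' ∘ₗ LinearMap.rTensor _ _)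
      (g := LinearMap.mulLeft k b ∘ₗ LeftDual.pair a a') (TensorProduct.ext' fun x y => ?_) z
    simp [LeftDual.pair_tmul, LeftDual.mul_tMap]
  comul_mul_s b ψ z hz := by
    symm
    rw [D.mk_eq_comul_iff] at hz ⊢
    intro a a'
    rw [LeftDual.sHom_apply, LeftDual.mul_sMap, mul_assoc, ← hz]
    refine LinearMap.congr_fun (f := LeftDual.pair a a' ∘ₗ LinearMap.lTensor _ _)
      (g := LeftDual.pair a (a' * P.t (op b))) (TensorProduct.ext' fun x y => ?_) z
    simp [LeftDual.pair_tmul, LeftDual.mul_sMap]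
  counit_mul_t b ψ := by
    simp [LeftDual.mul_tMap]
  counit_mul_s b ψ := by
    have := LeftDual.apply_t_mul ψ b 1
    simpa [LeftDual.mul_sMap] using this
  coassoc ψ z hz := by
    rw [D.mk_eq_comul_iff] at hz
    let r := LeftDual.dR P
    let l := LeftDual.dL P
    obtain ⟨x, hx⟩ := Submodule.mkQ_surjective _ (comulId D.comul z)
    obtain ⟨y, hy⟩ := Submodule.mkQ_surjective _ (idComul D.comul z)
    rw [← hx, ← hy]
    refine D.mk_ext3 fun a a' a'' => ?_
    have hl : ∀ (b : B) (m n p : P.LeftDual),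
        LeftDual.pair3 a a' a'' ((LinearMap.mulRight k (LeftDual.sHom P b) m ⊗ₜ n) ⊗ₜ p) =
        LeftDual.pair3 a a' a'' ((m ⊗ₜ LinearMap.mulRight k (LeftDual.tHom P (op b)) n) ⊗ₜ p) :=
      fun b m n p => LeftDual.pair_bal _ _ b m n
    have hr : ∀ (b : B) (m n p : P.LeftDual),
        LeftDual.pair3 a a' a'' ((m ⊗ₜ LinearMap.mulRight k (LeftDual.sHom P b) n) ⊗ₜ p) =
        LeftDual.pair3 a a' a'' ((m ⊗ₜ n) ⊗ₜ LinearMap.mulRight k (LeftDual.tHom P (op b)) p) := by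
      intro b m n p
      simp [LeftDual.pair3_tmul, LeftDual.pair_tmul, LeftDual.mul_sMap, LeftDual.mul_tMap,
        mul_assoc]
    let G : TriTensor k r l →ₗ[k] B := (TriRel k r l).liftQ (LeftDual.pair3 a a' a'') (by
      refine Submodule.span_le.2 ?_
      rintro _ (⟨b, m, n, p, rfl⟩ | ⟨b, m, n, p, rfl⟩)
      · rw [SetLike.mem_coe, LinearMap.mem_ker, map_sub, sub_eq_zero]; exact hl b m n p
      · rw [SetLike.mem_coe, LinearMap.mem_ker, map_sub, sub_eq_zero]; exact hr b m n p)
    change G (Submodule.mkQ _ x) = G (Submodule.mkQ _ y)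
    rw [hx, hy]
    have h1 : G ∘ₗ comulId D.comul = LeftDual.pair (a * a') a'' := by
      refine TensorProduct.ext' fun φ χ => ?_
      obtain ⟨w, hw⟩ := BTensor.exists_rep (D.comul φ)
      simp only [comulId, LinearMap.comp_apply, LinearMap.rTensor_tmul]
      rw [← hw, TriTensor.inl_mk]
      change LeftDual.pair3 a a' a'' (w ⊗ₜ χ) = _
      rw [LeftDual.pair3_tmul, (D.mk_eq_comul_iff φ w).1 hw, LeftDual.pair_tmul, mul_assoc]
    have h2 : G ∘ₗ idComul D.comul = LeftDual.pair a (a' * a'') := by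
      refine TensorProduct.ext' fun φ χ => ?_
      obtain ⟨w, hw⟩ := BTensor.exists_rep (D.comul χ)
      simp only [idComul, LinearMap.comp_apply, LinearMap.lTensor_tmul]
      rw [← hw, TriTensor.inr_mk]
      change LeftDual.pair3 a a' a'' _ = _
      rw [LeftDual.pair_tmul, ← (D.mk_eq_comul_iff χ w).1 hw]
      refine LinearMap.congr_fun (f := LeftDual.pair3 a a' a'' ∘ₗ
        (TensorProduct.assoc k _ _ _).symm.toLinearMap ∘ₗ TensorProduct.mk k _ _ φ)
        (g := LeftDual.toLin φ ∘ₗ LinearMap.mulLeft k a ∘ₗ P.t.toLinearMap ∘ₗ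
          (opLinearEquiv k).toLinearMap ∘ₗ LeftDual.pair a' a'')
        (TensorProduct.ext' fun _ _ => rfl) w
    rw [← LinearMap.comp_apply, ← LinearMap.comp_apply, h1, h2, hz, hz, mul_assoc]
  counit_comul ψ z hz := by
    rw [D.mk_eq_comul_iff] at hz
    ext a
    rw [← one_mul a, ← hz]
    refine LinearMap.congr_fun (f := LinearMap.applyₗ (1 * a) ∘ₗ LeftDual.toLin ∘ₗ
      TensorProduct.lift _) (TensorProduct.ext' fun φ χ => ?_) z
    have := LeftDual.apply_t_mul φ (χ a) 1
    rw [mul_one] at this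
    simp [LeftDual.mul_tMap, LeftDual.pair_tmul, this]
  comul_counit ψ z hz := by
    rw [D.mk_eq_comul_iff] at hz
    ext a
    rw [← mul_one a, ← hz]
    refine LinearMap.congr_fun (f := LinearMap.applyₗ (a * 1) ∘ₗ LeftDual.toLin ∘ₗ
      TensorProduct.lift _) (TensorProduct.ext' fun φ χ => ?_) z
    simp [LeftDual.mul_sMap, LeftDual.pair_tmul]
  takeuchi ψ b z hz := by
    rw [D.mk_eq_comul_iff] at hz
    refine D.mk_ext fun a a' => ?_
    have h1 : LeftDual.pair a a' ∘ₗ (LinearMap.mulLeft k (LeftDual.sHom P b)).rTensor _ =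
        LeftDual.pair (a * P.s b) a' := by
      refine TensorProduct.ext' fun φ χ => ?_
      simp [LeftDual.pair_tmul, LeftDual.sMap_mul, mul_assoc, P.s_mul_t]
    have h2 : LeftDual.pair a a' ∘ₗ (LinearMap.mulLeft k (LeftDual.tHom P (op b))).lTensor _ =
        LeftDual.pair a (P.s b * a') := by
      refine TensorProduct.ext' fun φ χ => ?_
      simp [LeftDual.pair_tmul, LeftDual.tMap_mul]
    rw [← LinearMap.comp_apply, ← LinearMap.comp_apply, h1, h2, hz, hz, mul_assoc]
  comul_one := by
    symm
    rw [D.mk_eq_comul_iff]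
    intro a a'
    rw [LeftDual.pair_tmul, LeftDual.one_apply, LeftDual.one_apply, LeftDual.one_apply,
      P.counit_mul_t]
  counit_one := P.counit_one
  counit_s_mul φ ψ := by
    have := LeftDual.mul_apply φ ψ 1 (1 ⊗ₜ 1) P.comul_one.symm
    simp [LeftDual.sMap_mul, this]
  counit_t_mul φ ψ := by
    have := LeftDual.mul_apply φ ψ 1 (1 ⊗ₜ 1) P.comul_one.symm
    simp [LeftDual.tMap_mul, this]

end LeftDual

section RightDual

/-- The right dual `Hom(_B A, _B B) = {φ | φ(s(b) a) = b φ(a)}`. -/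
def rightDualSubmodule {k A B : Type*} [CommRing k] [Ring A] [Algebra k A] [Ring B] [Algebra k B]
    (P : LeftAlmostBialgebroid k A B) : Submodule k (A →ₗ[k] B) where
  carrier := {φ | ∀ b a, φ (P.s b * a) = b * φ a}
  add_mem' {φ ψ} hφ hψ b a := by
    rw [LinearMap.add_apply, LinearMap.add_apply, hφ, hψ, mul_add]
  zero_mem' b a := by simp
  smul_mem' c φ hφ b a := by
    rw [LinearMap.smul_apply, LinearMap.smul_apply, hφ, mul_smul_comm]

/-- The right dual `Hom(_B A, _B B) = {φ | φ(s(b) a) = b φ(a)}` as a type. -/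
def RightDual {k A B : Type*} [CommRing k] [Ring A] [Algebra k A] [Ring B] [Algebra k B]
    (P : LeftAlmostBialgebroid k A B) : Type _ :=
  ↥P.rightDualSubmodule

namespace RightDual

variable {k A B : Type*} [CommRing k] [Ring A] [Algebra k A] [Ring B] [Algebra k B]
  {P : LeftAlmostBialgebroid k A B}

instance : AddCommGroup P.RightDual := inferInstanceAs (AddCommGroup ↥P.rightDualSubmodule)

instance : Module k P.RightDual := inferInstanceAs (Module k ↥P.rightDualSubmodule)

/-- The inclusion of the right dual into the `k`-linear maps `A → B`. -/
def toLin : P.RightDual →ₗ[k] A →ₗ[k] B := P.rightDualSubmodule.subtype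

instance : CoeFun P.RightDual (fun _ => A → B) := ⟨fun φ => toLin φ⟩

@[ext] theorem ext {φ ψ : P.RightDual} (h : ∀ a, φ a = ψ a) : φ = ψ :=
  Subtype.ext (LinearMap.ext h)

theorem apply_s_mul (φ : P.RightDual) (b : B) (a : A) : φ (P.s b * a) = b * φ a := φ.2 b a

/-- The map `a ⊗ a' ↦ ψ(t(φ(a')) a)`. -/
def ev (φ ψ : P.RightDual) : A ⊗[k] A →ₗ[k] B :=
  toLin ψ ∘ₗ TensorProduct.lift (LinearMap.flip (LinearMap.mul k A ∘ₗ P.t.toLinearMap ∘ₗ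
    (opLinearEquiv k).toLinearMap ∘ₗ toLin φ))

@[simp] theorem ev_tmul (φ ψ : P.RightDual) (a a' : A) : ev φ ψ (a ⊗ₜ a') = ψ (P.t (op (φ a')) * a) :=
  rfl

theorem ev_bal (φ ψ : P.RightDual) (b : B) (m n : A) :
    ev φ ψ (LinearMap.mulLeft k (P.t (op b)) m ⊗ₜ n) =
      ev φ ψ (m ⊗ₜ LinearMap.mulLeft k (P.s b) n) := by
  simp [apply_s_mul, mul_assoc]

/-- The product `(φψ)(a) = ψ(t(φ(a₂)) a₁)`. -/
instance : Mul P.RightDual := ⟨fun φ ψ =>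
  ⟨(Submodule.liftQ _ (ev φ ψ) (BalRel.le_ker _ (ev_bal φ ψ))) ∘ₗ P.comul, fun b a => by
    obtain ⟨z, hz⟩ := BTensor.exists_rep (P.comul a)
    rw [LinearMap.comp_apply, LinearMap.comp_apply, P.comul_s_mul b a z hz, ← hz,
      Submodule.mkQ_apply, Submodule.mkQ_apply, Submodule.liftQ_apply, Submodule.liftQ_apply]
    have : ev φ ψ ∘ₗ (LinearMap.mulLeft k (P.s b)).rTensor A =
        LinearMap.mulLeft k b ∘ₗ ev φ ψ := by
      refine TensorProduct.ext' fun x y => ?_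
      have h : P.t (op (φ y)) * (P.s b * x) = P.s b * (P.t (op (φ y)) * x) := by
        rw [← mul_assoc, ← P.s_mul_t, mul_assoc]
      simp [h, apply_s_mul]
    exact LinearMap.congr_fun this z⟩⟩

/-- The unit of the dual is the counit. -/
instance : One P.RightDual := ⟨⟨P.counit, P.counit_s_mul⟩⟩

theorem one_apply (a : A) : (1 : P.RightDual) a = P.counit a := rfl

theorem mul_apply (φ ψ : P.RightDual) (a : A) (z : A ⊗[k] A) (hz : BTensor.mk _ _ z = P.comul a) :
    (φ * ψ) a = ev φ ψ z := by
  change (Submodule.liftQ _ (ev φ ψ) (BalRel.le_ker _ (ev_bal φ ψ))) (P.comul a) = _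
  rw [← hz]; rfl

theorem add_apply (φ ψ : P.RightDual) (a : A) : (φ + ψ) a = φ a + ψ a := rfl

theorem smul_apply (c : k) (ψ : P.RightDual) (a : A) : (c • ψ) a = c • ψ a := rfl

protected theorem mul_assoc (φ ψ χ : P.RightDual) : φ * ψ * χ = φ * (ψ * χ) := by
  ext a
  obtain ⟨z, hz⟩ := BTensor.exists_rep (P.comul a)
  rw [mul_apply _ _ a z hz, mul_apply _ _ a z hz]
  let G : (A ⊗[k] A) ⊗[k] A →ₗ[k] B :=
    toLin χ ∘ₗ TensorProduct.lift (LinearMap.flip (LinearMap.mul k A ∘ₗ P.t.toLinearMap ∘ₗ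
      (opLinearEquiv k).toLinearMap ∘ₗ ev φ ψ)) ∘ₗ (TensorProduct.assoc k A A A).toLinearMap
  have hG : ∀ x y w, G ((x ⊗ₜ y) ⊗ₜ w) = χ (P.t (op (ψ (P.t (op (φ w)) * y))) * x) :=
    fun _ _ _ => rfl
  let G' : TriTensor k P.rAct
      P.lAct →ₗ[k] B :=
    (TriRel k _ _).liftQ G (by
      refine Submodule.span_le.2 ?_
      rintro _ (⟨b, m, n, p, rfl⟩ | ⟨b, m, n, p, rfl⟩)
      · have : P.t (op (φ p)) * (P.s b * n) = P.s b * (P.t (op (φ p)) * n) := by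
          rw [← mul_assoc, ← P.s_mul_t, mul_assoc]
        simp [hG, apply_s_mul, mul_assoc, this]
      · simp [hG, apply_s_mul, mul_assoc])
  have h1 : G' ∘ₗ idComul P.comul = ev (φ * ψ) χ := by
    refine TensorProduct.ext' fun x y => ?_
    obtain ⟨w, hw⟩ := BTensor.exists_rep (P.comul y)
    simp only [idComul, LinearMap.comp_apply, LinearMap.lTensor_tmul, ev_tmul]
    rw [mul_apply φ ψ y w hw, ← hw, TriTensor.inr_mk]
    change G _ = _
    have h4 : G ∘ₗ (TensorProduct.assoc k A A A).symm.toLinearMap ∘ₗ TensorProduct.mk k A _ x =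
        toLin χ ∘ₗ LinearMap.mulRight k x ∘ₗ P.t.toLinearMap ∘ₗ (opLinearEquiv k).toLinearMap ∘ₗ
          ev φ ψ :=
      TensorProduct.ext' fun _ _ => rfl
    exact LinearMap.congr_fun h4 w
  have h2 : G' ∘ₗ comulId P.comul = ev φ (ψ * χ) := by
    refine TensorProduct.ext' fun x y => ?_
    obtain ⟨w, hw⟩ := BTensor.exists_rep (P.comul x)
    simp only [comulId, LinearMap.comp_apply, LinearMap.rTensor_tmul, ev_tmul]
    have h3 := P.comul_t_mul (φ y) x w hw
    rw [mul_apply ψ χ _ _ h3.symm, ← hw, TriTensor.inl_mk]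
    change G _ = _
    have h4 : G ∘ₗ (TensorProduct.mk k _ A).flip y =
        ev ψ χ ∘ₗ (LinearMap.mulLeft k (P.t (op (φ y)))).lTensor A :=
      TensorProduct.ext' fun _ _ => rfl
    exact LinearMap.congr_fun h4 w
  rw [← h1, ← h2, LinearMap.comp_apply, LinearMap.comp_apply, P.coassoc a z hz]

instance : Ring P.RightDual :=
  { (inferInstance : AddCommGroup P.RightDual) with
    mul := (· * ·)
    one := 1
    mul_assoc := RightDual.mul_assoc
    one_mul := fun ψ => by
      ext a
      obtain ⟨z, hz⟩ := BTensor.exists_rep (P.comul a)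
      rw [mul_apply _ _ a z hz]
      exact congrArg ψ (P.comul_counit a z hz)
    mul_one := fun φ => by
      ext a
      obtain ⟨z, hz⟩ := BTensor.exists_rep (P.comul a)
      rw [mul_apply _ _ a z hz]
      conv_rhs => rw [← P.counit_comul a z hz]
      refine LinearMap.congr_fun (f := ev φ 1) (g := toLin φ ∘ₗ _) (TensorProduct.ext' fun x y => ?_) z
      rw [ev_tmul, one_apply, P.counit_t_mul]
      exact (apply_s_mul φ _ _).symm
    left_distrib := fun φ ψ χ => by
      ext a
      obtain ⟨z, hz⟩ := BTensor.exists_rep (P.comul a)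
      rw [add_apply, mul_apply _ _ a z hz, mul_apply _ _ a z hz, mul_apply _ _ a z hz]
      exact LinearMap.congr_fun (g := ev φ ψ + ev φ χ) (TensorProduct.ext' fun x y => rfl) z
    right_distrib := fun φ ψ χ => by
      ext a
      obtain ⟨z, hz⟩ := BTensor.exists_rep (P.comul a)
      rw [add_apply, mul_apply _ _ a z hz, mul_apply _ _ a z hz, mul_apply _ _ a z hz]
      refine LinearMap.congr_fun (g := ev φ χ + ev ψ χ) (TensorProduct.ext' fun x y => ?_) z
      simp [add_mul]
    zero_mul := fun χ => by
      ext a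
      obtain ⟨z, hz⟩ := BTensor.exists_rep (P.comul a)
      rw [mul_apply _ _ a z hz]
      refine LinearMap.congr_fun (g := 0) (TensorProduct.ext' fun x y => ?_) z
      simp
    mul_zero := fun χ => by
      ext a
      obtain ⟨z, hz⟩ := BTensor.exists_rep (P.comul a)
      rw [mul_apply _ _ a z hz]
      exact LinearMap.congr_fun (g := 0) (TensorProduct.ext' fun x y => rfl) z }

instance : Algebra k P.RightDual :=
  Algebra.ofModule
    (fun c φ ψ => by
      ext a
      obtain ⟨z, hz⟩ := BTensor.exists_rep (P.comul a)
      rw [smul_apply, mul_apply _ _ a z hz, mul_apply _ _ a z hz]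
      refine LinearMap.congr_fun (g := c • ev φ ψ) (TensorProduct.ext' fun x y => ?_) z
      simp)
    (fun c φ ψ => by
      ext a
      obtain ⟨z, hz⟩ := BTensor.exists_rep (P.comul a)
      rw [smul_apply, mul_apply _ _ a z hz, mul_apply _ _ a z hz]
      refine LinearMap.congr_fun (g := c • ev φ ψ) (TensorProduct.ext' fun x y => ?_) z
      simp)

/-- The source map `s(b)(a) = ε(a) b` of the right dual. -/
def sMap (b : B) : P.RightDual :=
  ⟨LinearMap.mulRight k b ∘ₗ P.counit, fun b' a => by
    simp [mul_assoc, P.counit_s_mul]⟩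

/-- The target map `t(b)(a) = ε(a s(b))` of the right dual. -/
def tMap (b : B) : P.RightDual :=
  ⟨P.counit ∘ₗ LinearMap.mulRight k (P.s b), fun b' a => by
    simp [mul_assoc, P.counit_s_mul]⟩

theorem sMap_apply (b : B) (a : A) : (sMap b : P.RightDual) a = P.counit a * b := rfl

theorem tMap_apply (b : B) (a : A) : (tMap b : P.RightDual) a = P.counit (a * P.s b) := rfl

theorem mul_sMap (ψ : P.RightDual) (b : B) (a : A) : (ψ * sMap b : P.RightDual) a = ψ a * b := by
  obtain ⟨z, hz⟩ := BTensor.exists_rep (P.comul a)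
  rw [mul_apply _ _ a z hz]
  conv_rhs => rw [← P.counit_comul a z hz]
  refine LinearMap.congr_fun (f := ev ψ (sMap b))
    (g := LinearMap.mulRight k b ∘ₗ toLin ψ ∘ₗ _) (TensorProduct.ext' fun x y => ?_) z
  rw [ev_tmul, sMap_apply, P.counit_t_mul]
  exact congrArg (· * b) (apply_s_mul ψ _ _).symm

theorem mul_tMap (ψ : P.RightDual) (b : B) (a : A) :
    (ψ * tMap b : P.RightDual) a = ψ (a * P.s b) := by
  obtain ⟨z, hz⟩ := BTensor.exists_rep (P.comul a)
  rw [mul_apply _ _ a z hz]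
  set F := TensorProduct.lift (LinearMap.mul k A ∘ₗ P.s.toLinearMap ∘ₗ P.counit) with hF
  have hFt : ∀ x y, F (x ⊗ₜ y) = P.s (P.counit x) * y := fun _ _ => rfl
  have h1 : ev ψ (tMap b) = toLin ψ ∘ₗ F ∘ₗ (LinearMap.mulRight k (P.t (op b))).rTensor A := by
    refine TensorProduct.ext' fun x y => ?_
    rw [ev_tmul, tMap_apply, mul_assoc, P.counit_t_mul, ← P.counit_ts]
    exact (apply_s_mul ψ _ _).symm
  have h2 : F ∘ₗ (LinearMap.mulRight k (P.s b)).lTensor A =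
      LinearMap.mulRight k (P.s b) ∘ₗ F := by
    refine TensorProduct.ext' fun x y => ?_
    simp [hFt, mul_assoc]
  have h3 := BTensor.congr F (fun b m n => by
    simp [hFt, P.counit_t_mul, mul_assoc]) (P.takeuchi a b z hz)
  rw [h1, LinearMap.comp_apply, LinearMap.comp_apply, h3, ← LinearMap.comp_apply F, h2,
    LinearMap.comp_apply, P.counit_comul a z hz]
  rfl

theorem tMap_mul (ψ : P.RightDual) (b : B) (a : A) :
    (tMap b * ψ : P.RightDual) a = ψ (a * P.t (op b)) := by
  obtain ⟨z, hz⟩ := BTensor.exists_rep (P.comul a)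
  rw [mul_apply _ _ a z hz]
  set F := TensorProduct.lift (LinearMap.flip (LinearMap.mul k A ∘ₗ P.t.toLinearMap ∘ₗ
      (opLinearEquiv k).toLinearMap ∘ₗ P.counit)) with hF
  have hFt : ∀ x y, F (x ⊗ₜ y) = P.t (op (P.counit y)) * x := fun _ _ => rfl
  have h1 : ev (tMap b) ψ = toLin ψ ∘ₗ F ∘ₗ (LinearMap.mulRight k (P.s b)).lTensor A :=
    TensorProduct.ext' fun x y => rfl
  have h2 : F ∘ₗ (LinearMap.mulRight k (P.t (op b))).rTensor A =
      LinearMap.mulRight k (P.t (op b)) ∘ₗ F := by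
    refine TensorProduct.ext' fun x y => ?_
    simp [hFt, mul_assoc]
  have h3 := BTensor.congr F (fun b m n => by
    simp [hFt, P.counit_s_mul, mul_assoc]) (P.takeuchi a b z hz)
  rw [h1, LinearMap.comp_apply, LinearMap.comp_apply, ← h3, ← LinearMap.comp_apply F, h2,
    LinearMap.comp_apply, P.comul_counit a z hz]
  rfl

theorem sMap_mul (ψ : P.RightDual) (b : B) (a : A) :
    (sMap b * ψ : P.RightDual) a = ψ (P.t (op b) * a) := by
  obtain ⟨z, hz⟩ := BTensor.exists_rep (P.comul a)
  rw [mul_apply _ _ a z hz]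
  conv_rhs => rw [← P.comul_counit a z hz]
  refine LinearMap.congr_fun (f := ev (sMap b) ψ)
    (g := toLin ψ ∘ₗ LinearMap.mulLeft k (P.t (op b)) ∘ₗ _) (TensorProduct.ext' fun x y => ?_) z
  rw [ev_tmul, sMap_apply, op_mul, map_mul P.t, mul_assoc]
  rfl

/-- The source map of the right dual as an algebra map. -/
def sHom (P : LeftAlmostBialgebroid k A B) : B →ₐ[k] P.RightDual :=
  AlgHom.ofLinearMap
    { toFun := sMap
      map_add' := fun b b' => by ext a; simp [sMap_apply, mul_add]
      map_smul' := fun c b => by ext a; simp [sMap_apply] }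
    (by ext a; simp [sMap_apply, one_apply])
    (fun b b' => by ext a; simp [mul_sMap, sMap_apply, mul_assoc])

/-- The target map of the right dual as an algebra map. -/
def tHom (P : LeftAlmostBialgebroid k A B) : Bᵐᵒᵖ →ₐ[k] P.RightDual :=
  AlgHom.ofLinearMap
    { toFun := fun b => tMap b.unop
      map_add' := fun b b' => by ext a; simp [tMap_apply, mul_add]
      map_smul' := fun c b => by ext a; simp [tMap_apply] }
    (by ext a; simp [tMap_apply, one_apply])
    (fun b b' => by ext a; simp [mul_tMap, tMap_apply, mul_assoc])

@[simp] theorem sHom_apply (b : B) : sHom P b = sMap b := rfl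
@[simp] theorem tHom_apply (b : Bᵐᵒᵖ) : tHom P b = tMap b.unop := rfl

/-- The right action `φ · b = φ s(b)` of `B` on the dual. -/
abbrev dR (P : LeftAlmostBialgebroid k A B) : B → P.RightDual →ₗ[k] P.RightDual :=
  fun b => LinearMap.mulRight k (sHom P b)

/-- The left action `b · φ = φ t(b)` of `B` on the dual. -/
abbrev dL (P : LeftAlmostBialgebroid k A B) : B → P.RightDual →ₗ[k] P.RightDual :=
  fun b => LinearMap.mulRight k (tHom P (op b))

/-- The pairing `φ ⊗ ψ ↦ ψ(a s(φ(a')))`. -/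
def pair (a a' : A) : P.RightDual ⊗[k] P.RightDual →ₗ[k] B :=
  TensorProduct.lift (LinearMap.mk₂ k (fun φ ψ : P.RightDual => ψ (a * P.s (φ a')))
    (fun _ _ _ => by simp [mul_add]) (fun _ _ _ => by simp) (fun _ _ _ => rfl)
    (fun _ _ _ => rfl))

theorem pair_tmul (a a' : A) (φ ψ : P.RightDual) : pair a a' (φ ⊗ₜ ψ) = ψ (a * P.s (φ a')) := rfl

theorem pair_bal (a a' : A) (b : B) (φ ψ : P.RightDual) :
    pair a a' (LinearMap.mulRight k (sHom P b) φ ⊗ₜ ψ) =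
      pair a a' (φ ⊗ₜ LinearMap.mulRight k (tHom P (op b)) ψ) := by
  simp [pair_tmul, mul_sMap, mul_tMap, mul_assoc]

/-- The map `ψ ↦ ψ(_ c)`. -/
def shift (c : A) : P.RightDual →ₗ[k] P.RightDual where
  toFun ψ := ⟨toLin ψ ∘ₗ LinearMap.mulRight k c, fun b a => by
    simp [mul_assoc, apply_s_mul]⟩
  map_add' _ _ := rfl
  map_smul' _ _ := rfl

theorem shift_apply (c : A) (ψ : P.RightDual) (a : A) : shift c ψ a = ψ (a * c) := rfl

/-- A finite dual basis of `A` as a left `B`-module: `a = ∑ φ_i(a) · e_i = ∑ s(φ_i(a)) e_i`. -/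
structure DualBasis (P : LeftAlmostBialgebroid k A B) where
  n : ℕ
  e : Fin n → A
  φ : Fin n → P.RightDual
  sum_eq : ∀ a, ∑ i, P.s (φ i a) * e i = a

theorem apply_sum {ι : Type*} (s : Finset ι) (f : ι → P.RightDual) (a : A) :
    (∑ i ∈ s, f i) a = ∑ i ∈ s, f i a := by
  rw [map_sum, LinearMap.sum_apply]

theorem DualBasis.sum_apply (D : DualBasis P) (ψ : P.RightDual) (a : A) :
    ∑ i, D.φ i a * ψ (D.e i) = ψ a := by
  conv_rhs => rw [← D.sum_eq a, map_sum]
  exact Finset.sum_congr rfl fun i _ => (apply_s_mul ψ _ _).symm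

/-- The functionals `ψ(_ s(φ(c)))`, linear in `φ ⊗ ψ`. -/
def pairL (c : A) : P.RightDual ⊗[k] P.RightDual →ₗ[k] P.RightDual :=
  TensorProduct.lift (LinearMap.mk₂ k (fun φ ψ : P.RightDual => ψ * tMap (φ c))
    (fun φ φ' ψ => by
      rw [← mul_add]; congr 1; exact (tHom P).map_add (op (φ c)) (op (φ' c)))
    (fun r φ ψ => by
      rw [← mul_smul_comm]; congr 1; exact map_smul (tHom P) r (op (φ c)))
    (fun _ _ _ => add_mul _ _ _) (fun _ _ _ => smul_mul_assoc _ _ _))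

theorem pairL_apply (c a : A) (z : P.RightDual ⊗[k] P.RightDual) : pairL c z a = pair a c z := by
  refine LinearMap.congr_fun (f := LinearMap.applyₗ a ∘ₗ toLin ∘ₗ pairL c)
    (TensorProduct.ext' fun x y => ?_) z
  exact mul_tMap _ _ _

theorem DualBasis.eq_sum (D : DualBasis P) (φ : P.RightDual) :
    φ = ∑ i, D.φ i * sMap (φ (D.e i)) := by
  ext a
  rw [apply_sum]
  simp only [mul_sMap, D.sum_apply]

theorem DualBasis.mk_eq (D : DualBasis P) (z : P.RightDual ⊗[k] P.RightDual) :
    BTensor.mk (dR P)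
        (dL P) z =
      BTensor.mk _ _ (∑ i, D.φ i ⊗ₜ pairL (D.e i) z) := by
  induction z with
  | zero => simp
  | add x y hx hy =>
    simp only [map_add, hx, hy, TensorProduct.tmul_add, Finset.sum_add_distrib]
  | tmul φ ψ =>
    conv_lhs => rw [D.eq_sum φ, TensorProduct.sum_tmul]
    rw [map_sum, map_sum]
    refine Finset.sum_congr rfl fun i _ => ?_
    exact BTensor.mk_tmul (dR P)
        (dL P) (φ (D.e i)) (D.φ i) ψ

/-- Elements of the tensor square of the right dual are determined by the pairing. -/
theorem DualBasis.mk_ext (D : DualBasis P) {z z' : P.RightDual ⊗[k] P.RightDual}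
    (h : ∀ a a', pair a a' z = pair a a' z') :
    BTensor.mk (dR P)
        (dL P) z = BTensor.mk _ _ z' := by
  rw [D.mk_eq z, D.mk_eq z']
  congr 1
  refine Finset.sum_congr rfl fun i _ => ?_
  congr 1
  ext a
  rw [pairL_apply, pairL_apply, h]

/-- The pairing `φ ⊗ ψ ⊗ χ ↦ χ(a s(ψ(a' s(φ(a'')))))`. -/
def pair3 (a a' a'' : A) : (P.RightDual ⊗[k] P.RightDual) ⊗[k] P.RightDual →ₗ[k] B :=
  TensorProduct.lift (LinearMap.mk₂ k
    (fun (w : P.RightDual ⊗[k] P.RightDual) (χ : P.RightDual) => χ (a * P.s (pair a' a'' w)))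
    (fun _ _ _ => by simp [mul_add]) (fun _ _ _ => by simp) (fun _ _ _ => rfl) (fun _ _ _ => rfl))

theorem pair3_tmul (a a' a'' : A) (w : P.RightDual ⊗[k] P.RightDual) (χ : P.RightDual) :
    pair3 a a' a'' (w ⊗ₜ χ) = χ (a * P.s (pair a' a'' w)) := rfl

/-- Elements of the triple tensor product of the right dual are determined by `pair3`. -/
theorem DualBasis.mk_ext3 (D : DualBasis P)
    {z z' : (P.RightDual ⊗[k] P.RightDual) ⊗[k] P.RightDual}
    (h : ∀ a a' a'', pair3 a a' a'' z = pair3 a a' a'' z') :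
    TriTensor.mk (dR P)
        (dL P) z = TriTensor.mk _ _ z' := by
  let q (c c' : A) : (P.RightDual ⊗[k] P.RightDual) ⊗[k] P.RightDual →ₗ[k] P.RightDual :=
    TensorProduct.lift (LinearMap.mk₂ k
      (fun (w : P.RightDual ⊗[k] P.RightDual) (χ : P.RightDual) => χ * tMap (pair c c' w))
      (fun w w' χ => by
        rw [← mul_add]; congr 1
        rw [map_add]; exact (tHom P).map_add (op (pair c c' w)) (op (pair c c' w')))
      (fun r w χ => by
        rw [← mul_smul_comm]; congr 1
        rw [map_smul]; exact map_smul (tHom P) r (op (pair c c' w)))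
      (fun _ _ _ => add_mul _ _ _) (fun _ _ _ => smul_mul_assoc _ _ _))
  have hq : ∀ c c' z a, q c c' z a = pair3 a c c' z := by
    intro c c' z a
    refine LinearMap.congr_fun (f := LinearMap.applyₗ a ∘ₗ toLin ∘ₗ q c c')
      (TensorProduct.ext' fun x y => ?_) z
    exact mul_tMap _ _ _
  have key : ∀ z, TriTensor.mk (dR P)
        (dL P) z =
      TriTensor.mk _ _ (∑ j, ∑ i, (D.φ j ⊗ₜ D.φ i) ⊗ₜ q (D.e i) (D.e j) z) := by
    intro z
    induction z with
    | zero => simp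
    | add x y hx hy =>
      simp only [map_add, hx, hy, TensorProduct.tmul_add, Finset.sum_add_distrib]
    | tmul w χ =>
      rw [← TriTensor.inl_mk, D.mk_eq, TriTensor.inl_mk, TensorProduct.sum_tmul, map_sum, map_sum]
      refine Finset.sum_congr rfl fun j _ => ?_
      conv_lhs => rw [D.eq_sum (pairL (D.e j) w), TensorProduct.tmul_sum, TensorProduct.sum_tmul]
      rw [map_sum, map_sum]
      refine Finset.sum_congr rfl fun i _ => ?_
      rw [pairL_apply]
      exact TriTensor.mk_right (dR P)
        (dL P) _ _ _ _
  rw [key z, key z']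
  congr 1
  refine Finset.sum_congr rfl fun j _ => Finset.sum_congr rfl fun i _ => ?_
  congr 1
  ext a
  rw [hq, hq, h]

/-- The comultiplication of the right dual, written in a dual basis. -/
def DualBasis.comul (D : DualBasis P) : P.RightDual →ₗ[k]
    BTensor k (dR P)
      (dL P) :=
  BTensor.mk _ _ ∘ₗ ∑ i, TensorProduct.mk k P.RightDual P.RightDual (D.φ i) ∘ₗ shift (D.e i)

/-- The comultiplication of the right dual is characterized by `ψ(a a') = ψ⁽²⁾(a s(ψ⁽¹⁾(a')))`. -/
theorem DualBasis.mk_eq_comul_iff (D : DualBasis P) (ψ : P.RightDual)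
    (z : P.RightDual ⊗[k] P.RightDual) :
    BTensor.mk _ _ z = D.comul ψ ↔ ∀ a a', pair a a' z = ψ (a * a') := by
  have h0 : ∀ a a', pair a a' (∑ i, D.φ i ⊗ₜ[k] shift (D.e i) ψ) = ψ (a * a') := by
    intro a a'
    rw [map_sum]
    simp only [pair_tmul, shift_apply]
    rw [← map_sum]
    congr 1
    conv_rhs => rw [← D.sum_eq a']
    rw [Finset.mul_sum]
    simp [mul_assoc]
  have h1 : D.comul ψ = BTensor.mk _ _ (∑ i, D.φ i ⊗ₜ[k] shift (D.e i) ψ) := by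
    rw [DualBasis.comul, LinearMap.comp_apply, LinearMap.sum_apply]
    rfl
  constructor
  · intro h a a'
    rw [← h0 a a']
    exact BTensor.congr (pair a a') (pair_bal a a') (h.trans h1)
  · intro h
    rw [h1]
    exact D.mk_ext fun a a' => by rw [h, h0]

end RightDual

/-- The right dual of a left almost bialgebroid `A` that is finitely generated projective as a left
`B`-module (witnessed by a dual basis; the comultiplication does not depend on it). -/
def rightDual {k A B : Type*} [CommRing k] [Ring A] [Algebra k A] [Ring B] [Algebra k B]
    (P : LeftAlmostBialgebroid k A B) (D : RightDual.DualBasis P) :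
    RightAlmostBialgebroid k P.RightDual B where
  s := RightDual.sHom P
  t := RightDual.tHom P
  s_mul_t b b' := by
    ext a
    simp [RightDual.mul_tMap, RightDual.mul_sMap, RightDual.tMap_apply, RightDual.sMap_apply]
  comul := D.comul
  counit := LinearMap.applyₗ 1 ∘ₗ RightDual.toLin
  comul_mul_t b ψ z hz := by
    symm
    rw [D.mk_eq_comul_iff] at hz ⊢
    intro a a'
    rw [RightDual.tHom_apply, RightDual.mul_tMap, unop_op, mul_assoc, ← hz]
    refine LinearMap.congr_fun (f := RightDual.pair a a' ∘ₗ LinearMap.rTensor _ _)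
      (g := RightDual.pair a (a' * P.s b)) (TensorProduct.ext' fun x y => ?_) z
    simp [RightDual.pair_tmul, RightDual.mul_tMap]
  comul_mul_s b ψ z hz := by
    symm
    rw [D.mk_eq_comul_iff] at hz ⊢
    intro a a'
    rw [RightDual.sHom_apply, RightDual.mul_sMap, ← hz]
    refine LinearMap.congr_fun (f := RightDual.pair a a' ∘ₗ LinearMap.lTensor _ _)
      (g := LinearMap.mulRight k b ∘ₗ RightDual.pair a a') (TensorProduct.ext' fun x y => ?_) z
    simp [RightDual.pair_tmul, RightDual.mul_sMap]
  counit_mul_t b ψ := by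
    have := RightDual.apply_s_mul ψ b 1
    simpa [RightDual.mul_tMap] using this
  counit_mul_s b ψ := by
    simp [RightDual.mul_sMap]
  coassoc ψ z hz := by
    rw [D.mk_eq_comul_iff] at hz
    let r := RightDual.dR P
    let l := RightDual.dL P
    obtain ⟨x, hx⟩ := Submodule.mkQ_surjective _ (comulId D.comul z)
    obtain ⟨y, hy⟩ := Submodule.mkQ_surjective _ (idComul D.comul z)
    rw [← hx, ← hy]
    refine D.mk_ext3 fun a a' a'' => ?_
    have hl : ∀ (b : B) (m n p : P.RightDual),
        RightDual.pair3 a a' a'' ((LinearMap.mulRight k (RightDual.sHom P b) m ⊗ₜ n) ⊗ₜ p) =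
        RightDual.pair3 a a' a'' ((m ⊗ₜ LinearMap.mulRight k (RightDual.tHom P (op b)) n) ⊗ₜ p) :=
      fun b m n p => by
        rw [RightDual.pair3_tmul, RightDual.pair3_tmul, RightDual.pair_bal]
    have hr : ∀ (b : B) (m n p : P.RightDual),
        RightDual.pair3 a a' a'' ((m ⊗ₜ LinearMap.mulRight k (RightDual.sHom P b) n) ⊗ₜ p) =
        RightDual.pair3 a a' a'' ((m ⊗ₜ n) ⊗ₜ LinearMap.mulRight k (RightDual.tHom P (op b)) p) := by
      intro b m n p
      simp [RightDual.pair3_tmul, RightDual.pair_tmul, RightDual.mul_sMap, RightDual.mul_tMap,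
        mul_assoc]
    let G : TriTensor k r l →ₗ[k] B := (TriRel k r l).liftQ (RightDual.pair3 a a' a'') (by
      refine Submodule.span_le.2 ?_
      rintro _ (⟨b, m, n, p, rfl⟩ | ⟨b, m, n, p, rfl⟩)
      · rw [SetLike.mem_coe, LinearMap.mem_ker, map_sub, sub_eq_zero]; exact hl b m n p
      · rw [SetLike.mem_coe, LinearMap.mem_ker, map_sub, sub_eq_zero]; exact hr b m n p)
    change G (Submodule.mkQ _ x) = G (Submodule.mkQ _ y)
    rw [hx, hy]
    have h1 : G ∘ₗ comulId D.comul = RightDual.pair a (a' * a'') := by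
      refine TensorProduct.ext' fun φ χ => ?_
      obtain ⟨w, hw⟩ := BTensor.exists_rep (D.comul φ)
      simp only [comulId, LinearMap.comp_apply, LinearMap.rTensor_tmul]
      rw [← hw, TriTensor.inl_mk]
      change RightDual.pair3 a a' a'' (w ⊗ₜ χ) = _
      rw [RightDual.pair3_tmul, (D.mk_eq_comul_iff φ w).1 hw, RightDual.pair_tmul]
    have h2 : G ∘ₗ idComul D.comul = RightDual.pair (a * a') a'' := by
      refine TensorProduct.ext' fun φ χ => ?_
      obtain ⟨w, hw⟩ := BTensor.exists_rep (D.comul χ)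
      simp only [idComul, LinearMap.comp_apply, LinearMap.lTensor_tmul]
      rw [← hw, TriTensor.inr_mk]
      change RightDual.pair3 a a' a'' _ = _
      rw [RightDual.pair_tmul, mul_assoc, ← (D.mk_eq_comul_iff χ w).1 hw]
      exact LinearMap.congr_fun (f := RightDual.pair3 a a' a'' ∘ₗ
        (TensorProduct.assoc k _ _ _).symm.toLinearMap ∘ₗ TensorProduct.mk k _ _ φ)
        (g := RightDual.pair a (a' * P.s (φ a'')))
        (TensorProduct.ext' fun _ _ => rfl) w
    rw [← LinearMap.comp_apply, ← LinearMap.comp_apply, h1, h2, hz, hz, mul_assoc]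
  counit_comul ψ z hz := by
    rw [D.mk_eq_comul_iff] at hz
    ext a
    rw [← mul_one a, ← hz]
    refine LinearMap.congr_fun (f := LinearMap.applyₗ (a * 1) ∘ₗ RightDual.toLin ∘ₗ
      TensorProduct.lift _) (TensorProduct.ext' fun φ χ => ?_) z
    simp [RightDual.mul_tMap, RightDual.pair_tmul]
  comul_counit ψ z hz := by
    rw [D.mk_eq_comul_iff] at hz
    ext a
    rw [← one_mul a, ← hz]
    refine LinearMap.congr_fun (f := LinearMap.applyₗ (1 * a) ∘ₗ RightDual.toLin ∘ₗ
      TensorProduct.lift _) (TensorProduct.ext' fun φ χ => ?_) z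
    have := RightDual.apply_s_mul χ (φ a) 1
    rw [mul_one] at this
    simp [RightDual.mul_sMap, RightDual.pair_tmul, this]
  takeuchi ψ b z hz := by
    rw [D.mk_eq_comul_iff] at hz
    refine D.mk_ext fun a a' => ?_
    have h1 : RightDual.pair a a' ∘ₗ (LinearMap.mulLeft k (RightDual.sHom P b)).rTensor _ =
        RightDual.pair a (P.t (op b) * a') := by
      refine TensorProduct.ext' fun φ χ => ?_
      simp [RightDual.pair_tmul, RightDual.sMap_mul]
    have h2 : RightDual.pair a a' ∘ₗ (LinearMap.mulLeft k (RightDual.tHom P (op b))).lTensor _ =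
        RightDual.pair (a * P.t (op b)) a' := by
      refine TensorProduct.ext' fun φ χ => ?_
      simp [RightDual.pair_tmul, RightDual.tMap_mul, mul_assoc, P.s_mul_t]
    rw [← LinearMap.comp_apply, ← LinearMap.comp_apply, h1, h2, hz, hz, mul_assoc]
  comul_one := by
    symm
    rw [D.mk_eq_comul_iff]
    intro a a'
    rw [RightDual.pair_tmul, RightDual.one_apply, RightDual.one_apply, RightDual.one_apply,
      P.counit_mul_s]
  counit_one := P.counit_one
  counit_s_mul φ ψ := by
    have := RightDual.mul_apply φ ψ 1 (1 ⊗ₜ 1) P.comul_one.symm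
    simp [RightDual.sMap_mul, this]
  counit_t_mul φ ψ := by
    have := RightDual.mul_apply φ ψ 1 (1 ⊗ₜ 1) P.comul_one.symm
    simp [RightDual.tMap_mul, this]

end RightDual

end LeftAlmostBialgebroid

/-- A double algebra over `k`: a `k`-module `A` with two associative unital `k`-algebra structures,
the vertical one `(∘, e)` = `(vmul, e)` and the horizontal one `(⋆, i)` = `(hmul, i)`, satisfying
the eight corner axioms. -/
structure DoubleAlgebra (k A : Type*) [CommRing k] [AddCommGroup A] [Module k A] where
  /-- the vertical multiplication `a ∘ b` -/
  vmul : A →ₗ[k] A →ₗ[k] A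
  /-- the vertical unit -/
  e : A
  /-- the horizontal multiplication `a ⋆ b` -/
  hmul : A →ₗ[k] A →ₗ[k] A
  /-- the horizontal unit -/
  i : A
  vmul_assoc : ∀ a b c, vmul (vmul a b) c = vmul a (vmul b c)
  e_vmul : ∀ a, vmul e a = a
  vmul_e : ∀ a, vmul a e = a
  hmul_assoc : ∀ a b c, hmul (hmul a b) c = hmul a (hmul b c)
  i_hmul : ∀ a, hmul i a = a
  hmul_i : ∀ a, hmul a i = a
  A1 : ∀ a b, vmul (hmul a e) b = hmul (vmul (hmul a e) i) b
  A2 : ∀ a b, vmul a (hmul b e) = hmul (vmul i (hmul b e)) a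
  A3 : ∀ a b, hmul (vmul a i) b = vmul (hmul (vmul a i) e) b
  A4 : ∀ a b, hmul a (vmul b i) = vmul (hmul e (vmul b i)) a
  A5 : ∀ a b, vmul a (hmul e b) = hmul a (vmul i (hmul e b))
  A6 : ∀ a b, vmul (hmul e a) b = hmul b (vmul (hmul e a) i)
  A7 : ∀ a b, hmul a (vmul i b) = vmul a (hmul e (vmul i b))
  A8 : ∀ a b, hmul (vmul i a) b = vmul b (hmul (vmul i a) e)

/-- `Φ : X → S` (viewed as a map `X → X`) is a Frobenius homomorphism onto the subalgebra `S`: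
an `S`-`S`-bimodule map possessing dual bases. -/
structure IsFrobeniusHom {k X : Type*} [CommRing k] [Ring X] [Algebra k X] (S : Subalgebra k X)
    (Φ : X →ₗ[k] X) : Prop where
  mem : ∀ x, Φ x ∈ S
  map_mul_left : ∀ s ∈ S, ∀ x, Φ (s * x) = s * Φ x
  map_mul_right : ∀ s ∈ S, ∀ x, Φ (x * s) = Φ x * s
  exists_dual : ∃ (n : ℕ) (u v : Fin n → X),
    (∀ a, ∑ j, Φ (a * u j) * v j = a) ∧ ∀ a, ∑ j, u j * Φ (v j * a) = a

namespace DoubleAlgebra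

section Basic

/-- The vertical algebra `V = ⟨A, ∘, e⟩`. -/
def V {k A : Type*} [CommRing k] [AddCommGroup A] [Module k A] (_D : DoubleAlgebra k A) : Type _ := A

/-- The horizontal algebra `H = ⟨A, ⋆, i⟩`. -/
def H {k A : Type*} [CommRing k] [AddCommGroup A] [Module k A] (_D : DoubleAlgebra k A) : Type _ := A

variable {k A : Type*} [CommRing k] [AddCommGroup A] [Module k A] (D : DoubleAlgebra k A)

instance instRingV : Ring D.V :=
  letI inst : AddCommGroup D.V := inferInstanceAs (AddCommGroup A)
  { inst with
    mul := fun a b => D.vmul a b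
    one := D.e
    mul_assoc := D.vmul_assoc
    one_mul := D.e_vmul
    mul_one := D.vmul_e
    left_distrib := fun a b c => map_add (D.vmul a) b c
    right_distrib := fun a b c => LinearMap.map_add₂ D.vmul a b c
    zero_mul := fun a => LinearMap.map_zero₂ D.vmul a
    mul_zero := fun a => map_zero (D.vmul a) }

instance instRingH : Ring D.H :=
  letI inst : AddCommGroup D.H := inferInstanceAs (AddCommGroup A)
  { inst with
    mul := fun a b => D.hmul a b
    one := D.i
    mul_assoc := D.hmul_assoc
    one_mul := D.i_hmul
    mul_one := D.hmul_i
    left_distrib := fun a b c => map_add (D.hmul a) b c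
    right_distrib := fun a b c => LinearMap.map_add₂ D.hmul a b c
    zero_mul := fun a => LinearMap.map_zero₂ D.hmul a
    mul_zero := fun a => map_zero (D.hmul a) }

instance instAlgebraV : Algebra k D.V :=
  letI : Module k D.V := inferInstanceAs (Module k A)
  Algebra.ofModule (fun c a b => LinearMap.map_smul₂ D.vmul c a b)
    (fun c a b => map_smul (D.vmul a) c b)

instance instAlgebraH : Algebra k D.H :=
  letI : Module k D.H := inferInstanceAs (Module k A)
  Algebra.ofModule (fun c a b => LinearMap.map_smul₂ D.hmul c a b)
    (fun c a b => map_smul (D.hmul a) c b)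

/-- The identity map `A → V`. -/
def toV : A ≃ₗ[k] D.V where
  toFun a := a
  invFun a := a
  map_add' _ _ := rfl
  map_smul' _ _ := rfl
  left_inv _ := rfl
  right_inv _ := rfl

/-- The identity map `A → H`. -/
def toH : A ≃ₗ[k] D.H where
  toFun a := a
  invFun a := a
  map_add' _ _ := rfl
  map_smul' _ _ := rfl
  left_inv _ := rfl
  right_inv _ := rfl

theorem toV_mul (a b : A) : D.toV a * D.toV b = D.toV (D.vmul a b) := rfl
theorem toH_mul (a b : A) : D.toH a * D.toH b = D.toH (D.hmul a b) := rfl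
theorem toV_e : D.toV D.e = 1 := rfl
theorem toH_i : D.toH D.i = 1 := rfl

/-- The base homomorphism `Φ_L(a) = a ⋆ e`. -/
def ΦL : A →ₗ[k] A := D.hmul.flip D.e
/-- The base homomorphism `Φ_R(a) = e ⋆ a`. -/
def ΦR : A →ₗ[k] A := D.hmul D.e
/-- The base homomorphism `Φ_B(a) = a ∘ i`. -/
def ΦB : A →ₗ[k] A := D.vmul.flip D.i
/-- The base homomorphism `Φ_T(a) = i ∘ a`. -/
def ΦT : A →ₗ[k] A := D.vmul D.i

/-- The double algebra `A^D` with vertical and horizontal structures interchanged. -/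
def swap : DoubleAlgebra k A where
  vmul := D.hmul
  e := D.i
  hmul := D.vmul
  i := D.e
  vmul_assoc := D.hmul_assoc
  e_vmul := D.i_hmul
  vmul_e := D.hmul_i
  hmul_assoc := D.vmul_assoc
  i_hmul := D.e_vmul
  hmul_i := D.vmul_e
  A1 := D.A3
  A2 := D.A4
  A3 := D.A1
  A4 := D.A2
  A5 := D.A7
  A6 := D.A8
  A7 := D.A5
  A8 := D.A6

theorem ΦB_vmul (a b : A) : D.ΦB (D.vmul a b) = D.vmul a (D.ΦB b) := D.vmul_assoc _ _ _

theorem ΦB_ΦL_ΦB (a : A) : D.ΦB (D.ΦL (D.ΦB a)) = D.ΦB a :=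
  (D.A3 a D.i).symm.trans (D.hmul_i _)

theorem ΦB_ΦR_ΦB (a : A) : D.ΦB (D.ΦR (D.ΦB a)) = D.ΦB a :=
  (D.A4 D.i a).symm.trans (D.i_hmul _)

theorem ΦR_ΦB_ΦR (a : A) : D.ΦR (D.ΦB (D.ΦR a)) = D.ΦR a :=
  (D.A6 a D.e).symm.trans (D.vmul_e _)

theorem ΦL_ΦB_ΦL (a : A) : D.ΦL (D.ΦB (D.ΦL a)) = D.ΦL a := D.swap.ΦB_ΦL_ΦB a

/-- `b ⋆ a = Φ_L(b) ∘ a` for `b ∈ B`. -/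
theorem ΦB_hmul (a b : A) : D.hmul (D.ΦB a) b = D.vmul (D.ΦL (D.ΦB a)) b := D.A3 a b

/-- `a ⋆ b = Φ_R(b) ∘ a` for `b ∈ B`. -/
theorem hmul_ΦB (a b : A) : D.hmul a (D.ΦB b) = D.vmul (D.ΦR (D.ΦB b)) a := D.A4 a b

/-- `Φ_B` is a left `B`-module map. -/
theorem ΦB_hmul_left (a b : A) : D.ΦB (D.hmul (D.ΦB a) b) = D.hmul (D.ΦB a) (D.ΦB b) := by
  rw [ΦB_hmul, ΦB_vmul, ← ΦB_hmul]

/-- `Φ_B` is a right `B`-module map. -/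
theorem ΦB_hmul_right (a b : A) : D.ΦB (D.hmul a (D.ΦB b)) = D.hmul (D.ΦB a) (D.ΦB b) := by
  rw [hmul_ΦB, ΦB_vmul, ← hmul_ΦB]

theorem ΦR_vmul (a b : A) : D.ΦR (D.vmul (D.ΦR a) b) = D.vmul (D.ΦR a) (D.ΦR b) := by
  change D.hmul D.e (D.vmul (D.hmul D.e a) b) = D.vmul (D.hmul D.e a) (D.hmul D.e b)
  rw [D.A6 a b, D.A6 a (D.hmul D.e b), D.hmul_assoc]

/-- The bottom base algebra `B = Φ_B(A)`, a subalgebra of `H`. -/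
def B : Subalgebra k D.H :=
  Submodule.toSubalgebra (Submodule.map D.toH.toLinearMap (LinearMap.range D.ΦB))
    ⟨D.i, ⟨D.e, D.e_vmul _⟩, rfl⟩ (by
      rintro _ _ ⟨_, ⟨a, rfl⟩, rfl⟩ ⟨_, ⟨b, rfl⟩, rfl⟩
      exact ⟨_, ⟨_, D.ΦB_hmul_left a b⟩, rfl⟩)

/-- The left base algebra `L = Φ_L(A)`, a subalgebra of `V`. -/
def L : Subalgebra k D.V :=
  Submodule.toSubalgebra (Submodule.map D.toV.toLinearMap (LinearMap.range D.ΦL))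
    ⟨D.e, ⟨D.i, D.i_hmul _⟩, rfl⟩ (by
      rintro _ _ ⟨_, ⟨a, rfl⟩, rfl⟩ ⟨_, ⟨b, rfl⟩, rfl⟩
      exact ⟨_, ⟨_, D.swap.ΦB_hmul_left a b⟩, rfl⟩)

/-- The right base algebra `R = Φ_R(A)`, a subalgebra of `V`. -/
def R : Subalgebra k D.V :=
  Submodule.toSubalgebra (Submodule.map D.toV.toLinearMap (LinearMap.range D.ΦR))
    ⟨D.e, ⟨D.i, D.hmul_i _⟩, rfl⟩ (by
      rintro _ _ ⟨_, ⟨a, rfl⟩, rfl⟩ ⟨_, ⟨b, rfl⟩, rfl⟩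
      exact ⟨_, ⟨D.vmul (D.ΦR a) b, D.ΦR_vmul a b⟩, rfl⟩)

/-- The top base algebra `T = Φ_T(A)`, a subalgebra of `H`. -/
def T : Subalgebra k D.H :=
  Submodule.toSubalgebra (Submodule.map D.toH.toLinearMap (LinearMap.range D.ΦT))
    ⟨D.i, ⟨D.e, D.vmul_e _⟩, rfl⟩ (by
      rintro _ _ ⟨_, ⟨a, rfl⟩, rfl⟩ ⟨_, ⟨b, rfl⟩, rfl⟩
      exact ⟨_, ⟨D.hmul (D.ΦT a) b, D.swap.ΦR_vmul a b⟩, rfl⟩)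

/-- A double algebra is Frobenius if its four base homomorphisms are Frobenius homomorphisms
(`Φ_L`, `Φ_R` for the vertical algebra and `Φ_B`, `Φ_T` for the horizontal one). -/
structure IsFrobenius : Prop where
  frobL : IsFrobeniusHom D.L (D.toV.conj D.ΦL)
  frobB : IsFrobeniusHom D.B (D.toH.conj D.ΦB)
  frobR : IsFrobeniusHom D.R (D.toV.conj D.ΦR)
  frobT : IsFrobeniusHom D.T (D.toH.conj D.ΦT)

/-- `S` is an antipode of the double algebra. -/
structure IsAntipode (S : A →ₗ[k] A) : Prop where
  bottom : ∀ a a' a'', D.ΦB (D.hmul a' (D.vmul a'' a)) = D.ΦB (D.hmul (D.vmul a' (S a)) a'')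
  right : ∀ a a' a'', D.ΦR (D.vmul a' (D.hmul a a'')) = D.ΦR (D.vmul (D.hmul (S a) a') a'')
  left : ∀ a a' a'', D.ΦL (D.vmul (D.hmul a' a) a'') = D.ΦL (D.vmul a' (D.hmul a'' (S a)))
  top : ∀ a a' a'', D.ΦT (D.hmul (D.vmul a a') a'') = D.ΦT (D.hmul a' (D.vmul (S a) a''))

/-- An element of `B` as an element of `A`. -/
def valB : D.B →ₗ[k] A := D.toH.symm.toLinearMap ∘ₗ D.B.toSubmodule.subtype

/-- `Φ_B` as a map from `A` onto `B`. -/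
def inB : A →ₗ[k] D.B :=
  LinearMap.codRestrict (Subalgebra.toSubmodule D.B) (D.toH.toLinearMap ∘ₗ D.ΦB)
    (fun a => ⟨_, ⟨a, rfl⟩, rfl⟩)

@[simp] theorem valB_inB (a : A) : D.valB (D.inB a) = D.ΦB a := rfl

theorem valB_injective : Function.Injective D.valB := fun _ _ h => Subtype.ext h

theorem valB_mul (b b' : D.B) : D.valB (b * b') = D.hmul (D.valB b) (D.valB b') := rfl

theorem valB_one : D.valB 1 = D.i := rfl

theorem exists_inB (b : D.B) : ∃ a, D.inB a = b := by
  obtain ⟨_, _, ⟨a, rfl⟩, rfl⟩ := b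
  exact ⟨a, rfl⟩

theorem ΦB_ΦL_valB (b : D.B) : D.ΦB (D.ΦL (D.valB b)) = D.valB b := by
  obtain ⟨a, rfl⟩ := D.exists_inB b
  exact D.ΦB_ΦL_ΦB a

theorem ΦB_ΦR_valB (b : D.B) : D.ΦB (D.ΦR (D.valB b)) = D.valB b := by
  obtain ⟨a, rfl⟩ := D.exists_inB b
  exact D.ΦB_ΦR_ΦB a

/-- `b ⋆ a = Φ_L(b) ∘ a` for `b ∈ B`. -/
theorem valB_hmul (b : D.B) (a : A) : D.hmul (D.valB b) a = D.vmul (D.ΦL (D.valB b)) a := by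
  obtain ⟨c, rfl⟩ := D.exists_inB b
  exact D.ΦB_hmul c a

/-- `a ⋆ b = Φ_R(b) ∘ a` for `b ∈ B`. -/
theorem hmul_valB (b : D.B) (a : A) : D.hmul a (D.valB b) = D.vmul (D.ΦR (D.valB b)) a := by
  obtain ⟨c, rfl⟩ := D.exists_inB b
  exact D.hmul_ΦB a c

theorem ΦB_valB_hmul (b : D.B) (a : A) :
    D.ΦB (D.hmul (D.valB b) a) = D.hmul (D.valB b) (D.ΦB a) := by
  obtain ⟨c, rfl⟩ := D.exists_inB b
  exact D.ΦB_hmul_left c a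

theorem ΦB_hmul_valB (b : D.B) (a : A) :
    D.ΦB (D.hmul a (D.valB b)) = D.hmul (D.ΦB a) (D.valB b) := by
  obtain ⟨c, rfl⟩ := D.exists_inB b
  exact D.ΦB_hmul_right a c

/-- The source map `Φ_L|_B : B → V`. -/
def sourceB : D.B →ₐ[k] D.V :=
  AlgHom.ofLinearMap (D.toV.toLinearMap ∘ₗ D.ΦL ∘ₗ D.valB)
    (D.i_hmul D.e)
    (fun b b' => congrArg D.toV (by
      rw [LinearMap.comp_apply, valB_mul]
      refine Eq.trans ?_ (D.valB_hmul b (D.ΦL (D.valB b')))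
      exact D.hmul_assoc _ _ _))

/-- The target map `Φ_R|_B : B^op → V`. -/
def targetB : (D.B)ᵐᵒᵖ →ₐ[k] D.V :=
  AlgHom.ofLinearMap (D.toV.toLinearMap ∘ₗ D.ΦR ∘ₗ D.valB ∘ₗ (opLinearEquiv k).symm.toLinearMap)
    (D.hmul_i D.e)
    (fun b b' => congrArg D.toV (by
      refine Eq.trans ?_ (D.hmul_valB b.unop (D.ΦR (D.valB b'.unop)))
      exact (D.hmul_assoc _ _ _).symm))

theorem sourceB_apply (b : D.B) : D.sourceB b = D.toV (D.ΦL (D.valB b)) := rfl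
theorem targetB_apply (b : D.B) : D.targetB (op b) = D.toV (D.ΦR (D.valB b)) := rfl

theorem sourceB_mul (b : D.B) (a : A) : D.sourceB b * D.toV a = D.toV (D.hmul (D.valB b) a) :=
  congrArg D.toV (D.valB_hmul b a).symm

theorem targetB_mul (b : D.B) (a : A) : D.targetB (op b) * D.toV a = D.toV (D.hmul a (D.valB b)) :=
  congrArg D.toV (D.hmul_valB b a).symm

/-- The right action of `B` on `V`: `a · b = t(b) ∘ a`. -/
abbrev rB : D.B → D.V →ₗ[k] D.V := fun b => LinearMap.mulLeft k (D.targetB (op b))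
/-- The left action of `B` on `V`: `b · a = s(b) ∘ a`. -/
abbrev lB : D.B → D.V →ₗ[k] D.V := fun b => LinearMap.mulLeft k (D.sourceB b)

end Basic

section VB

variable {k A : Type*} [CommRing k] [AddCommGroup A] [Module k A] {D : DoubleAlgebra k A}
  (h : IsFrobeniusHom D.B (D.toH.conj D.ΦB))

/-- The number of elements of a chosen dual basis of `Φ_B`. -/
noncomputable def dimB : ℕ := h.exists_dual.choose
/-- The elements `u_k` of a chosen dual basis `∑ u_k ⊗ v_k` of `Φ_B`. -/
noncomputable def uB (j : Fin (dimB h)) : A :=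
  D.toH.symm (h.exists_dual.choose_spec.choose j)
/-- The elements `v_k` of a chosen dual basis `∑ u_k ⊗ v_k` of `Φ_B`. -/
noncomputable def vB (j : Fin (dimB h)) : A :=
  D.toH.symm (h.exists_dual.choose_spec.choose_spec.choose j)

theorem sum_ΦB_hmul_vB (a : A) :
    ∑ j, D.hmul (D.ΦB (D.hmul a (uB h j))) (vB h j) = a := by
  refine Eq.trans ?_ (congrArg D.toH.symm
    (h.exists_dual.choose_spec.choose_spec.choose_spec.1 (D.toH a)))
  rw [map_sum]
  rfl

theorem sum_uB_hmul_ΦB (a : A) :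
    ∑ j, D.hmul (uB h j) (D.ΦB (D.hmul (vB h j) a)) = a := by
  refine Eq.trans ?_ (congrArg D.toH.symm
    (h.exists_dual.choose_spec.choose_spec.choose_spec.2 (D.toH a)))
  rw [map_sum]
  rfl

/-- The comultiplication `Δ_B(a) = ∑ a ⋆ u_k ⊗ v_k` in `A ⊗_B A`. -/
noncomputable def comulB :
    D.V →ₗ[k] BTensor k D.rB D.lB :=
  BTensor.mk _ _ ∘ₗ ∑ j, (TensorProduct.mk k D.V D.V).flip (D.toV (vB h j)) ∘ₗ
    D.toV.toLinearMap ∘ₗ D.hmul.flip (uB h j) ∘ₗ D.toV.symm.toLinearMap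

theorem comulB_apply (a : A) :
    comulB h (D.toV a) = BTensor.mk D.rB D.lB
      (∑ j, D.toV (D.hmul a (uB h j)) ⊗ₜ[k] D.toV (vB h j)) := by
  rw [comulB, LinearMap.comp_apply, LinearMap.sum_apply]
  rfl

/-- `x ⋆ b ⊗ y = x ⊗ b ⋆ y` in `A ⊗_B A`. -/
theorem mk_bal (x y : A) (b : D.B) :
    BTensor.mk D.rB D.lB (D.toV (D.hmul x (D.valB b)) ⊗ₜ[k] D.toV y) =
      BTensor.mk D.rB D.lB (D.toV x ⊗ₜ[k] D.toV (D.hmul (D.valB b) y)) := by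
  have := BTensor.mk_tmul D.rB D.lB b (D.toV x) (D.toV y)
  rw [LinearMap.mulLeft_apply, LinearMap.mulLeft_apply, targetB_mul, sourceB_mul] at this
  exact this

/-- `∑ c ⋆ f(u_k) ⊗ v_k = ∑ c ⋆ u_k ⊗ g(v_k)` for `f`, `g` transposed with respect to `Φ_B`. -/
theorem transpose_dual (f g : A → A)
    (hfg : ∀ x y, D.ΦB (D.hmul x (f y)) = D.ΦB (D.hmul (g x) y)) (c : A) :
    BTensor.mk D.rB D.lB
        (∑ j, D.toV (D.hmul c (f (uB h j))) ⊗ₜ[k] D.toV (vB h j)) =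
      BTensor.mk D.rB D.lB
        (∑ j, D.toV (D.hmul c (uB h j)) ⊗ₜ[k] D.toV (g (vB h j))) := by
  have h3 : ∀ j, D.toV (D.hmul c (f (uB h j))) ⊗ₜ[k] D.toV (vB h j) =
      ∑ l, D.toV (D.hmul (D.hmul c (uB h l)) (D.ΦB (D.hmul (g (vB h l)) (uB h j)))) ⊗ₜ[k]
        D.toV (vB h j) := by
    intro j
    conv_lhs => rw [← sum_uB_hmul_ΦB h (f (uB h j))]
    simp only [map_sum, TensorProduct.sum_tmul, hfg, D.hmul_assoc]
  have h4 : ∀ l, D.toV (D.hmul c (uB h l)) ⊗ₜ[k] D.toV (g (vB h l)) =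
      ∑ j, D.toV (D.hmul c (uB h l)) ⊗ₜ[k]
        D.toV (D.hmul (D.ΦB (D.hmul (g (vB h l)) (uB h j))) (vB h j)) := by
    intro l
    conv_lhs => rw [← sum_ΦB_hmul_vB h (g (vB h l))]
    simp only [map_sum, TensorProduct.tmul_sum]
  simp only [h3, h4, map_sum]
  rw [Finset.sum_comm]
  exact Finset.sum_congr rfl fun l _ => Finset.sum_congr rfl fun j _ => mk_bal _ _ (D.inB _)

/-- `Δ_B(a ⋆ c) = ∑ a ⋆ u_k ⊗ v_k ⋆ c`. -/
theorem comulB_hmul (a c : A) :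
    comulB h (D.toV (D.hmul a c)) = BTensor.mk D.rB D.lB
      (∑ j, D.toV (D.hmul a (uB h j)) ⊗ₜ[k] D.toV (D.hmul (vB h j) c)) := by
  rw [comulB_apply, ← transpose_dual h (fun y => D.hmul c y) (fun x => D.hmul x c)]
  · simp only [D.hmul_assoc]
  · intro x y
    simp only [D.hmul_assoc]

theorem comulB_eq (a : A) :
    comulB h (D.toV a) = BTensor.mk D.rB D.lB
      (∑ j, D.toV (uB h j) ⊗ₜ[k] D.toV (D.hmul (vB h j) a)) := by
  have := comulB_hmul h D.i a
  simpa only [D.i_hmul] using this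

theorem comulB_targetB_mul (b : D.B) (a : D.V)
    (z : D.V ⊗[k] D.V) (hz : BTensor.mk _ _ z = comulB h a) :
    comulB h (D.targetB (op b) * a) =
      BTensor.mk D.rB D.lB ((LinearMap.mulLeft k (D.targetB (op b))).lTensor D.V z) := by
  obtain ⟨a, rfl⟩ := D.toV.surjective a
  have hf := BTensor.congr (r := D.rB) (l := D.lB)
    (BTensor.mk D.rB D.lB ∘ₗ (LinearMap.mulLeft k (D.targetB (op b))).lTensor D.V)
    (fun b' m n => by
      obtain ⟨m, rfl⟩ := D.toV.surjective m
      obtain ⟨n, rfl⟩ := D.toV.surjective n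
      simp only [LinearMap.comp_apply, LinearMap.lTensor_tmul, LinearMap.mulLeft_apply,
        targetB_mul, sourceB_mul, mk_bal, D.hmul_assoc]) (hz.trans (comulB_apply h a))
  rw [LinearMap.comp_apply, LinearMap.comp_apply] at hf
  rw [hf, targetB_mul, comulB_hmul]
  simp only [map_sum, LinearMap.lTensor_tmul, LinearMap.mulLeft_apply, targetB_mul]

theorem comulB_sourceB_mul (b : D.B) (a : D.V)
    (z : D.V ⊗[k] D.V) (hz : BTensor.mk _ _ z = comulB h a) :
    comulB h (D.sourceB b * a) =
      BTensor.mk D.rB D.lB ((LinearMap.mulLeft k (D.sourceB b)).rTensor D.V z) := by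
  obtain ⟨a, rfl⟩ := D.toV.surjective a
  have hf := BTensor.congr (r := D.rB) (l := D.lB)
    (BTensor.mk D.rB D.lB ∘ₗ (LinearMap.mulLeft k (D.sourceB b)).rTensor D.V)
    (fun b' m n => by
      obtain ⟨m, rfl⟩ := D.toV.surjective m
      obtain ⟨n, rfl⟩ := D.toV.surjective n
      simp only [LinearMap.comp_apply, LinearMap.rTensor_tmul, LinearMap.mulLeft_apply,
        targetB_mul, sourceB_mul, ← mk_bal, D.hmul_assoc]) (hz.trans (comulB_apply h a))
  rw [LinearMap.comp_apply, LinearMap.comp_apply] at hf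
  rw [hf, sourceB_mul, comulB_apply]
  simp only [map_sum, LinearMap.rTensor_tmul, LinearMap.mulLeft_apply, sourceB_mul, D.hmul_assoc]

theorem tri_bal_left (x y w : A) (b : D.B) :
    TriTensor.mk D.rB D.lB ((D.toV (D.hmul x (D.valB b)) ⊗ₜ[k] D.toV y) ⊗ₜ[k] D.toV w) =
      TriTensor.mk D.rB D.lB ((D.toV x ⊗ₜ[k] D.toV (D.hmul (D.valB b) y)) ⊗ₜ[k] D.toV w) := by
  rw [← TriTensor.inl_mk, mk_bal, TriTensor.inl_mk]

theorem tri_bal_right (x y w : A) (b : D.B) :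
    TriTensor.mk D.rB D.lB ((D.toV x ⊗ₜ[k] D.toV (D.hmul y (D.valB b))) ⊗ₜ[k] D.toV w) =
      TriTensor.mk D.rB D.lB ((D.toV x ⊗ₜ[k] D.toV y) ⊗ₜ[k] D.toV (D.hmul (D.valB b) w)) := by
  have := TriTensor.mk_right D.rB D.lB b (D.toV x) (D.toV y) (D.toV w)
  rw [LinearMap.mulLeft_apply, LinearMap.mulLeft_apply, targetB_mul, sourceB_mul] at this
  exact this

theorem comulId_comulB (a c : A) :
    comulId (comulB h) (D.toV a ⊗ₜ[k] D.toV c) = ∑ j, TriTensor.mk D.rB D.lB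
      ((D.toV (D.hmul a (uB h j)) ⊗ₜ[k] D.toV (vB h j)) ⊗ₜ[k] D.toV c) := by
  rw [comulId, LinearMap.comp_apply, LinearMap.rTensor_tmul, comulB_apply, TriTensor.inl_mk,
    TensorProduct.sum_tmul, map_sum]

theorem comulId_comulB' (a b c : A) :
    comulId (comulB h) (D.toV (D.hmul a b) ⊗ₜ[k] D.toV c) = ∑ j, TriTensor.mk D.rB D.lB
      ((D.toV (D.hmul a (uB h j)) ⊗ₜ[k] D.toV (D.hmul (vB h j) b)) ⊗ₜ[k] D.toV c) := by
  rw [comulId, LinearMap.comp_apply, LinearMap.rTensor_tmul, comulB_hmul, TriTensor.inl_mk,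
    TensorProduct.sum_tmul, map_sum]

theorem idComul_comulB (a c : A) :
    idComul (comulB h) (D.toV a ⊗ₜ[k] D.toV c) = ∑ j, TriTensor.mk D.rB D.lB
      ((D.toV a ⊗ₜ[k] D.toV (D.hmul c (uB h j))) ⊗ₜ[k] D.toV (vB h j)) := by
  rw [idComul, LinearMap.comp_apply, LinearMap.lTensor_tmul, comulB_apply, TriTensor.inr_mk,
    TensorProduct.tmul_sum, map_sum, map_sum]
  rfl

theorem coassocB (a : D.V)
    (z : D.V ⊗[k] D.V) (hz : BTensor.mk _ _ z = comulB h a) :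
    comulId (comulB h) z = idComul (comulB h) z := by
  obtain ⟨a, rfl⟩ := D.toV.surjective a
  have hf := BTensor.congr (r := D.rB) (l := D.lB) (comulId (comulB h) - idComul (comulB h))
    (fun b' m n => by
      obtain ⟨m, rfl⟩ := D.toV.surjective m
      obtain ⟨n, rfl⟩ := D.toV.surjective n
      simp only [LinearMap.sub_apply, LinearMap.mulLeft_apply, targetB_mul, sourceB_mul]
      rw [comulId_comulB', comulId_comulB, idComul_comulB, idComul_comulB]
      simp only [tri_bal_left, tri_bal_right, D.hmul_assoc]) (hz.trans (comulB_apply h a))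
  rw [← sub_eq_zero, ← LinearMap.sub_apply, hf, LinearMap.sub_apply, sub_eq_zero, map_sum, map_sum]
  simp only [comulId_comulB', idComul_comulB]
  exact Finset.sum_comm

theorem takeuchiB (a : D.V) (b : D.B)
    (z : D.V ⊗[k] D.V) (hz : BTensor.mk _ _ z = comulB h a) :
    BTensor.mk D.rB D.lB ((LinearMap.mulRight k (D.targetB (op b))).rTensor D.V z) =
      BTensor.mk D.rB D.lB ((LinearMap.mulRight k (D.sourceB b)).lTensor D.V z) := by
  obtain ⟨a, rfl⟩ := D.toV.surjective a
  have hf1 := BTensor.congr (r := D.rB) (l := D.lB)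
    (BTensor.mk D.rB D.lB ∘ₗ (LinearMap.mulRight k (D.targetB (op b))).rTensor D.V)
    (fun b' m n => by
      simp only [LinearMap.comp_apply, LinearMap.rTensor_tmul, LinearMap.mulRight_apply]
      rw [LinearMap.mulLeft_apply, mul_assoc]
      exact BTensor.mk_tmul D.rB D.lB b' (m * D.targetB (op b)) n) (hz.trans (comulB_apply h a))
  have hf2 := BTensor.congr (r := D.rB) (l := D.lB)
    (BTensor.mk D.rB D.lB ∘ₗ (LinearMap.mulRight k (D.sourceB b)).lTensor D.V)
    (fun b' m n => by
      simp only [LinearMap.comp_apply, LinearMap.lTensor_tmul, LinearMap.mulRight_apply]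
      refine (BTensor.mk_tmul D.rB D.lB b' m (n * D.sourceB b)).trans ?_
      simp only [LinearMap.mulLeft_apply, mul_assoc]) (hz.trans (comulB_apply h a))
  rw [LinearMap.comp_apply, LinearMap.comp_apply] at hf1 hf2
  rw [hf1, hf2]
  simp only [map_sum, LinearMap.rTensor_tmul, LinearMap.lTensor_tmul, LinearMap.mulRight_apply,
    sourceB_apply, targetB_apply, toV_mul]
  have h5 : ∀ x, D.vmul x (D.ΦR (D.valB b)) = D.hmul x (D.ΦT (D.ΦR (D.valB b))) :=
    fun x => D.A5 x (D.valB b)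
  have h2 : ∀ x, D.vmul x (D.ΦL (D.valB b)) = D.hmul (D.ΦT (D.ΦL (D.valB b))) x :=
    fun x => D.A2 x (D.valB b)
  have := transpose_dual h (fun y => D.hmul y (D.ΦT (D.ΦR (D.valB b))))
    (fun x => D.hmul (D.ΦT (D.ΦL (D.valB b))) x) (fun x y => by
      rw [← D.hmul_assoc, ← h5, ΦB_vmul, ΦB_ΦR_valB, D.hmul_assoc, ← h2, ΦB_vmul, ΦB_ΦL_valB]) a
  rw [map_sum, map_sum] at this
  simp only [h5, h2, D.hmul_assoc]
  exact this

theorem counit_comulB (a : D.V)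
    (z : D.V ⊗[k] D.V) (hz : BTensor.mk _ _ z = comulB h a) :
    TensorProduct.lift (LinearMap.mul k D.V ∘ₗ D.sourceB.toLinearMap ∘ₗ
      (D.inB ∘ₗ D.toV.symm.toLinearMap)) z = a := by
  obtain ⟨a, rfl⟩ := D.toV.surjective a
  set F := TensorProduct.lift (LinearMap.mul k D.V ∘ₗ D.sourceB.toLinearMap ∘ₗ
      (D.inB ∘ₗ D.toV.symm.toLinearMap)) with hF
  have hFt : ∀ x y, F (D.toV x ⊗ₜ D.toV y) = D.toV (D.hmul (D.ΦB x) y) :=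
    fun x y => D.sourceB_mul (D.inB x) y
  rw [BTensor.congr (r := D.rB) (l := D.lB) F (fun b m n => by
    obtain ⟨m, rfl⟩ := D.toV.surjective m
    obtain ⟨n, rfl⟩ := D.toV.surjective n
    simp only [LinearMap.mulLeft_apply, targetB_mul, sourceB_mul, hFt, ΦB_hmul_valB, D.hmul_assoc])
    (hz.trans (comulB_apply h a)), map_sum]
  simp only [hFt]
  rw [← map_sum, sum_ΦB_hmul_vB]

theorem comul_counitB (a : D.V)
    (z : D.V ⊗[k] D.V) (hz : BTensor.mk _ _ z = comulB h a) :
    TensorProduct.lift (LinearMap.flip (LinearMap.mul k D.V ∘ₗ D.targetB.toLinearMap ∘ₗ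
      (opLinearEquiv k).toLinearMap ∘ₗ (D.inB ∘ₗ D.toV.symm.toLinearMap))) z = a := by
  obtain ⟨a, rfl⟩ := D.toV.surjective a
  set F := TensorProduct.lift (LinearMap.flip (LinearMap.mul k D.V ∘ₗ D.targetB.toLinearMap ∘ₗ
      (opLinearEquiv k).toLinearMap ∘ₗ (D.inB ∘ₗ D.toV.symm.toLinearMap))) with hF
  have hFt : ∀ x y, F (D.toV x ⊗ₜ D.toV y) = D.toV (D.hmul x (D.ΦB y)) :=
    fun x y => D.targetB_mul (D.inB y) x
  rw [BTensor.congr (r := D.rB) (l := D.lB) F (fun b m n => by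
    obtain ⟨m, rfl⟩ := D.toV.surjective m
    obtain ⟨n, rfl⟩ := D.toV.surjective n
    simp only [LinearMap.mulLeft_apply, targetB_mul, sourceB_mul, hFt, ΦB_valB_hmul, D.hmul_assoc])
    (hz.trans (comulB_eq h a)), map_sum]
  simp only [hFt]
  rw [← map_sum, sum_uB_hmul_ΦB]

/-- The left almost bialgebroid `V_B = ⟨V, B, Φ_L|_B, Φ_R|_B, Δ_B, Φ_B⟩`. -/
noncomputable def VB :
    LeftAlmostBialgebroid k D.V D.B where
  s := D.sourceB
  t := D.targetB
  s_mul_t b b' := by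
    refine (D.sourceB_mul b (D.ΦR (D.valB b'))).trans
      (Eq.trans ?_ (D.targetB_mul b' (D.ΦL (D.valB b))).symm)
    exact congrArg D.toV (D.hmul_assoc _ _ _).symm
  comul := comulB h
  counit := D.inB ∘ₗ D.toV.symm.toLinearMap
  comul_s_mul b a z hz := comulB_sourceB_mul h b a z hz
  comul_t_mul b a z hz := comulB_targetB_mul h b a z hz
  counit_s_mul b a := by
    obtain ⟨a, rfl⟩ := D.toV.surjective a
    rw [sourceB_mul]
    exact D.valB_injective (D.ΦB_valB_hmul b a)
  counit_t_mul b a := by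
    obtain ⟨a, rfl⟩ := D.toV.surjective a
    rw [targetB_mul]
    exact D.valB_injective (D.ΦB_hmul_valB b a)
  coassoc := coassocB h
  counit_comul a z hz := counit_comulB h a z hz
  comul_counit a z hz := comul_counitB h a z hz
  takeuchi a b z hz := takeuchiB h a b z hz
  comul_one := by
    rw [← D.toV_e, comulB_apply]
    have h1 : ∀ a, D.hmul D.e a = D.hmul D.e (D.valB (D.inB (D.ΦR a))) := fun a =>
      (D.ΦR_ΦB_ΦR a).symm
    have h2 : ∀ j, BTensor.mk D.rB D.lB
        (D.toV (D.hmul D.e (uB h j)) ⊗ₜ[k] D.toV (vB h j)) = BTensor.mk D.rB D.lB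
          (D.toV D.e ⊗ₜ[k] D.toV (D.hmul (D.ΦB (D.hmul D.e (uB h j))) (vB h j))) := by
      intro j
      exact (congrArg (fun x => BTensor.mk D.rB D.lB (D.toV x ⊗ₜ[k] D.toV (vB h j)))
        (h1 (uB h j))).trans (mk_bal _ _ _)
    simp only [map_sum, h2]
    rw [← map_sum, ← TensorProduct.tmul_sum, ← map_sum, sum_ΦB_hmul_vB]
  counit_one := D.valB_injective (D.e_vmul _)
  counit_mul_s a a' := by
    refine D.valB_injective ?_
    refine (D.ΦB_vmul (D.toV.symm a) _).trans (Eq.trans ?_ (D.ΦB_vmul (D.toV.symm a) _).symm)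
    exact congrArg _ (D.ΦB_ΦL_ΦB _)
  counit_mul_t a a' := by
    refine D.valB_injective ?_
    refine (D.ΦB_vmul (D.toV.symm a) _).trans (Eq.trans ?_ (D.ΦB_vmul (D.toV.symm a) _).symm)
    exact congrArg _ (D.ΦB_ΦR_ΦB _)

/-- The left almost bialgebroid `H_L = ⟨H, L, Φ_B|_L, Φ_T|_L, Δ_L, Φ_L⟩`, with
`Δ_L(a) = ∑ a ∘ x_j ⊗ y_j` for the dual basis of `Φ_L`; it is the `V_B` of `A^D`. -/
noncomputable def HL (h : IsFrobeniusHom D.L (D.toV.conj D.ΦL)) :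
    LeftAlmostBialgebroid k D.H D.L :=
  VB (D := D.swap) h

/-- `V_B` is finitely generated projective as a right `B`-module:
`a = ∑ u_k ⋆ Φ_B(v_k ⋆ a) = ∑ t(Φ_B(v_k ⋆ a)) ∘ u_k`. -/
noncomputable def rightDualBasisVB :
    LeftAlmostBialgebroid.LeftDual.DualBasis (VB h) where
  n := dimB h
  e := fun j => D.toV (uB h j)
  φ := fun j => ⟨D.inB ∘ₗ D.hmul (vB h j) ∘ₗ D.toV.symm.toLinearMap, fun b a => by
    obtain ⟨a, rfl⟩ := D.toV.surjective a
    refine D.valB_injective ?_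
    refine (congrArg (fun x => D.ΦB (D.hmul (vB h j) (D.toV.symm x))) (D.targetB_mul b a)).trans ?_
    refine Eq.trans ?_ (D.ΦB_hmul_valB b (D.hmul (vB h j) a))
    exact congrArg D.ΦB (D.hmul_assoc _ _ _).symm⟩
  sum_eq := fun a => by
    obtain ⟨a, rfl⟩ := D.toV.surjective a
    conv_rhs => rw [← sum_uB_hmul_ΦB h a, map_sum]
    exact Finset.sum_congr rfl fun j _ => D.targetB_mul (D.inB (D.hmul (vB h j) a)) _

/-- `V_B` is finitely generated projective as a left `B`-module:
`a = ∑ Φ_B(a ⋆ u_k) ⋆ v_k = ∑ s(Φ_B(a ⋆ u_k)) ∘ v_k`. -/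
noncomputable def leftDualBasisVB :
    LeftAlmostBialgebroid.RightDual.DualBasis (VB h) where
  n := dimB h
  e := fun j => D.toV (vB h j)
  φ := fun j => ⟨D.inB ∘ₗ D.hmul.flip (uB h j) ∘ₗ D.toV.symm.toLinearMap, fun b a => by
    obtain ⟨a, rfl⟩ := D.toV.surjective a
    refine D.valB_injective ?_
    refine (congrArg (fun x => D.ΦB (D.hmul (D.toV.symm x) (uB h j))) (D.sourceB_mul b a)).trans ?_
    refine Eq.trans ?_ (D.ΦB_valB_hmul b (D.hmul a (uB h j)))
    exact congrArg D.ΦB (D.hmul_assoc _ _ _)⟩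
  sum_eq := fun a => by
    obtain ⟨a, rfl⟩ := D.toV.surjective a
    conv_rhs => rw [← sum_ΦB_hmul_vB h a, map_sum]
    exact Finset.sum_congr rfl fun j _ => D.sourceB_mul (D.inB (D.hmul a (uB h j))) _

/-- The left dual of `V_B`. -/
noncomputable def leftDualVB :
    RightAlmostBialgebroid k (VB h).LeftDual D.B :=
  (VB h).leftDual (rightDualBasisVB h)

/-- The right dual of `V_B`. -/
noncomputable def rightDualVB :
    RightAlmostBialgebroid k (VB h).RightDual D.B :=
  (VB h).rightDual (leftDualBasisVB h)

/-- The right almost bialgebroid `H_L^op = ⟨H^op, L, Φ_T|_L, Φ_B|_L, Δ_L, Φ_L⟩`. -/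
noncomputable def HLop (h : IsFrobeniusHom D.L (D.toV.conj D.ΦL)) :
    RightAlmostBialgebroid k (D.H)ᵐᵒᵖ D.L :=
  (HL h).opposite

/-- The map `Φ_B|_L : L → B`. -/
def ΦBL (D : DoubleAlgebra k A) : D.L →ₗ[k] D.B :=
  D.inB ∘ₗ D.toV.symm.toLinearMap ∘ₗ D.L.toSubmodule.subtype

/-- The map `h ↦ Φ_B(h ⋆ _)` from `H^op` to the left dual of `V_B`. -/
noncomputable def kappaL :
    (D.H)ᵐᵒᵖ →ₗ[k] (VB h).LeftDual where
  toFun x := ⟨D.inB ∘ₗ D.hmul (D.toH.symm x.unop) ∘ₗ D.toV.symm.toLinearMap, fun b a => by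
    obtain ⟨a, rfl⟩ := D.toV.surjective a
    refine D.valB_injective ?_
    refine (congrArg (fun y => D.ΦB (D.hmul (D.toH.symm x.unop) (D.toV.symm y)))
      (D.targetB_mul b a)).trans ?_
    refine Eq.trans ?_ (D.ΦB_hmul_valB b (D.hmul (D.toH.symm x.unop) a))
    exact congrArg D.ΦB (D.hmul_assoc _ _ _).symm⟩
  map_add' x y := by
    refine Subtype.ext (LinearMap.ext fun a => ?_)
    exact congrArg D.inB (LinearMap.map_add₂ D.hmul _ _ _) |>.trans (map_add D.inB _ _)
  map_smul' c x := by
    refine Subtype.ext (LinearMap.ext fun a => ?_)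
    exact congrArg D.inB (LinearMap.map_smul₂ D.hmul _ _ _) |>.trans (map_smul D.inB _ _)

/-- The map `h ↦ Φ_B Φ_L(_ ∘ h)` from `H^op` to the right dual of `V_B`. -/
noncomputable def kappaR :
    (D.H)ᵐᵒᵖ →ₗ[k] (VB h).RightDual where
  toFun x := ⟨D.inB ∘ₗ D.ΦL ∘ₗ D.vmul.flip (D.toH.symm x.unop) ∘ₗ D.toV.symm.toLinearMap,
    fun b a => by
      obtain ⟨a, rfl⟩ := D.toV.surjective a
      refine D.valB_injective ?_
      refine Eq.trans ?_ (D.ΦB_valB_hmul b (D.ΦL (D.vmul a (D.toH.symm x.unop))))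
      refine congrArg D.ΦB ?_
      refine Eq.trans (congrArg D.ΦL (D.vmul_assoc (D.ΦL (D.valB b)) a _)) ?_
      refine Eq.trans (congrArg D.ΦL (D.valB_hmul b _).symm) ?_
      exact D.hmul_assoc _ _ _⟩
  map_add' x y := by
    refine Subtype.ext (LinearMap.ext fun a => ?_)
    exact congrArg (D.inB ∘ₗ D.ΦL) (map_add (D.vmul (D.toV.symm a)) _ _) |>.trans
      (map_add (D.inB ∘ₗ D.ΦL) _ _)
  map_smul' c x := by
    refine Subtype.ext (LinearMap.ext fun a => ?_)
    exact congrArg (D.inB ∘ₗ D.ΦL) (map_smul (D.vmul (D.toV.symm a)) _ _) |>.trans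
      (map_smul (D.inB ∘ₗ D.ΦL) _ _)

theorem kappaL_apply (x v : A) :
    D.valB ((kappaL h (op (D.toH x))) (D.toV v)) = D.ΦB (D.hmul x v) := rfl

theorem kappaR_apply (x v : A) :
    D.valB ((kappaR h (op (D.toH x))) (D.toV v)) = D.ΦB (D.ΦL (D.vmul v x)) := rfl

theorem HLop_s_apply (h : IsFrobeniusHom D.L (D.toV.conj D.ΦL)) (l : D.L) :
    (HLop h).s l = op (D.toH (D.ΦT (D.toV.symm l.1))) := rfl

theorem HLop_t_apply (h : IsFrobeniusHom D.L (D.toV.conj D.ΦL)) (l : D.L) :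
    (HLop h).t (op l) = op (D.toH (D.ΦB (D.toV.symm l.1))) := rfl

theorem HLop_counit_apply (h : IsFrobeniusHom D.L (D.toV.conj D.ΦL)) (x : A) :
    ((HLop h).counit (op (D.toH x))).1 = D.toV (D.ΦL x) := rfl

theorem HLop_comul_apply (h : IsFrobeniusHom D.L (D.toV.conj D.ΦL)) (x : A) :
    ∃ (n : ℕ) (p q : Fin n → A),
      ((∀ a, ∑ j, D.vmul (D.ΦL (D.vmul a (p j))) (q j) = a) ∧
        ∀ a, ∑ j, D.vmul (p j) (D.ΦL (D.vmul (q j) a)) = a) ∧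
      (HLop h).comul (op (D.toH x)) = BTensor.mk _ _
        (∑ j, op (D.toH (D.vmul x (p j))) ⊗ₜ[k] op (D.toH (q j))) := by
  refine ⟨dimB (D := D.swap) h, uB (D := D.swap) h, vB (D := D.swap) h,
    ⟨sum_ΦB_hmul_vB (D := D.swap) h, sum_uB_hmul_ΦB (D := D.swap) h⟩, ?_⟩
  refine (congrArg (HL h).opTensor (comulB_apply (D := D.swap) h x)).trans ?_
  refine ((HL h).opTensor_mk _).trans ?_
  congr 1
  exact map_sum (TensorProduct.map (opLinearEquiv k).toLinearMap (opLinearEquiv k).toLinearMap)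
    (fun j => D.toH (D.vmul x (uB (D := D.swap) h j)) ⊗ₜ[k] D.toH (vB (D := D.swap) h j)) Finset.univ

end VB

end DoubleAlgebra

/-! Nearly everything that an isomorphism requires holds in every Frobenius double algebra. What can
fail is one condition for each map, and each of these conditions turns out to be one of the antipode
axioms for a map that is known in advance.

The left antipode axiom with a'' = i reads Φ_L(a ∘ S(w)) = Φ_L Φ_B(a ⋆ w). Since Φ_L has a dual
basis ∑ x_j ⊗ y_j, this determines S: it must be `antipodeMap`, S(w) = ∑ x_j ∘ Φ_L Φ_B(y_j ⋆ w).
This S always exists and always satisfies that special case (`ΦL_vmul_antipodeMap`). In other words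
`kappaR` sends S(w) to the functional Φ_B(_ ⋆ w). It is also always surjective, because the dual
basis of Φ_B represents every left B-linear functional as Φ_B(_ ⋆ w).

For the left dual, `kappaL` is always bijective, multiplicative and compatible with units, sources,
targets and counits. The coproduct of the dual is characterized by ψ(a' ∘ a) = ψ⁽¹⁾(a' ∘
t(ψ⁽²⁾(a))). Pairing the image of Δ_L(x) with a', a gives Φ_B((x ∘ S(a)) ⋆ a'), whereas `kappaL` of
x evaluated at a' ∘ a gives Φ_B(x ⋆ (a' ∘ a)). So comultiplicativity is exactly the bottom axiom for
S (`kappaL_comul_iff`).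

For the right dual the roles of product and coproduct are exchanged. Once `kappaR` is
multiplicative, so that its tensor square is well defined over the bases, comultiplicativity is just
the dual basis identity of Φ_L (`kappaR_comul`). The product of the images of S(w) and y is the
functional Φ_B Φ_L((_ ⋆ w) ∘ y), while the image of their product is Φ_B Φ_L(_ ∘ (y ⋆ S(w))). As S
is surjective, multiplicativity is exactly the left axiom for S (`kappaR_mul_iff`).

It remains to see that the bottom and left axioms for S imply the right and top ones
(`isAntipode_of_bottom_of_left`). By nondegeneracy of Φ_B and Φ_L the two axioms make S reverse both
products. A surjective such map fixes both units, hence carries Φ_L to Φ_R and Φ_B to Φ_T, and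
applying S to the left and bottom axioms gives the right and top axioms. -/

/-- A multiplicative F that intertwines sources and targets respects the balancing relations, so F ⊗
F descends to the tensor squares over the bases. Compatibility with coproducts can therefore be
checked on a single representative of Δ(x). -/
theorem RightAlmostBialgebroid.mk_map_congr {k A B A' B' : Type*} [CommRing k]
    [Ring A] [Algebra k A] [Ring B] [Algebra k B] [Ring A'] [Algebra k A'] [Ring B'] [Algebra k B']
    (P : RightAlmostBialgebroid k A B) (Q : RightAlmostBialgebroid k A' B')
    (F : A →ₗ[k] A') (f : B →ₗ[k] B') (hF : ∀ x y, F (x * y) = F x * F y)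
    (hs : ∀ b, F (P.s b) = Q.s (f b)) (ht : ∀ b, F (P.t (op b)) = Q.t (op (f b)))
    {z z' : A ⊗[k] A}
    (h : BTensor.mk (fun b : B => LinearMap.mulRight k (P.s b))
      (fun b : B => LinearMap.mulRight k (P.t (op b))) z = BTensor.mk _ _ z') :
    BTensor.mk (fun b : B' => LinearMap.mulRight k (Q.s b))
      (fun b : B' => LinearMap.mulRight k (Q.t (op b))) (TensorProduct.map F F z) =
        BTensor.mk _ _ (TensorProduct.map F F z') := by
  refine BTensor.congr (BTensor.mk (fun b : B' => LinearMap.mulRight k (Q.s b))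
      (fun b : B' => LinearMap.mulRight k (Q.t (op b))) ∘ₗ TensorProduct.map F F)
    (fun b m n => ?_) h
  simp only [LinearMap.comp_apply, TensorProduct.map_tmul, LinearMap.mulRight_apply, hF, hs, ht]
  exact BTensor.mk_tmul (fun b : B' => LinearMap.mulRight k (Q.s b))
    (fun b : B' => LinearMap.mulRight k (Q.t (op b))) (f b) (F m) (F n)

namespace DoubleAlgebra

variable {k A : Type*} [CommRing k] [AddCommGroup A] [Module k A] {D : DoubleAlgebra k A}

/-! ### Calculus of the base homomorphisms. -/

section Identities

/-- This and the next two identities trade a vertical multiplication by a base element for a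
horizontal one on a definite side. Associativity of ⋆ then lets base elements move past horizontal
factors. -/
theorem ΦL_vmul (D : DoubleAlgebra k A) (a b : A) :
    D.vmul (D.ΦL a) b = D.hmul (D.ΦB (D.ΦL a)) b := D.A1 a b

theorem vmul_ΦL (D : DoubleAlgebra k A) (a b : A) :
    D.vmul a (D.ΦL b) = D.hmul (D.ΦT (D.ΦL b)) a := D.A2 a b

theorem vmul_ΦR (D : DoubleAlgebra k A) (a b : A) :
    D.vmul a (D.ΦR b) = D.hmul a (D.ΦT (D.ΦR b)) := D.A5 a b

theorem ΦL_hmul (D : DoubleAlgebra k A) (a b : A) : D.ΦL (D.hmul a b) = D.hmul a (D.ΦL b) :=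
  D.hmul_assoc _ _ _

theorem ΦL_ΦL_vmul (D : DoubleAlgebra k A) (a b : A) :
    D.ΦL (D.vmul (D.ΦL a) b) = D.vmul (D.ΦL a) (D.ΦL b) := D.swap.ΦB_hmul_left a b

theorem ΦL_vmul_ΦL (D : DoubleAlgebra k A) (a b : A) :
    D.ΦL (D.vmul a (D.ΦL b)) = D.vmul (D.ΦL a) (D.ΦL b) := D.swap.ΦB_hmul_right a b

/-- An element of B acts from the left in H as an element of L acts from the left in V, and Φ_L is
left L-linear. -/
theorem ΦL_ΦB_hmul_vmul (D : DoubleAlgebra k A) (a b c : A) :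
    D.ΦL (D.vmul (D.hmul (D.ΦB a) b) c) = D.hmul (D.ΦB a) (D.ΦL (D.vmul b c)) := by
  rw [ΦB_hmul, D.vmul_assoc, ΦL_ΦL_vmul, ← ΦB_hmul]

/-- Left vertical multiplication by L is left horizontal multiplication by B, which commutes with
right horizontal multiplication by c. -/
theorem ΦL_vmul_hmul (D : DoubleAlgebra k A) (a b c : A) :
    D.vmul (D.ΦL a) (D.hmul b c) = D.hmul (D.vmul (D.ΦL a) b) c := by
  rw [ΦL_vmul, ΦL_vmul, D.hmul_assoc]

/-- Right vertical multiplication by L is left horizontal multiplication by an element of T, so it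
too commutes with right horizontal multiplication. -/
theorem vmul_ΦL_hmul (D : DoubleAlgebra k A) (a b c : A) :
    D.hmul (D.vmul a (D.ΦL b)) c = D.vmul (D.hmul a c) (D.ΦL b) := by
  rw [vmul_ΦL, vmul_ΦL, D.hmul_assoc]

/-- The value Φ_B(a ∘ b) = a ∘ Φ_B(b) depends on b only through Φ_B(b), and Φ_L Φ_B(b) has the same
image under Φ_B. The next lemma does the same with Φ_R. -/
theorem ΦB_vmul_ΦL_ΦB (D : DoubleAlgebra k A) (a b : A) :
    D.ΦB (D.vmul a (D.ΦL (D.ΦB b))) = D.ΦB (D.vmul a b) := by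
  rw [ΦB_vmul, ΦB_ΦL_ΦB, ← ΦB_vmul]

theorem ΦB_vmul_ΦR_ΦB (D : DoubleAlgebra k A) (a b : A) :
    D.ΦB (D.vmul a (D.ΦR (D.ΦB b))) = D.ΦB (D.vmul a b) := by
  rw [ΦB_vmul, ΦB_ΦR_ΦB, ← ΦB_vmul]

/-- Right vertical multiplication by R is right horizontal multiplication by an element of T, so the
factor from R can be moved outside a ⋆ b, where Φ_B no longer sees the difference between it and c.
-/
theorem ΦB_hmul_vmul_ΦR (D : DoubleAlgebra k A) (a b c : A) :
    D.ΦB (D.hmul a (D.vmul b (D.ΦR (D.ΦB c)))) = D.ΦB (D.vmul (D.hmul a b) c) := by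
  rw [vmul_ΦR, ← D.hmul_assoc, ← vmul_ΦR, ΦB_vmul_ΦR_ΦB]

theorem ΦL_vmul_ΦB (D : DoubleAlgebra k A) (a l : A) :
    D.ΦL (D.vmul (D.ΦB a) (D.ΦL l)) = D.hmul (D.ΦB a) (D.ΦL l) := by
  rw [ΦL_vmul_ΦL, ← ΦB_hmul]

end Identities

/-! ### Nondegeneracy of the forms Φ_B(a ⋆ b) and Φ_L(a ∘ b). -/

section Nondegenerate

/-- The dual basis expansion recovers x from the values Φ_B(v_k ⋆ x). -/
theorem hmul_right_cancel_ΦB (h : IsFrobeniusHom D.B (D.toH.conj D.ΦB)) {x y : A}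
    (hxy : ∀ a, D.ΦB (D.hmul a x) = D.ΦB (D.hmul a y)) : x = y := by
  rw [← sum_uB_hmul_ΦB h x, ← sum_uB_hmul_ΦB h y]
  simp only [hxy]

theorem hmul_left_cancel_ΦB (h : IsFrobeniusHom D.B (D.toH.conj D.ΦB)) {x y : A}
    (hxy : ∀ a, D.ΦB (D.hmul x a) = D.ΦB (D.hmul y a)) : x = y := by
  rw [← sum_ΦB_hmul_vB h x, ← sum_ΦB_hmul_vB h y]
  simp only [hxy]

theorem vmul_right_cancel_ΦL (h : IsFrobeniusHom D.L (D.toV.conj D.ΦL)) {x y : A}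
    (hxy : ∀ a, D.ΦL (D.vmul a x) = D.ΦL (D.vmul a y)) : x = y :=
  hmul_right_cancel_ΦB (D := D.swap) h hxy

end Nondegenerate

/-! ### The candidate for the antipode. -/

section AntipodeMap

variable (hL : IsFrobeniusHom D.L (D.toV.conj D.ΦL))

/-- The only candidate for an antipode, `a ↦ ∑ x_j ∘ Φ_L(Φ_B(y_j ⋆ a))` for the dual basis
`∑ x_j ⊗ y_j` of `Φ_L`. -/
noncomputable def antipodeMap : A →ₗ[k] A :=
  ∑ j, D.vmul (uB (D := D.swap) hL j) ∘ₗ D.ΦL ∘ₗ D.ΦB ∘ₗ D.hmul (vB (D := D.swap) hL j)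

theorem antipodeMap_apply (a : A) : antipodeMap hL a = ∑ j, D.vmul (uB (D := D.swap) hL j)
    (D.ΦL (D.ΦB (D.hmul (vB (D := D.swap) hL j) a))) := by
  rw [antipodeMap, LinearMap.sum_apply]
  rfl

theorem sum_ΦL_vmul_vL (a : A) : ∑ j, D.vmul (D.ΦL (D.vmul a (uB (D := D.swap) hL j)))
    (vB (D := D.swap) hL j) = a :=
  sum_ΦB_hmul_vB (D := D.swap) hL a

/-- The functional Φ_L Φ_B(_ ⋆ w) is left L-linear, and the candidate is the element that represents
it through the dual basis of Φ_L. No antipode axiom is assumed here. -/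
theorem ΦL_vmul_antipodeMap (a w : A) :
    D.ΦL (D.vmul a (antipodeMap hL w)) = D.ΦL (D.ΦB (D.hmul a w)) := by
  conv_rhs => rw [← sum_ΦL_vmul_vL hL a]
  simp only [antipodeMap_apply, map_sum, LinearMap.sum_apply, ← ΦL_vmul_hmul, ΦB_vmul, ΦL_ΦL_vmul]
  exact Finset.sum_congr rfl fun j _ => by rw [← D.vmul_assoc, ΦL_vmul_ΦL]

/-- This says that `kappaR` sends S(w) to Φ_B(_ ⋆ w). It is the form in which the candidate enters
both equivalences below. -/
theorem ΦB_ΦL_vmul_antipodeMap (a w : A) :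
    D.ΦB (D.ΦL (D.vmul a (antipodeMap hL w))) = D.ΦB (D.hmul a w) := by
  rw [ΦL_vmul_antipodeMap, ΦB_ΦL_ΦB]

theorem antipodeMap_surjective (hB : IsFrobeniusHom D.B (D.toH.conj D.ΦB)) :
    Function.Surjective (antipodeMap hL) := by
  intro x
  -- The functional Φ_B Φ_L(_ ∘ x) is left B-linear, so the dual basis of Φ_B writes it as Φ_B(_ ⋆
  -- w) with this w. Nondegeneracy of Φ_L then forces S(w) = x.
  refine ⟨∑ j, D.hmul (uB hB j) (D.ΦB (D.ΦL (D.vmul (vB hB j) x))),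
    vmul_right_cancel_ΦL hL fun a => ?_⟩
  rw [ΦL_vmul_antipodeMap]
  conv_rhs => rw [← sum_ΦB_hmul_vB hB a]
  simp only [map_sum, LinearMap.sum_apply, ΦL_ΦB_hmul_vmul, ← D.hmul_assoc, ΦB_hmul_right,
    ΦL_hmul, ΦL_ΦB_ΦL]

end AntipodeMap

/-! ### Reduction of the antipode to two axioms for the candidate. -/

section Characterization

/-- The left axiom with a'' = i prescribes Φ_L(a ∘ S(w)) for all a, and Φ_L is nondegenerate. -/
theorem IsAntipode.eq_antipodeMap (hL : IsFrobeniusHom D.L (D.toV.conj D.ΦL)) {S : A →ₗ[k] A}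
    (hS : D.IsAntipode S) : S = antipodeMap hL := by
  refine LinearMap.ext fun w => vmul_right_cancel_ΦL hL fun a => ?_
  have := hS.left w a D.i
  rw [D.i_hmul] at this
  rw [ΦL_vmul_antipodeMap]
  exact this.symm

/-- A bijective map which satisfies two of the antipode axioms reverses both products, and so
satisfies the two others. -/
theorem isAntipode_of_bottom_of_left (hB : IsFrobeniusHom D.B (D.toH.conj D.ΦB))
    (hL : IsFrobeniusHom D.L (D.toV.conj D.ΦL)) {S : A →ₗ[k] A} (hS : Function.Surjective S)
    (bottom : ∀ a a' a'', D.ΦB (D.hmul a' (D.vmul a'' a)) = D.ΦB (D.hmul (D.vmul a' (S a)) a''))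
    (left : ∀ a a' a'', D.ΦL (D.vmul (D.hmul a' a) a'') = D.ΦL (D.vmul a' (D.hmul a'' (S a)))) :
    D.IsAntipode S := by
  -- In Φ_B(e ⋆ (c ∘ a ∘ b)) the bottom axiom can move a ∘ b across at once, or first b and then a.
  -- Comparing the two results against all c gives the reversal.
  have vmulS : ∀ a b, S (D.vmul a b) = D.vmul (S b) (S a) := fun a b =>
    hmul_left_cancel_ΦB hB fun c => by
      have h := bottom (D.vmul a b) D.e c
      rw [← D.vmul_assoc, bottom b, bottom a] at h
      simpa only [D.e_vmul] using h.symm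
  -- The same comparison with the left axiom, applied to Φ_L((c ⋆ a ⋆ b) ∘ i).
  have hmulS : ∀ a b, S (D.hmul a b) = D.hmul (S b) (S a) := fun a b =>
    vmul_right_cancel_ΦL hL fun c => by
      have h := left (D.hmul a b) c D.i
      rw [← D.hmul_assoc, left b, left a] at h
      simpa only [D.i_hmul] using h.symm
  -- If S(x) = e, then e = S(x ∘ e) = S(e) ∘ e = S(e). The horizontal unit is treated alike.
  have hSe : S D.e = D.e := by
    obtain ⟨x, hx⟩ := hS D.e
    have := vmulS x D.e
    rwa [D.vmul_e, hx, D.vmul_e, eq_comm] at this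
  have hSi : S D.i = D.i := by
    obtain ⟨x, hx⟩ := hS D.i
    have := hmulS x D.i
    rwa [D.hmul_i, hx, D.hmul_i, eq_comm] at this
  have hSB : ∀ a, S (D.ΦB a) = D.ΦT (S a) := fun a =>
    (vmulS a D.i).trans (congrArg (fun x => D.vmul x (S a)) hSi)
  have hSL : ∀ a, S (D.ΦL a) = D.ΦR (S a) := fun a =>
    (hmulS a D.e).trans (congrArg (fun x => D.hmul x (S a)) hSe)
  refine ⟨bottom, fun a a' a'' => ?_, left, fun a a' a'' => ?_⟩
  -- S turns the left axiom at (a, a'', a') into the right axiom at (S a, S a', S a''), which is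
  -- general by surjectivity. The top axiom comes from the bottom one in the same way.
  · obtain ⟨a, rfl⟩ := hS a
    obtain ⟨a', rfl⟩ := hS a'
    obtain ⟨a'', rfl⟩ := hS a''
    simpa only [hSL, vmulS, hmulS] using congrArg S (left a a'' a')
  · obtain ⟨a, rfl⟩ := hS a
    obtain ⟨a', rfl⟩ := hS a'
    obtain ⟨a'', rfl⟩ := hS a''
    simpa only [hSB, vmulS, hmulS] using congrArg S (bottom a a'' a')

/-- There is an antipode if and only if the candidate satisfies two of the antipode axioms. -/
theorem exists_isAntipode_iff (hB : IsFrobeniusHom D.B (D.toH.conj D.ΦB))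
    (hL : IsFrobeniusHom D.L (D.toV.conj D.ΦL)) :
    (∃ S : A →ₗ[k] A, D.IsAntipode S) ↔
      (∀ a a' a'', D.ΦB (D.hmul a' (D.vmul a'' a)) =
        D.ΦB (D.hmul (D.vmul a' (antipodeMap hL a)) a'')) ∧
      ∀ a a' a'', D.ΦL (D.vmul (D.hmul a' a) a'') =
        D.ΦL (D.vmul a' (D.hmul a'' (antipodeMap hL a))) := by
  constructor
  · rintro ⟨S, hS⟩
    obtain rfl := hS.eq_antipodeMap hL
    exact ⟨hS.bottom, hS.left⟩
  · rintro ⟨hb, hl⟩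
    exact ⟨_, isAntipode_of_bottom_of_left hB hL (antipodeMap_surjective hL hB) hb hl⟩

end Characterization

/-! ### Products in the duals, and the base isomorphism. -/

section Kappa

variable (hB : IsFrobeniusHom D.B (D.toH.conj D.ΦB)) (hL : IsFrobeniusHom D.L (D.toV.conj D.ΦL))

theorem leftDual_ext {φ ψ : (VB hB).LeftDual}
    (h : ∀ a, D.valB (φ (D.toV a)) = D.valB (ψ (D.toV a))) : φ = ψ :=
  LeftAlmostBialgebroid.LeftDual.ext fun a => D.valB_injective (h (D.toV.symm a))

theorem rightDual_ext {φ ψ : (VB hB).RightDual}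
    (h : ∀ a, D.valB (φ (D.toV a)) = D.valB (ψ (D.toV a))) : φ = ψ :=
  LeftAlmostBialgebroid.RightDual.ext fun a => D.valB_injective (h (D.toV.symm a))

/-- The product of the dual computed on the dual basis representative of Δ_B(a), with the source
action of B rewritten as left horizontal multiplication. -/
theorem leftDual_mul_apply (φ ψ : (VB hB).LeftDual) (a : A) :
    D.valB ((φ * ψ) (D.toV a)) = ∑ j, D.valB (ψ (D.toV
      (D.hmul (D.valB (φ (D.toV (D.hmul a (uB hB j))))) (vB hB j)))) := by
  refine (congrArg D.valB ((LeftAlmostBialgebroid.LeftDual.mul_apply φ ψ _ _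
    (comulB_apply hB a).symm).trans (map_sum (LeftAlmostBialgebroid.LeftDual.ev φ ψ) _ _))).trans
    ((map_sum D.valB _ _).trans (Finset.sum_congr rfl fun j _ => ?_))
  exact congrArg (fun x => D.valB (ψ x)) (D.sourceB_mul _ _)

/-- Here the target action is the one that occurs; it is right horizontal multiplication. -/
theorem rightDual_mul_apply (φ ψ : (VB hB).RightDual) (a : A) :
    D.valB ((φ * ψ) (D.toV a)) = ∑ j, D.valB (ψ (D.toV
      (D.hmul (D.hmul a (uB hB j)) (D.valB (φ (D.toV (vB hB j))))))) := by
  refine (congrArg D.valB ((LeftAlmostBialgebroid.RightDual.mul_apply φ ψ _ _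
    (comulB_apply hB a).symm).trans (map_sum (LeftAlmostBialgebroid.RightDual.ev φ ψ) _ _))).trans
    ((map_sum D.valB _ _).trans (Finset.sum_congr rfl fun j _ => ?_))
  exact congrArg (fun x => D.valB (ψ x)) (D.targetB_mul _ _)

/-- Left vertical multiplication by an element l of L is multiplication by the source of Φ_B(l), so
the left B-linearity of φ is also a linearity over L. -/
theorem rightDual_apply_ΦL_vmul (φ : (VB hB).RightDual) (c a : A) :
    D.valB (φ (D.toV (D.vmul (D.ΦL c) a))) = D.hmul (D.ΦB (D.ΦL c)) (D.valB (φ (D.toV a))) := by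
  rw [ΦL_vmul]
  exact congrArg D.valB ((congrArg φ (D.sourceB_mul (D.inB (D.ΦL c)) a).symm).trans
    (LeftAlmostBialgebroid.RightDual.apply_s_mul φ _ _))

theorem exists_ΦL (l : D.L) : ∃ a, D.toV (D.ΦL a) = l.1 := by
  obtain ⟨_, _, ⟨a, rfl⟩, rfl⟩ := l
  exact ⟨a, rfl⟩

theorem valB_ΦBL (l : D.L) : D.valB (D.ΦBL l) = D.ΦB (D.toV.symm l.1) := rfl

/-- The inverse is Φ_L restricted to B: Φ_L Φ_B is the identity on L and Φ_B Φ_L is the identity on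
B. -/
theorem ΦBL_bijective : Function.Bijective D.ΦBL := by
  constructor
  · intro l l' hll
    obtain ⟨a, ha⟩ := exists_ΦL l
    obtain ⟨b, hb⟩ := exists_ΦL l'
    have h := congrArg (D.ΦL ∘ D.valB) hll
    simp only [Function.comp_apply, valB_ΦBL, ← ha, ← hb, LinearEquiv.symm_apply_apply,
      ΦL_ΦB_ΦL] at h
    exact Subtype.ext (ha.symm.trans ((congrArg D.toV h).trans hb))
  · intro b
    refine ⟨⟨D.toV (D.ΦL (D.valB b)), ⟨_, ⟨_, rfl⟩, rfl⟩⟩, D.valB_injective ?_⟩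
    exact D.ΦB_ΦL_valB b

theorem ΦBL_one : D.ΦBL 1 = 1 := D.valB_injective (D.e_vmul _)

theorem ΦBL_mul (l l' : D.L) : D.ΦBL (l * l') = D.ΦBL l * D.ΦBL l' := by
  refine D.valB_injective ?_
  obtain ⟨a, ha⟩ := exists_ΦL l
  rw [valB_mul, valB_ΦBL, valB_ΦBL, valB_ΦBL, ← ha]
  change D.ΦB (D.vmul (D.toV.symm l.1) (D.toV.symm l'.1)) = _
  rw [← ha, LinearEquiv.symm_apply_apply, ΦL_vmul, ΦB_hmul_left]

/-! ### Bijectivity of the two maps from H^op. -/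

theorem kappaL_bijective : Function.Bijective (kappaL hB) := by
  constructor
  · intro x y hxy
    obtain ⟨x, rfl⟩ := op_surjective x
    obtain ⟨y, rfl⟩ := op_surjective y
    obtain ⟨x, rfl⟩ := D.toH.surjective x
    obtain ⟨y, rfl⟩ := D.toH.surjective y
    refine congrArg (fun a => op (D.toH a)) (hmul_left_cancel_ΦB hB fun a => ?_)
    rw [← kappaL_apply hB, hxy, kappaL_apply]
  · intro φ
    -- A right B-linear φ is determined by its values on the u_k, since a = ∑ u_k ⋆ Φ_B(v_k ⋆ a).
    -- This gives φ(a) = ∑ φ(u_k) ⋆ Φ_B(v_k ⋆ a), and the left B-linearity of Φ_B collects the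
    -- representing element.
    refine ⟨op (D.toH (∑ j, D.hmul (D.valB (φ (D.toV (uB hB j)))) (vB hB j))), ?_⟩
    refine leftDual_ext hB fun a => ?_
    rw [kappaL_apply]
    conv_rhs => rw [← sum_uB_hmul_ΦB hB a]
    simp only [map_sum, LinearMap.sum_apply, D.hmul_assoc, ΦB_valB_hmul]
    refine Finset.sum_congr rfl fun j _ => ?_
    rw [← valB_inB, ← targetB_mul, ← valB_mul]
    exact congrArg D.valB (LeftAlmostBialgebroid.LeftDual.apply_t_mul φ _ _).symm

theorem kappaR_bijective (hL : IsFrobeniusHom D.L (D.toV.conj D.ΦL)) :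
    Function.Bijective (kappaR hB) := by
  constructor
  · intro x y hxy
    obtain ⟨x, rfl⟩ := op_surjective x
    obtain ⟨y, rfl⟩ := op_surjective y
    obtain ⟨x, rfl⟩ := D.toH.surjective x
    obtain ⟨y, rfl⟩ := D.toH.surjective y
    refine congrArg (fun a => op (D.toH a)) (vmul_right_cancel_ΦL hL fun a => ?_)
    -- The outer Φ_B in `kappaR` loses nothing, because it is injective on L; this reduces
    -- injectivity to nondegeneracy of Φ_L.
    rw [← ΦL_ΦB_ΦL, ← kappaR_apply hB, hxy, kappaR_apply, ΦL_ΦB_ΦL]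
  · intro φ
    -- Transporting φ to L through Φ_L gives a left L-linear functional, which the dual basis of Φ_L
    -- represents by this element.
    refine ⟨op (D.toH (∑ j, D.vmul (uB (D := D.swap) hL j)
      (D.ΦL (D.valB (φ (D.toV (vB (D := D.swap) hL j))))))), ?_⟩
    refine rightDual_ext hB fun a => ?_
    rw [kappaR_apply]
    conv_rhs => rw [← sum_ΦL_vmul_vL hL a]
    simp only [map_sum, ← D.vmul_assoc, ΦL_vmul_ΦL]
    refine Finset.sum_congr rfl fun j _ => ?_
    rw [rightDual_apply_ΦL_vmul, ΦL_vmul, ΦB_hmul_left, ΦB_ΦL_valB]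

/-! ### Compatibilities that hold without an antipode. -/

/-- Δ_B is built from the dual basis of Φ_B, so the sum defining the product of the functionals
collapses: ∑ Φ_B(x ⋆ a ⋆ u_k) ⋆ v_k = x ⋆ a. The result Φ_B(y ⋆ x ⋆ a) has the factors in the order
of H^op. -/
theorem kappaL_mul (x y : (D.H)ᵐᵒᵖ) : kappaL hB (x * y) = kappaL hB x * kappaL hB y := by
  obtain ⟨x, rfl⟩ := op_surjective x
  obtain ⟨y, rfl⟩ := op_surjective y
  obtain ⟨x, rfl⟩ := D.toH.surjective x
  obtain ⟨y, rfl⟩ := D.toH.surjective y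
  refine leftDual_ext hB fun a => ?_
  rw [leftDual_mul_apply, ← op_mul, toH_mul, kappaL_apply]
  simp only [kappaL_apply, ← D.hmul_assoc x]
  rw [← map_sum, ← map_sum, sum_ΦB_hmul_vB, D.hmul_assoc]

theorem kappaL_one : kappaL hB 1 = 1 := by
  exact leftDual_ext hB fun a => (congrArg D.ΦB (D.i_hmul a))

/-- Φ_T(l) ⋆ a = a ∘ l for l in L, and under Φ_B the factor l may be replaced by Φ_R Φ_B(l), the
target of Φ_B(l). -/
theorem kappaL_s (l : D.L) : kappaL hB ((HLop hL).s l) = (leftDualVB hB).s (D.ΦBL l) := by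
  refine leftDual_ext hB fun a => ?_
  obtain ⟨c, hc⟩ := exists_ΦL l
  rw [HLop_s_apply, kappaL_apply, ← hc, LinearEquiv.symm_apply_apply, ← vmul_ΦL,
    ← ΦB_vmul_ΦR_ΦB]
  exact congrArg (fun x => D.ΦB (D.vmul a (D.ΦR (D.ΦB (D.toV.symm x))))) hc

theorem kappaL_t (l : D.L) :
    kappaL hB ((HLop hL).t (op l)) = (leftDualVB hB).t (op (D.ΦBL l)) := by
  refine leftDual_ext hB fun a => ?_
  rw [HLop_t_apply, kappaL_apply, ΦB_hmul_left]
  rfl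

theorem kappaL_counit (x : (D.H)ᵐᵒᵖ) :
    (leftDualVB hB).counit (kappaL hB x) = D.ΦBL ((HLop hL).counit x) := rfl

theorem kappaR_one : kappaR hB 1 = 1 := by
  exact rightDual_ext hB fun a => (D.ΦB_ΦL_ΦB a)

/-- a ∘ Φ_T(l) = Φ_B(a) ∘ l by associativity. Then Φ_L turns this into Φ_B(a) ⋆ l, from which Φ_B
splits off its left factor in B. -/
theorem kappaR_s (l : D.L) : kappaR hB ((HLop hL).s l) = (rightDualVB hB).s (D.ΦBL l) := by
  refine rightDual_ext hB fun a => ?_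
  obtain ⟨c, hc⟩ := exists_ΦL l
  rw [HLop_s_apply, kappaR_apply]
  have h : D.valB ((rightDualVB hB).s (D.ΦBL l) (D.toV a)) =
      D.hmul (D.ΦB a) (D.ΦB (D.toV.symm l.1)) := rfl
  rw [h, ← hc, LinearEquiv.symm_apply_apply, ← ΦB_hmul_left, ← ΦL_vmul_ΦB]
  exact congrArg (fun x => D.ΦB (D.ΦL x)) (D.vmul_assoc _ _ _).symm

theorem kappaR_t (l : D.L) :
    kappaR hB ((HLop hL).t (op l)) = (rightDualVB hB).t (op (D.ΦBL l)) := by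
  refine rightDual_ext hB fun a => ?_
  rw [HLop_t_apply, kappaR_apply, ← ΦB_vmul, ΦB_ΦL_ΦB, ← ΦB_vmul_ΦL_ΦB]
  rfl

theorem kappaR_counit (x : (D.H)ᵐᵒᵖ) :
    (rightDualVB hB).counit (kappaR hB x) = D.ΦBL ((HLop hL).counit x) := by
  obtain ⟨x, rfl⟩ := op_surjective x
  obtain ⟨x, rfl⟩ := D.toH.surjective x
  refine D.valB_injective ?_
  exact congrArg (fun y => D.ΦB (D.ΦL y)) (D.e_vmul x)

/-! ### The two compatibilities that encode antipode axioms. -/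

/-- The comultiplications agree on `x` if and only if the bottom antipode axiom holds at `x`. -/
theorem kappaL_comul_iff (x : A) :
    (∀ z, BTensor.mk _ _ z = (HLop hL).comul (op (D.toH x)) →
      (leftDualVB hB).comul (kappaL hB (op (D.toH x))) =
        BTensor.mk _ _ (TensorProduct.map (kappaL hB) (kappaL hB) z)) ↔
    ∀ a a', D.ΦB (D.hmul x (D.vmul a' a)) =
      D.ΦB (D.hmul (D.vmul x (antipodeMap hL a)) a') := by
  obtain ⟨n, p, q, hpq, hx⟩ := HLop_comul_apply hL x
  -- The pairing of the image of Δ_L(x) = ∑ x ∘ p_j ⊗ q_j with a', a. Expanding S(a) = ∑ p_j ∘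
  -- Φ_L(q_j ∘ S(a)) on the other side, both become ∑ ((x ∘ p_j) ⋆ a') ∘ Φ_B(q_j ⋆ a).
  have key : ∀ a a', D.valB (LeftAlmostBialgebroid.LeftDual.pair (P := VB hB) (D.toV a') (D.toV a)
      (TensorProduct.map (kappaL hB) (kappaL hB)
        (∑ j, op (D.toH (D.vmul x (p j))) ⊗ₜ[k] op (D.toH (q j))))) =
      D.ΦB (D.hmul (D.vmul x (antipodeMap hL a)) a') := by
    intro a a'
    have hterm : ∀ j, D.valB (LeftAlmostBialgebroid.LeftDual.pair (P := VB hB) (D.toV a') (D.toV a)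
        (kappaL hB (op (D.toH (D.vmul x (p j)))) ⊗ₜ[k] kappaL hB (op (D.toH (q j))))) =
        D.ΦB (D.hmul (D.vmul x (p j)) (D.vmul a' (D.ΦR (D.ΦB (D.hmul (q j) a))))) := fun j => rfl
    simp only [map_sum, TensorProduct.map_tmul, hterm, ΦB_hmul_vmul_ΦR]
    conv_rhs => rw [← hpq.2 (antipodeMap hL a)]
    simp only [map_sum, LinearMap.sum_apply, ← D.vmul_assoc, vmul_ΦL_hmul]
    refine Finset.sum_congr rfl fun j _ => ?_
    rw [ΦB_vmul, ΦB_vmul, ΦB_ΦL_vmul_antipodeMap]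
  have hiff := LeftAlmostBialgebroid.LeftDual.DualBasis.mk_eq_comul_iff (rightDualBasisVB hB)
    (kappaL hB (op (D.toH x))) (TensorProduct.map (kappaL hB) (kappaL hB)
        (∑ j, op (D.toH (D.vmul x (p j))) ⊗ₜ[k] op (D.toH (q j))))
  constructor
  · intro H a a'
    rw [← key, hiff.1 (H _ hx.symm).symm (D.toV a') (D.toV a)]
    rfl
  · intro H z hz
    -- Replaces the arbitrary representative z by the dual basis representative of Δ_L(x), for which
    -- `key` was computed.
    refine Eq.trans ?_ (RightAlmostBialgebroid.mk_map_congr (HLop hL) (leftDualVB hB) (kappaL hB)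
      D.ΦBL (kappaL_mul hB) (kappaL_s hB hL) (kappaL_t hB hL) (hx.symm.trans hz.symm))
    refine (hiff.2 fun a' a => ?_).symm
    obtain ⟨a, rfl⟩ := D.toV.surjective a
    obtain ⟨a', rfl⟩ := D.toV.surjective a'
    refine D.valB_injective ?_
    rw [key, ← H]
    rfl

/-- The products of `x` and `y` agree if and only if the left antipode axiom holds at them. -/
theorem kappaR_mul_iff (w y : A) :
    kappaR hB (op (D.toH (antipodeMap hL w)) * op (D.toH y)) =
        kappaR hB (op (D.toH (antipodeMap hL w))) * kappaR hB (op (D.toH y)) ↔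
      ∀ a, D.ΦL (D.vmul (D.hmul a w) y) = D.ΦL (D.vmul a (D.hmul y (antipodeMap hL w))) := by
  -- Writing the first factor as S(w) makes its functional Φ_B(_ ⋆ w). The sum over Δ_B(a) then
  -- collapses, since ∑ a ⋆ u_k ⋆ Φ_B(v_k ⋆ w) = a ⋆ w.
  have key : ∀ a, D.valB ((kappaR hB (op (D.toH (antipodeMap hL w))) * kappaR hB (op (D.toH y)))
      (D.toV a)) = D.ΦB (D.ΦL (D.vmul (D.hmul a w) y)) := by
    intro a
    rw [rightDual_mul_apply]
    simp only [kappaR_apply, ΦB_ΦL_vmul_antipodeMap, D.hmul_assoc]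
    conv_rhs => rw [← sum_uB_hmul_ΦB hB w]
    simp only [map_sum, LinearMap.sum_apply]
  constructor
  · intro H a
    have h := key a
    rw [← H, ← op_mul, toH_mul, kappaR_apply] at h
    -- Φ_B is cancelled by its injectivity on L.
    rw [← ΦL_ΦB_ΦL, ← h, ΦL_ΦB_ΦL]
  · intro H
    refine rightDual_ext hB fun a => ?_
    rw [key, H, ← op_mul, toH_mul, kappaR_apply]

/-- The pairing with a', a is ∑ Φ_B Φ_L(a' ∘ Φ_L(a ∘ x ∘ p_j) ∘ q_j), which the dual basis identity
of Φ_L contracts to Φ_B Φ_L(a' ∘ a ∘ x). Multiplicativity enters only to make the tensor square of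
`kappaR` independent of the representative z. -/
theorem kappaR_comul (hmul : ∀ x y, kappaR hB (x * y) = kappaR hB x * kappaR hB y) (x : A)
    (z : (D.H)ᵐᵒᵖ ⊗[k] (D.H)ᵐᵒᵖ) (hz : BTensor.mk _ _ z = (HLop hL).comul (op (D.toH x))) :
    (rightDualVB hB).comul (kappaR hB (op (D.toH x))) =
      BTensor.mk _ _ (TensorProduct.map (kappaR hB) (kappaR hB) z) := by
  obtain ⟨n, p, q, hpq, hx⟩ := HLop_comul_apply hL x
  refine Eq.trans ?_ (RightAlmostBialgebroid.mk_map_congr (HLop hL) (rightDualVB hB) (kappaR hB)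
    D.ΦBL hmul (kappaR_s hB hL) (kappaR_t hB hL) (hx.symm.trans hz.symm))
  refine ((LeftAlmostBialgebroid.RightDual.DualBasis.mk_eq_comul_iff (leftDualBasisVB hB)
    (kappaR hB (op (D.toH x))) _).2 fun a' a => ?_).symm
  obtain ⟨a, rfl⟩ := D.toV.surjective a
  obtain ⟨a', rfl⟩ := D.toV.surjective a'
  refine D.valB_injective ?_
  have hterm : ∀ j, D.valB (LeftAlmostBialgebroid.RightDual.pair (P := VB hB) (D.toV a') (D.toV a)
      (kappaR hB (op (D.toH (D.vmul x (p j)))) ⊗ₜ[k] kappaR hB (op (D.toH (q j))))) =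
      D.ΦB (D.ΦL (D.vmul (D.vmul a' (D.ΦL (D.ΦB (D.ΦL (D.vmul a (D.vmul x (p j)))))))
        (q j))) := fun j => rfl
  simp only [map_sum, TensorProduct.map_tmul, hterm, ΦL_ΦB_ΦL]
  simp only [D.vmul_assoc]
  rw [← map_sum, ← map_sum, ← map_sum]
  have h := hpq.1 (D.vmul a x)
  simp only [D.vmul_assoc] at h
  rw [h, toV_mul, kappaR_apply, D.vmul_assoc]

/-! ### Assembly of the two isomorphism criteria. -/

/-- `(κ, Φ_B|_L)` is an isomorphism onto the left dual if and only if the bottom antipode axiom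
holds. -/
theorem isIso_kappaL_iff :
    RightAlmostBialgebroid.IsIso (HLop hL) (leftDualVB hB) (kappaL hB) D.ΦBL ↔
      ∀ a a' a'', D.ΦB (D.hmul a' (D.vmul a'' a)) =
        D.ΦB (D.hmul (D.vmul a' (antipodeMap hL a)) a'') := by
  constructor
  · intro H a a' a''
    exact (kappaL_comul_iff hB hL a').1 (H.map_comul _) a a''
  · intro H
    exact
      { bijective_total := kappaL_bijective hB
        bijective_base := ΦBL_bijective
        map_one := kappaL_one hB
        map_mul := kappaL_mul hB
        map_base_one := ΦBL_one
        map_base_mul := ΦBL_mul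
        map_s := kappaL_s hB hL
        map_t := kappaL_t hB hL
        map_comul := fun x => (kappaL_comul_iff hB hL (D.toH.symm x.unop)).2 fun a => H a _
        map_counit := kappaL_counit hB hL }

/-- `(κ, Φ_B|_L)` is an isomorphism onto the right dual if and only if the left antipode axiom
holds. -/
theorem isIso_kappaR_iff :
    RightAlmostBialgebroid.IsIso (HLop hL) (rightDualVB hB) (kappaR hB) D.ΦBL ↔
      ∀ a a' a'', D.ΦL (D.vmul (D.hmul a' a) a'') =
        D.ΦL (D.vmul a' (D.hmul a'' (antipodeMap hL a))) := by
  constructor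
  · intro H a a' a''
    exact (kappaR_mul_iff hB hL a a'').1 (H.map_mul _ _) a'
  · intro H
    have hmul : ∀ x y, kappaR hB (x * y) = kappaR hB x * kappaR hB y := by
      intro x y
      -- The criterion for products is available only for first factors of the form S(w);
      -- surjectivity of S covers every x.
      obtain ⟨w, hw⟩ := antipodeMap_surjective hL hB (D.toH.symm x.unop)
      have h := (kappaR_mul_iff hB hL w (D.toH.symm y.unop)).2 fun a => H w a _
      rw [hw] at h
      exact h
    exact
      { bijective_total := kappaR_bijective hB hL
        bijective_base := ΦBL_bijective
        map_one := kappaR_one hB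
        map_mul := hmul
        map_base_one := ΦBL_one
        map_base_mul := ΦBL_mul
        map_s := kappaR_s hB hL
        map_t := kappaR_t hB hL
        map_comul := fun x => kappaR_comul hB hL hmul (D.toH.symm x.unop)
        map_counit := kappaR_counit hB hL }

end Kappa

end DoubleAlgebra

theorem mainTheorem8 {k A : Type*} [CommRing k] [AddCommGroup A] [Module k A]
    (D : DoubleAlgebra k A) (hD : D.IsFrobenius) :
    (RightAlmostBialgebroid.IsIso (DoubleAlgebra.HLop hD.frobL) (DoubleAlgebra.leftDualVB hD.frobB)
        (DoubleAlgebra.kappaL hD.frobB) D.ΦBL ∧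
      RightAlmostBialgebroid.IsIso (DoubleAlgebra.HLop hD.frobL)
        (DoubleAlgebra.rightDualVB hD.frobB) (DoubleAlgebra.kappaR hD.frobB) D.ΦBL) ↔
      ∃ S : A →ₗ[k] A, D.IsAntipode S := by
  rw [DoubleAlgebra.exists_isAntipode_iff hD.frobB hD.frobL, DoubleAlgebra.isIso_kappaL_iff,
    DoubleAlgebra.isIso_kappaR_iff]
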